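/- Let $\mathcal{X}$ be a measurable space, $P$ a probability distribution on $\mathcal{X}\times\mathbb{R}$ with first marginal $P_X$, and $(X_1,Y_1),\dots,(X_n,Y_n)$, $n\ge 1$, an i.i.d. sample from $P$; put $\mathbf{Y}=(Y_1,\dots,Y_n)^\top$. Let $f^*\in L^2(P_X)$ be the regression function, $\mathbb{E}[Y\mid X]=f^*(X)$. Let $k$ be the measurable kernel of a separable real reproducing kernel Hilbert space of functions on $\mathcal{X}$, with $k(x,x)\le\kappa$ for all $x$, where $\kappa>0$, and let $K:L^2(P_X)\to L^2(P_X)$, $(Kg)(x)=\int k(x,y)g(y)\,dP_X(y)$. Let $K_n=\frac1n(k(X_i,X_j))_{i,j}$, $\|a\|_{K_n}^2=\frac1n a^\top K_n a$, and $f_\alpha=\frac1n\sum_{i=1}^n\alpha_i k(X_i,\cdot)$ for $\alpha\in\mathbb{R}^n$. For $m\ge 0$ let $\alpha_m$ minimize $\|\mathbf{Y}-K_n\alpha\|_{K_n}$ over $\alpha\in\mathrm{span}\{\mathbf{Y},K_n\mathbf{Y},\dots,K_n^{m-1}\mathbf{Y}\}$ (conjugate gradient; $\alpha_0=0$), let $q_m$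 be a polynomial of degree at most $m-1$ with $\alpha_m=q_m(K_n)\mathbf{Y}$ ($q_0=0$), and let $f_m=f_{\alpha_m}$. For $\tau>1$, $0<\gamma<1$ and $M>0$ put $$\Lambda_m=4\tau\sqrt{\frac{\kappa\log(2\gamma^{-1})}{n}}\Big(\sqrt{\kappa}\,\|\alpha_m\|_{K_n}+M\sqrt{\log(2\gamma^{-1})}\Big),\qquad \delta=4\kappa\sqrt{\frac{\log(2\gamma^{-1})}{n}},$$ let $\widehat m$ be the first $m\ge 0$ with $\|(f_m(X_1),\dots,f_m(X_n))^\top-\mathbf{Y}\|_{K_n}<\Lambda_m$, and let $\widetilde m=\max(0,\widehat m-1)$ if $q_{\widehat m}(0)\ge\frac{1}{2\tau\delta}$ and $\widetilde m=\widehat m$ otherwise. **Theorem.** For all $r\ge 1/2$ and $\tau>1$ there is a constant $c(r,\tau)$, depending only on $r$ and $\tau$, such that the following holds in every setting as above. If $|Y|\le M$ almost surely and $f^*=K^r u$ for some $u\in L^2(P_X)$ with $\|u\|\le\kappa^{-r}\rho$, then, with probability at least $1-2\gamma$, the iterates exist, $\widehat m$ is finite, and $$\|f_{\widetilde m}-f^*\|_{L^2(P_X)}^2\le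 c(r,\tau)\,(M+\rho)^2\Big(\frac{\log^2\gamma^{-1}}{n}\Big)^{\frac{2r}{2r+1}}.$$ The stopping rule does not involve $r$ or $\rho$, so it adapts to $r$. -/

import Mathlib

open MeasureTheory ProbabilityTheory Polynomial
open scoped ENNReal Matrix

universe u v

/-! ### The kernel and its integral operator -/

/-- The scalar kernel `k(x, y) = ⟨k(x, ·), k(y, ·)⟩` of a real reproducing kernel Hilbert space
`H` of functions on `𝒳`. -/
noncomputable def rkhsKernel {𝒳 : Type u} (H : Type v) [NormedAddCommGroup H]
    [InnerProductSpace ℝ H] [CompleteSpace H] [RKHS ℝ H 𝒳 ℝ] (x y : 𝒳) : ℝ :=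
  RKHS.kernel H x y (1 : ℝ)

section Operator

variable {𝒳 : Type u} [MeasurableSpace 𝒳]

/-- `x ↦ ∫ k(x, y) g(y) dν(y)` is square integrable if `k` is measurable and bounded. -/
theorem memLp_kernelIntegral {ν : Measure 𝒳} [IsProbabilityMeasure ν] {k : 𝒳 → 𝒳 → ℝ}
    (hk : Measurable (Function.uncurry k)) {B : ℝ} (hB : ∀ x y, |k x y| ≤ B) (g : Lp ℝ 2 ν) :
    MemLp (fun x => ∫ y, k x y * g y ∂ν) 2 ν := by
  have hg : Integrable g ν := (Lp.memLp g).integrable (by norm_num)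
  have hgm : StronglyMeasurable g := Lp.stronglyMeasurable g
  have hm : StronglyMeasurable (fun x => ∫ y, k x y * g y ∂ν) := by
    refine StronglyMeasurable.integral_prod_right (f := fun x y => k x y * g y) ?_
    exact (hk.stronglyMeasurable).mul (hgm.comp_measurable measurable_snd)
  refine MemLp.of_bound hm.aestronglyMeasurable (B * ∫ y, ‖g y‖ ∂ν)
    (Filter.Eventually.of_forall fun x => ?_)
  rw [← integral_const_mul]
  refine norm_integral_le_of_norm_le (hg.norm.const_mul B) (Filter.Eventually.of_forall fun y => ?_)
  rw [norm_mul]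
  exact mul_le_mul_of_nonneg_right (hB x y) (norm_nonneg _)

theorem integrable_kernel_mul {ν : Measure 𝒳} [IsProbabilityMeasure ν] {k : 𝒳 → 𝒳 → ℝ}
    (hk : Measurable (Function.uncurry k)) {B : ℝ} (hB : ∀ x y, |k x y| ≤ B) (g : Lp ℝ 2 ν)
    (x : 𝒳) : Integrable (fun y => k x y * g y) ν := by
  have hg : Integrable g ν := (Lp.memLp g).integrable (by norm_num)
  refine hg.bdd_mul (c := B) ?_ (Filter.Eventually.of_forall fun y => hB x y)
  exact (hk.comp measurable_prodMk_left).aestronglyMeasurable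

/-- The kernel integral operator `K : L²(ν) → L²(ν)`, `(K g)(x) = ∫ k(x, y) g(y) dν(y)`. -/
noncomputable def kernelOp (ν : Measure 𝒳) [IsProbabilityMeasure ν] (k : 𝒳 → 𝒳 → ℝ)
    (hk : Measurable (Function.uncurry k)) (B : ℝ) (hB : ∀ x y, |k x y| ≤ B) :
    Lp ℝ 2 ν →L[ℝ] Lp ℝ 2 ν :=
  LinearMap.mkContinuous
    { toFun := fun g => (memLp_kernelIntegral hk hB g).toLp _
      map_add' := fun g h => by
        rw [← MemLp.toLp_add]
        refine MemLp.toLp_congr _ _ (Filter.Eventually.of_forall fun x => ?_)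
        simp only [Pi.add_apply]
        rw [← integral_add (integrable_kernel_mul hk hB g x) (integrable_kernel_mul hk hB h x)]
        refine integral_congr_ae ?_
        filter_upwards [Lp.coeFn_add g h] with y hy
        rw [hy, Pi.add_apply, mul_add]
      map_smul' := fun c g => by
        rw [RingHom.id_apply, ← MemLp.toLp_const_smul]
        refine MemLp.toLp_congr _ _ (Filter.Eventually.of_forall fun x => ?_)
        simp only [Pi.smul_apply, smul_eq_mul]
        rw [← integral_const_mul]
        refine integral_congr_ae ?_
        filter_upwards [Lp.coeFn_smul c g] with y hy
        rw [hy, Pi.smul_apply, smul_eq_mul]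
        ring }
    B (fun g => by
      obtain ⟨x₀⟩ : Nonempty 𝒳 := nonempty_of_isProbabilityMeasure ν
      have hB0 : 0 ≤ B := (abs_nonneg _).trans (hB x₀ x₀)
      have hg : Integrable g ν := (Lp.memLp g).integrable (by norm_num)
      have h1 : ∫ y, ‖g y‖ ∂ν ≤ ‖g‖ := by
        rw [integral_norm_eq_lintegral_enorm hg.1, ← eLpNorm_one_eq_lintegral_enorm, Lp.norm_def]
        exact ENNReal.toReal_mono (Lp.eLpNorm_ne_top g)
          (eLpNorm_le_eLpNorm_of_exponent_le (by norm_num) hg.1)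
      have h2 : ∀ᵐ x ∂ν, ‖((memLp_kernelIntegral hk hB g).toLp _ : Lp ℝ 2 ν) x‖ ≤ B * ‖g‖ := by
        filter_upwards [(memLp_kernelIntegral hk hB g).coeFn_toLp] with x hx
        rw [hx]
        calc ‖∫ y, k x y * g y ∂ν‖ ≤ ∫ y, B * ‖g y‖ ∂ν := by
              refine norm_integral_le_of_norm_le (hg.norm.const_mul B)
                (Filter.Eventually.of_forall fun y => ?_)
              rw [norm_mul]
              exact mul_le_mul_of_nonneg_right (hB x y) (norm_nonneg _)
          _ = B * ∫ y, ‖g y‖ ∂ν := integral_const_mul _ _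
          _ ≤ B * ‖g‖ := mul_le_mul_of_nonneg_left h1 hB0
      have h3 := Lp.norm_le_of_ae_bound (by positivity) h2
      simpa [measureUnivNNReal] using h3)

end Operator

/-- A kernel with `k(x, x) ≤ κ` satisfies `|k(x, y)| ≤ κ` (Cauchy–Schwarz). -/
theorem abs_rkhsKernel_le {𝒳 : Type u} {H : Type v} [NormedAddCommGroup H]
    [InnerProductSpace ℝ H] [CompleteSpace H] [RKHS ℝ H 𝒳 ℝ] {κ : ℝ}
    (hκ : ∀ x : 𝒳, rkhsKernel H x x ≤ κ) (x y : 𝒳) : |rkhsKernel H x y| ≤ κ := by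
  have hin : ∀ a b : 𝒳, rkhsKernel H a b
      = inner ℝ (RKHS.kerFun H b (1 : ℝ)) (RKHS.kerFun H a (1 : ℝ)) := fun a b => by
    rw [← RKHS.kernel_inner]; simp [rkhsKernel]
  have hs : ∀ a : 𝒳, ‖RKHS.kerFun H a (1 : ℝ)‖ ^ 2 ≤ κ := fun a => by
    have := hκ a
    rwa [hin, real_inner_self_eq_norm_sq] at this
  rw [hin]
  refine (abs_real_inner_le_norm _ _).trans ?_
  nlinarith [hs x, hs y,
    sq_nonneg (‖RKHS.kerFun H y (1 : ℝ)‖ - ‖RKHS.kerFun H x (1 : ℝ)‖)]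

/-- `g = A ^ r u` for a compact positive self-adjoint operator `A` and `r > 0`, read off the
spectral decomposition `A = ∑ μ P_μ`, with `P_μ` the orthogonal projection onto the eigenspace
`ker (A - μ)`: `A ^ r u = ∑ μ ^ r P_μ u`, where only eigenvalues `μ > 0` contribute. -/
def IsSpectralPowerImage {E : Type u} [NormedAddCommGroup E] [InnerProductSpace ℝ E]
    [CompleteSpace E] (A : E →L[ℝ] E) (r : ℝ) (u g : E) : Prop :=
  HasSum (fun μ : ℝ => μ ^ r • (A - μ • ContinuousLinearMap.id ℝ E).ker.starProjection u) g

/-! ### Kernel conjugate gradient -/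

section CG

variable {n : ℕ}

/-- The normalized kernel matrix `(1 / n) (k(X_i, X_j))`. -/
noncomputable def kernelMatrix {𝒳 : Type u} (k : 𝒳 → 𝒳 → ℝ) (x : Fin n → 𝒳) :
    Matrix (Fin n) (Fin n) ℝ :=
  Matrix.of fun i j => (n : ℝ)⁻¹ * k (x i) (x j)

/-- The normalized kernel expansion `f_α = (1 / n) ∑ α_i k(X_i, ·)`. -/
noncomputable def kernelExpansion {𝒳 : Type u} (k : 𝒳 → 𝒳 → ℝ) (x : Fin n → 𝒳)
    (α : Fin n → ℝ) (t : 𝒳) : ℝ :=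
  (n : ℝ)⁻¹ * ∑ i, α i * k (x i) t

/-- The seminorm `‖a‖_K = ⟨a, K a⟩ ^ (1/2)`, where `⟨a, b⟩ = (1 / n) ∑ a_i b_i`. -/
noncomputable def normK (K : Matrix (Fin n) (Fin n) ℝ) (a : Fin n → ℝ) : ℝ :=
  √((n : ℝ)⁻¹ * (a ⬝ᵥ (K *ᵥ a)))

/-- The Krylov space `span {Y, K Y, …, K ^ (m - 1) Y}`. -/
def krylov (K : Matrix (Fin n) (Fin n) ℝ) (Y : Fin n → ℝ) (m : ℕ) : Submodule ℝ (Fin n → ℝ) :=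
  Submodule.span ℝ {w | ∃ j < m, w = (K ^ j) *ᵥ Y}

/-- `α` and `q` are a sequence of conjugate gradient solutions `α_m`, minimizing `‖Y - K α‖_K`
over the `m`-th Krylov space, and of iteration polynomials `q_m` of degree at most `m - 1`, with
`α_m = q_m(K) Y`. -/
structure IsCGSequence (K : Matrix (Fin n) (Fin n) ℝ) (Y : Fin n → ℝ)
    (α : ℕ → Fin n → ℝ) (q : ℕ → ℝ[X]) : Prop where
  mem : ∀ m, α m ∈ krylov K Y m
  argmin : ∀ m, ∀ β ∈ krylov K Y m, normK K (Y - K *ᵥ α m) ≤ normK K (Y - K *ᵥ β)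
  degree_lt : ∀ m, (q m).degree < m
  eq_aeval : ∀ m, α m = (aeval K (q m)) *ᵥ Y

/-- The operator noise level `δ = 4 κ (log (2 / γ) / n) ^ (1/2)`. -/
noncomputable def noiseLevel (n : ℕ) (κ γ : ℝ) : ℝ := 4 * κ * √(Real.log (2 / γ) / n)

/-- The data-dependent discrepancy threshold at coefficient vector `a`. -/
noncomputable def threshold (τ κ M γ : ℝ) (K : Matrix (Fin n) (Fin n) ℝ) (a : Fin n → ℝ) : ℝ :=
  4 * τ * √(κ * Real.log (2 / γ) / n) * (√κ * normK K a + M * √(Real.log (2 / γ)))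

/-- The discrepancy condition `‖(f_a(X_1), …, f_a(X_n)) - Y‖_{K_n} < Λ` at the function `f_a`
with coefficient vector `a`. -/
def DiscrepancyHolds {𝒳 : Type u} (τ κ M γ : ℝ) (k : 𝒳 → 𝒳 → ℝ) (x : Fin n → 𝒳)
    (Y : Fin n → ℝ) (a : Fin n → ℝ) : Prop :=
  normK (kernelMatrix k x) ((fun i => kernelExpansion k x a (x i)) - Y)
    < threshold τ κ M γ (kernelMatrix k x) a

/-- The first iteration `m ≥ 0` at which the discrepancy condition holds. -/
noncomputable def discrepancyStop {𝒳 : Type u} (τ κ M γ : ℝ) (k : 𝒳 → 𝒳 → ℝ) (x : Fin n → 𝒳)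
    (Y : Fin n → ℝ) (α : ℕ → Fin n → ℝ) : ℕ :=
  sInf {m | DiscrepancyHolds τ κ M γ k x Y (α m)}

open Classical in
/-- The modified rule: go back one step if `q(0) ≥ 1 / (2 τ δ)` at the discrepancy stop. -/
noncomputable def modifiedStop {𝒳 : Type u} (τ κ M γ : ℝ) (k : 𝒳 → 𝒳 → ℝ) (x : Fin n → 𝒳)
    (Y : Fin n → ℝ) (α : ℕ → Fin n → ℝ) (q : ℕ → ℝ[X]) : ℕ :=
  if (2 * τ)⁻¹ * (noiseLevel n κ γ)⁻¹ ≤ (q (discrepancyStop τ κ M γ k x Y α)).eval 0 then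
    discrepancyStop τ κ M γ k x Y α - 1
  else discrepancyStop τ κ M γ k x Y α

end CG

/-!
With the canonical feature map `φ x = k(x, ·)` into the reproducing kernel Hilbert space `H`, and the
embedding `T : H → L²(P_X)`, the integral operator is `K = T T†`, and the covariance operator is
`A = T† T`. A coefficient vector `α` represents the function `(1 / n) ∑ α_i φ(X_i)`, whose norm in
`H` is `‖α‖_{K_n}`. Under this correspondence kernel conjugate gradients are the minimal residual
method for `Ã h = b̃`, where `Ã` is the empirical covariance operator and `b̃` the empirical mean of
`Y φ(X)` (`IsCGSequence.isKrylovMinimizer`), and the stopping rule is the discrepancy condition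
`‖b̃ - Ã h_m‖ < τ (δ ‖h_m‖ + ε)` (`discrepancyHolds_iff`).

*Concentration.* McDiarmid's inequality for the distance of an empirical mean in `ℓ²` to its
expectation, applied to the coordinates of `φ(X) ⊗ φ(X)` (Hilbert–Schmidt norm) and of `Y φ(X)`,
gives `‖Ã - A‖ ≤ δ` and `‖b̃ - T† f*‖ ≤ ε`, each with probability at least `1 - γ`
(`exists_concentration_event`). Everything that follows is deterministic.

*Source condition.* Since `r ≥ 1 / 2`, the target is `f* = T h` with `h ∈ H`. Cutting the spectrum at
a level `σ` splits `h` into `A ^ k g` and a remainder, with `k = ⌊r - 1 / 2⌋ + 1`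
(`exists_source_decomposition`), and `A ^ k` may be replaced by `Ã ^ k` because `‖Ã - A‖ ≤ δ`. No
qualification restricts `r`, as conjugate gradients compete with polynomials of every degree.

*Error analysis.* In an eigenbasis of `Ã`, after division by `σ`, this becomes a diagonal system with
noise `N = ε + δ ‖h‖` and approximation errors of size `Z ≥ N`. The residual polynomial
`1 - X q_m` is orthogonal to all polynomials of smaller degree, so its roots are simple and positive,
and `q_m(0)` is the sum of their inverses. Orthogonality to the cofactor of the smallest root gives a
residual of at most `N + C Z / q_m(0)` (`IsMinResidual.residual_le`). In one step `q_m(0)` grows by at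
most the inverse of the smallest new root (`IsResidualPoly.neg_derivative_succ_le`), so that a jump
of `q_m(0)` comes from an isolated root; deleting it yields a competitor of lower degree, and the
residual was small already before the jump (`IsMinResidual.residual_le_of_succ`). Together with
`‖error‖ ≤ 2 Z + max(1, q_m(0)) (N + residual)` (`l2_error_le`) this leaves two regimes
(`error_le_modified_discrepancy`). If `N` dominates `δ Z`, the discrepancy condition is met before
`q_m(0)` reaches `1 / (2 τ δ)`, and the first iterate meeting it is accurate. Otherwise the target is
bounded by a multiple of `Z`; if the first iterate meeting the condition has `q_m(0) ≥ 1 / (2 τ δ)`,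
the preceding one has a residual of the order `δ Z` while violating the condition, so it is bounded
by a multiple of `Z`, and bounded errors are harmless: the squared norms in `L²(P_X)` and in its
empirical version differ by at most `δ ‖error‖²`.

*Rate.* With `η = log (2 / γ) / √n ≤ 1`, the choice `σ = 32 τ κ η ^ (1 / (r + 1 / 2))` balances noise
and approximation error (`source_error_le`). For `η > 1` the zero function already meets the
discrepancy condition and satisfies the bound (`stopped_error_le`).
-/

/-! ### Residual polynomials of the minimal residual method -/

section Residual

variable {ι : Type*} [Fintype ι]

/-- The number of distinct nodes `lam j` carrying a nonzero weight `β j`. -/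
noncomputable def activeNodes (lam β : ι → ℝ) : ℕ :=
  Set.ncard (lam '' {j | β j ≠ 0})

/-- `q` is the `m`-th minimal residual iteration polynomial for the diagonal system
`lam j * x j = β j`: among the polynomials of degree less than `m` it minimizes the Euclidean norm
of the residual `(1 - lam q(lam)) β`. -/
def IsMinResidual (lam β : ι → ℝ) (m : ℕ) (q : ℝ[X]) : Prop :=
  q.degree < m ∧ ∀ s : ℝ[X], s.degree < m →
    ∑ j, ((1 - lam j * q.eval (lam j)) * β j) ^ 2 ≤ ∑ j, ((1 - lam j * s.eval (lam j)) * β j) ^ 2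

/-- `p` is an `m`-th residual polynomial: `p(0) = 1`, the degree is at most `m`, and `p` is
orthogonal to all polynomials of smaller degree with respect to the weights `β j ^ 2 * lam j`. -/
structure IsResidualPoly (lam β : ι → ℝ) (m : ℕ) (p : ℝ[X]) : Prop where
  eval_zero : p.eval 0 = 1
  natDegree_le : p.natDegree ≤ m
  orth : ∀ s : ℝ[X], s.degree < m →
    ∑ j, β j ^ 2 * lam j * (p.eval (lam j) * s.eval (lam j)) = 0

/-- The variational equation of a quadratic minimization along a line. -/
theorem sum_mul_eq_zero_of_forall_le {a b : ι → ℝ}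
    (h : ∀ t : ℝ, ∑ j, a j ^ 2 ≤ ∑ j, (a j - t * b j) ^ 2) : ∑ j, a j * b j = 0 := by
  have hexp : ∀ t : ℝ, ∑ j, (a j - t * b j) ^ 2
      = ∑ j, a j ^ 2 - 2 * t * ∑ j, a j * b j + t ^ 2 * ∑ j, b j ^ 2 := fun t => by
    rw [Finset.mul_sum, Finset.mul_sum, ← Finset.sum_sub_distrib, ← Finset.sum_add_distrib]
    exact Finset.sum_congr rfl fun j _ => by ring
  have hB : 0 ≤ ∑ j, b j ^ 2 := Finset.sum_nonneg fun j _ => sq_nonneg _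
  set S := ∑ j, a j * b j
  set B := ∑ j, b j ^ 2
  by_contra hS
  have h1 := h (S / (B + 1))
  rw [hexp] at h1
  have h2 : (S / (B + 1)) * (B + 1) = S := by field_simp
  set t := S / (B + 1)
  have ht : t ≠ 0 := fun h0 => hS (by rw [← h2, h0, zero_mul])
  have h3 : 0 < t ^ 2 := by positivity
  have h4 : t * S = t ^ 2 * (B + 1) := by rw [← h2]; ring
  nlinarith [mul_nonneg h3.le hB]

theorem IsMinResidual.isResidualPoly {lam β : ι → ℝ} {m : ℕ} {q : ℝ[X]}
    (hq : IsMinResidual lam β m q) : IsResidualPoly lam β m (1 - X * q) where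
  eval_zero := by simp
  natDegree_le := by
    rcases eq_or_ne q 0 with rfl | hq0
    · simp
    have h1 : q.natDegree < m := by
      have := hq.1
      rwa [degree_eq_natDegree hq0, Nat.cast_lt] at this
    refine (natDegree_sub_le _ _).trans (max_le (by simp) ?_)
    refine natDegree_mul_le.trans ?_
    rw [natDegree_X]; lia
  orth s hs := by
    have h := sum_mul_eq_zero_of_forall_le (a := fun j => (1 - lam j * q.eval (lam j)) * β j)
      (b := fun j => lam j * s.eval (lam j) * β j) fun t => by
        refine (hq.2 (q + C t * s) ?_).trans (Finset.sum_le_sum fun j _ => ?_)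
        · refine (degree_add_le _ _).trans_lt (max_lt hq.1 ?_)
          rw [← smul_eq_C_mul]
          exact (degree_smul_le _ _).trans_lt hs
        · simp only [eval_add, eval_mul, eval_C]
          apply le_of_eq; ring
    rw [← h]
    refine Finset.sum_congr rfl fun j _ => ?_
    simp only [eval_sub, eval_one, eval_mul, eval_X]
    ring

/-- The weighted bilinear form is positive definite on polynomials of degree less than the number of
active nodes, since such a polynomial cannot vanish at all of them. -/
theorem sum_sq_weight_pos {lam β : ι → ℝ} (hlam : ∀ j, β j ≠ 0 → 0 < lam j) {g : ℝ[X]}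
    (hg : g ≠ 0) (hdeg : g.natDegree < activeNodes lam β) :
    0 < ∑ j, β j ^ 2 * lam j * g.eval (lam j) ^ 2 := by
  have hnn : ∀ j, 0 ≤ β j ^ 2 * lam j * g.eval (lam j) ^ 2 := fun j => by
    by_cases hj : β j = 0
    · simp [hj]
    · have := hlam j hj; positivity
  by_contra hcon
  have hz : ∑ j, β j ^ 2 * lam j * g.eval (lam j) ^ 2 = 0 :=
    le_antisymm (not_lt.1 hcon) (Finset.sum_nonneg fun j _ => hnn j)
  rw [Finset.sum_eq_zero_iff_of_nonneg fun j _ => hnn j] at hz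
  have hsub : lam '' {j | β j ≠ 0} ⊆ (g.roots.toFinset : Set ℝ) := by
    rintro _ ⟨j, hj, rfl⟩
    have h1 := hz j (Finset.mem_univ j)
    have h2 := hlam j hj
    have h3 : g.eval (lam j) = 0 := by
      rcases mul_eq_zero.1 h1 with h | h
      · rcases mul_eq_zero.1 h with h | h
        · exact absurd (pow_eq_zero_iff (two_ne_zero) |>.1 h) hj
        · exact absurd h h2.ne'
      · exact pow_eq_zero_iff (two_ne_zero) |>.1 h
    simp [hg, h3]
  have h4 := Set.ncard_le_ncard hsub (Finset.finite_toSet _)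
  rw [Set.ncard_coe_finset] at h4
  have h5 := (Multiset.toFinset_card_le g.roots).trans (card_roots' g)
  unfold activeNodes at hdeg
  lia

theorem degree_lt_of_mul_natDegree_le {f g p : ℝ[X]} {m k : ℕ} (hp0 : p ≠ 0) (hp : p = f * g)
    (hm : p.natDegree ≤ m) (hf : f.natDegree = k) (hk : 0 < k) :
    g ≠ 0 ∧ g.natDegree + k ≤ m ∧ g.degree < m := by
  have hf0 : f ≠ 0 := by rintro rfl; simp [hp] at hp0
  have hg0 : g ≠ 0 := by rintro rfl; simp [hp] at hp0
  have h1 : p.natDegree = f.natDegree + g.natDegree := by rw [hp, natDegree_mul hf0 hg0]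
  refine ⟨hg0, by lia, ?_⟩
  rw [degree_eq_natDegree hg0, Nat.cast_lt]
  lia

namespace IsResidualPoly

variable {lam β : ι → ℝ} {m : ℕ} {p : ℝ[X]}

theorem ne_zero (hp : IsResidualPoly lam β m p) : p ≠ 0 := by
  rintro rfl; simpa using hp.eval_zero

/-- A residual polynomial has only real roots: a pair of conjugate complex roots would give a
quadratic factor of constant sign, contradicting orthogonality to the cofactor. -/
theorem splits (hp : IsResidualPoly lam β m p) (hlam : ∀ j, β j ≠ 0 → 0 < lam j)
    (hm : m ≤ activeNodes lam β) : p.Splits := by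
  refine Splits.of_splits_map (algebraMap ℝ ℂ) (IsAlgClosed.splits _) fun z hz => ?_
  by_contra hzr
  have him : z.im ≠ 0 := fun h0 => hzr ⟨z.re, by
    apply Complex.ext <;> simp [h0]⟩
  have hz0 : aeval z p = 0 := by
    have := isRoot_of_mem_roots hz
    rwa [IsRoot, eval_map_algebraMap] at this
  obtain ⟨g, hg⟩ := quadratic_dvd_of_aeval_eq_zero_im_ne_zero p hz0 him
  have hnorm : ‖z‖ ^ 2 = z.re ^ 2 + z.im ^ 2 := by
    rw [← Complex.normSq_eq_norm_sq, Complex.normSq_apply]; ring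
  have hdeg2 : (X ^ 2 - C (2 * z.re) * X + C (‖z‖ ^ 2)).natDegree = 2 := by
    compute_degree!
  obtain ⟨hg0, hgm, hgd⟩ := degree_lt_of_mul_natDegree_le hp.ne_zero hg hp.natDegree_le hdeg2
    two_pos
  have hpos := sum_sq_weight_pos hlam hg0 (by lia)
  have horth := hp.orth g hgd
  have hle : z.im ^ 2 * ∑ j, β j ^ 2 * lam j * g.eval (lam j) ^ 2 ≤ 0 := by
    rw [← horth, Finset.mul_sum]
    refine Finset.sum_le_sum fun j _ => ?_
    by_cases hj : β j = 0
    · simp [hj]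
    have hl := hlam j hj
    have : p.eval (lam j) = ((lam j - z.re) ^ 2 + z.im ^ 2) * g.eval (lam j) := by
      rw [hg, hnorm]; simp only [eval_mul, eval_add, eval_sub, eval_pow, eval_X, eval_C]; ring
    rw [this]
    have h1 : 0 ≤ β j ^ 2 * lam j * ((lam j - z.re) ^ 2 * g.eval (lam j) ^ 2) := by positivity
    nlinarith
  have : 0 < z.im ^ 2 := by positivity
  nlinarith

/-- Orthogonality of `p = (X - r) g` to the cofactor `g`. -/
theorem orth_cofactor (hp : IsResidualPoly lam β m p) {r : ℝ} {g : ℝ[X]}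
    (hg : p = (X - C r) * g) :
    g ≠ 0 ∧ g.natDegree + 1 ≤ m ∧ g.degree < m ∧
      ∀ s : ℝ[X], s.degree < m →
        ∑ j, β j ^ 2 * lam j * ((lam j - r) * (g.eval (lam j) * s.eval (lam j))) = 0 := by
  obtain ⟨hg0, hgm, hgd⟩ := degree_lt_of_mul_natDegree_le hp.ne_zero hg hp.natDegree_le
    (natDegree_X_sub_C r) one_pos
  refine ⟨hg0, hgm, hgd, fun s hs => ?_⟩
  rw [← hp.orth s hs]
  refine Finset.sum_congr rfl fun j _ => ?_
  rw [hg]; simp only [eval_mul, eval_sub, eval_X, eval_C]; ring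

/-- For `p = (X - r) g`, orthogonality to `g` exhibits `r` as the mean of the nodes with weights
`β ^ 2 lam g(lam) ^ 2`. -/
theorem root_pos (hp : IsResidualPoly lam β m p) (hlam : ∀ j, β j ≠ 0 → 0 < lam j)
    (hm : m ≤ activeNodes lam β) {r : ℝ} (hr : r ∈ p.roots) : 0 < r := by
  obtain ⟨g, hg⟩ := dvd_iff_isRoot.2 (isRoot_of_mem_roots hr)
  obtain ⟨hg0, hgm, hgd, horth⟩ := hp.orth_cofactor hg
  have hpos := sum_sq_weight_pos hlam hg0 (by lia)
  have h1 := horth g hgd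
  have h2 : r * ∑ j, β j ^ 2 * lam j * g.eval (lam j) ^ 2
      = ∑ j, β j ^ 2 * (lam j * g.eval (lam j)) ^ 2 := by
    rw [← sub_eq_zero, ← neg_eq_zero, ← h1, Finset.mul_sum, ← Finset.sum_sub_distrib,
      ← Finset.sum_neg_distrib]
    exact Finset.sum_congr rfl fun j _ => by ring
  have h3 : 0 ≤ r * ∑ j, β j ^ 2 * lam j * g.eval (lam j) ^ 2 := by
    rw [h2]; positivity
  have h4 : 0 ≤ r := nonneg_of_mul_nonneg_left h3 hpos
  rcases h4.lt_or_eq with h | h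
  · exact h
  · have := isRoot_of_mem_roots hr
    rw [← h, IsRoot, hp.eval_zero] at this
    exact absurd this one_ne_zero

theorem natDegree_eq (hp : IsResidualPoly lam β m p) (hlam : ∀ j, β j ≠ 0 → 0 < lam j)
    (hm : m ≤ activeNodes lam β) : p.natDegree = m := by
  by_contra hne
  have hlt := lt_of_le_of_ne hp.natDegree_le hne
  have hpos := sum_sq_weight_pos hlam hp.ne_zero (by lia)
  have := hp.orth p (by rw [degree_eq_natDegree hp.ne_zero, Nat.cast_lt]; exact hlt)
  simp only [← sq] at this
  exact hpos.ne' this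

/-- A double root would make `p = (X - r) ^ 2 g` nonnegative against the polynomial `g`. -/
theorem roots_nodup (hp : IsResidualPoly lam β m p) (hlam : ∀ j, β j ≠ 0 → 0 < lam j)
    (hm : m ≤ activeNodes lam β) : p.roots.Nodup := by
  rw [Multiset.nodup_iff_count_le_one]
  intro r
  by_contra! hr
  rw [count_roots] at hr
  obtain ⟨g, hg⟩ := (le_rootMultiplicity_iff hp.ne_zero).1 hr.nat_succ_le
  have hg' : p = (X - C r) * ((X - C r) * g) := by rw [hg]; ring
  obtain ⟨hf0, hfm, hfd, horth⟩ := hp.orth_cofactor hg'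
  have hpos := sum_sq_weight_pos hlam hf0 (by lia)
  have hg0 : g ≠ 0 := by rintro rfl; simp at hf0
  have hdg : g.degree < m := by
    refine lt_of_le_of_lt ?_ hfd
    rw [mul_comm]
    exact degree_le_mul_left _ (X_sub_C_ne_zero r)
  have := horth g hdg
  refine hpos.ne' ?_
  rw [← this]
  refine Finset.sum_congr rfl fun j _ => ?_
  simp only [eval_mul, eval_sub, eval_X, eval_C]; ring

theorem eval_eq_prod (hp : IsResidualPoly lam β m p) (hlam : ∀ j, β j ≠ 0 → 0 < lam j)
    (hm : m ≤ activeNodes lam β) (x : ℝ) :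
    p.eval x = (p.roots.map fun r => 1 - x / r).prod := by
  have h := (hp.splits hlam hm).eval_eq_prod_roots
  have h0 := h 0
  rw [hp.eval_zero] at h0
  have hne : (p.roots.map fun r => (0 : ℝ) - r).prod ≠ 0 := by
    intro h1; rw [h1, mul_zero] at h0; exact one_ne_zero h0
  have h2 : (p.roots.map fun r => x - r).prod
      = (p.roots.map fun r => (0 : ℝ) - r).prod * (p.roots.map fun r => 1 - x / r).prod := by
    rw [← Multiset.prod_map_mul]
    congr 1
    refine Multiset.map_congr rfl fun r hr => ?_
    have := (hp.root_pos hlam hm hr).ne'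
    field_simp; ring
  rw [h, h2, ← mul_assoc, ← h0, one_mul]

theorem neg_derivative_eval_zero (hp : IsResidualPoly lam β m p)
    (hlam : ∀ j, β j ≠ 0 → 0 < lam j) (hm : m ≤ activeNodes lam β) :
    -p.derivative.eval 0 = (p.roots.map fun r => r⁻¹).sum := by
  rw [(hp.splits hlam hm).eval_derivative_eq_eval_mul_sum (by rw [hp.eval_zero]; exact one_ne_zero),
    hp.eval_zero, one_mul]
  have h : (p.roots.map fun r => 1 / (0 - r)) = p.roots.map fun r => -r⁻¹ :=
    Multiset.map_congr rfl fun r _ => by rw [zero_sub, one_div, inv_neg]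
  rw [h, Multiset.sum_map_neg, neg_neg]

end IsResidualPoly
end Residual

/-! ### Size of the residual and deletion of the smallest root -/

section Residual

variable {ι : Type*} [Fintype ι]

theorem prod_one_sub_div_nonneg {S : Multiset ℝ} (hS : ∀ r ∈ S, 0 < r) {x : ℝ}
    (hxS : ∀ r ∈ S, x ≤ r) : 0 ≤ (S.map fun r => 1 - x / r).prod := by
  refine Multiset.prod_nonneg fun a ha => ?_
  obtain ⟨r, hr, rfl⟩ := Multiset.mem_map.1 ha
  rw [sub_nonneg, div_le_one (hS r hr)]
  exact hxS r hr

theorem prod_one_sub_div_le_exp {S : Multiset ℝ} (hS : ∀ r ∈ S, 0 < r) {x : ℝ}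
    (hxS : ∀ r ∈ S, x ≤ r) :
    (S.map fun r => 1 - x / r).prod ≤ Real.exp (-(x * (S.map fun r => r⁻¹).sum)) := by
  induction S using Multiset.induction_on with
  | empty => simp
  | cons a S ih =>
    have hS' : ∀ r ∈ S, 0 < r := fun r hr => hS r (Multiset.mem_cons_of_mem hr)
    have hxS' : ∀ r ∈ S, x ≤ r := fun r hr => hxS r (Multiset.mem_cons_of_mem hr)
    rw [Multiset.map_cons, Multiset.prod_cons, Multiset.map_cons, Multiset.sum_cons, mul_add,
      neg_add, Real.exp_add]
    refine mul_le_mul ?_ (ih hS' hxS') (prod_one_sub_div_nonneg hS' hxS') (Real.exp_nonneg _)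
    have := Real.add_one_le_exp (-(x * a⁻¹))
    rw [div_eq_mul_inv]; linarith

theorem one_sub_le_prod_one_sub_div {S : Multiset ℝ} (hS : ∀ r ∈ S, 0 < r) {x : ℝ} (hx : 0 ≤ x)
    (hxS : ∀ r ∈ S, x ≤ r) :
    1 - x * (S.map fun r => r⁻¹).sum ≤ (S.map fun r => 1 - x / r).prod := by
  induction S using Multiset.induction_on with
  | empty => simp
  | cons a S ih =>
    have hS' : ∀ r ∈ S, 0 < r := fun r hr => hS r (Multiset.mem_cons_of_mem hr)
    have hxS' : ∀ r ∈ S, x ≤ r := fun r hr => hxS r (Multiset.mem_cons_of_mem hr)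
    have h1 := ih hS' hxS'
    have h2 := prod_one_sub_div_le_exp hS' hxS'
    have ha := hS a (Multiset.mem_cons_self a S)
    have hsum : 0 ≤ (S.map fun r => r⁻¹).sum := Multiset.sum_nonneg fun b hb => by
      obtain ⟨r, hr, rfl⟩ := Multiset.mem_map.1 hb
      exact (inv_pos.2 (hS' r hr)).le
    have h3 : (S.map fun r => 1 - x / r).prod ≤ 1 :=
      h2.trans (Real.exp_le_one_iff.2 (neg_nonpos.2 (mul_nonneg hx hsum)))
    simp only [Multiset.map_cons, Multiset.prod_cons, Multiset.sum_cons]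
    have h4 : 0 ≤ x * a⁻¹ := mul_nonneg hx (inv_pos.2 ha).le
    rw [div_eq_mul_inv]
    nlinarith

namespace IsResidualPoly

variable {lam β : ι → ℝ} {m : ℕ} {p : ℝ[X]}

/-- The cofactor `t` of a root `r`, normalized by `t(0) = 1`. -/
theorem exists_cofactor (hp : IsResidualPoly lam β m p) (hlam : ∀ j, β j ≠ 0 → 0 < lam j)
    (hm : m ≤ activeNodes lam β) {r : ℝ} (hr : r ∈ p.roots) :
    ∃ t : ℝ[X], (∀ x, p.eval x = (1 - x / r) * t.eval x) ∧ t.eval 0 = 1 ∧ t.degree < m ∧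
      (∀ x, t.eval x = ((p.roots.erase r).map fun r => 1 - x / r).prod) ∧
      ∑ j, β j ^ 2 * lam j * ((lam j - r) * t.eval (lam j) ^ 2) = 0 := by
  have hr0 := hp.root_pos hlam hm hr
  set t : ℝ[X] := ((p.roots.erase r).map fun r => 1 - C r⁻¹ * X).prod with ht
  have hte : ∀ x, t.eval x = ((p.roots.erase r).map fun r => 1 - x / r).prod := fun x => by
    rw [ht, eval_multiset_prod, Multiset.map_map]
    congr 1
    refine Multiset.map_congr rfl fun a _ => ?_
    simp [div_eq_inv_mul]
  have hpe : ∀ x, p.eval x = (1 - x / r) * t.eval x := fun x => by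
    rw [hp.eval_eq_prod hlam hm, hte, ← Multiset.prod_cons, ← Multiset.map_cons (fun r => 1 - x / r),
      Multiset.cons_erase hr]
  have hpt : p = (X - C r) * (C (-r⁻¹) * t) := by
    refine Polynomial.funext fun x => ?_
    rw [hpe]; simp only [eval_mul, eval_sub, eval_X, eval_C]; field_simp; ring
  obtain ⟨-, -, hd, ho⟩ := hp.orth_cofactor hpt
  have htd : t.degree < m := by
    rwa [degree_C_mul (neg_ne_zero.2 (inv_ne_zero hr0.ne'))] at hd
  refine ⟨t, hpe, ?_, htd, hte, ?_⟩
  · have := hpe 0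
    rw [hp.eval_zero] at this
    simpa using this.symm
  · have h := ho t htd
    have h2 : ∑ j, β j ^ 2 * lam j * ((lam j - r) * t.eval (lam j) ^ 2)
        = -r * ∑ j, β j ^ 2 * lam j *
          ((lam j - r) * ((C (-r⁻¹) * t).eval (lam j) * t.eval (lam j))) := by
      rw [Finset.mul_sum]
      refine Finset.sum_congr rfl fun j _ => ?_
      simp only [eval_mul, eval_C]; field_simp
    rw [h2, h, mul_zero]

theorem exists_min_root (hp : IsResidualPoly lam β m p) (hlam : ∀ j, β j ≠ 0 → 0 < lam j)
    (hm : m ≤ activeNodes lam β) (hm0 : m ≠ 0) : ∃ r ∈ p.roots, ∀ r' ∈ p.roots, r ≤ r' := by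
  have hcard : p.roots.card = m := by
    rw [← (hp.splits hlam hm).natDegree_eq_card_roots, hp.natDegree_eq hlam hm]
  have hne : p.roots.toFinset.Nonempty := by
    rw [Multiset.toFinset_nonempty]
    intro h; rw [h] at hcard; exact hm0 hcard.symm
  obtain ⟨r, hr, hmin⟩ := Finset.exists_min_image p.roots.toFinset id hne
  exact ⟨r, Multiset.mem_toFinset.1 hr, fun r' hr' => hmin r' (Multiset.mem_toFinset.2 hr')⟩

/-- The residual is controlled by the part of the data below the smallest root, damped by
`exp (-lam P)` with `P = -p'(0)`. -/
theorem sum_residual_sq_le (hp : IsResidualPoly lam β m p) (hlam : ∀ j, β j ≠ 0 → 0 < lam j)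
    (hm : m ≤ activeNodes lam β) {r : ℝ} (hr : r ∈ p.roots) (hmin : ∀ r' ∈ p.roots, r ≤ r') :
    ∑ j, (p.eval (lam j) * β j) ^ 2 ≤
      ∑ j with lam j < r, Real.exp (-(lam j * -p.derivative.eval 0)) * β j ^ 2 := by
  obtain ⟨t, hpe, ht0, htd, hte, horth⟩ := hp.exists_cofactor hlam hm hr
  have hr0 := hp.root_pos hlam hm hr
  have h1 : ∑ j, (p.eval (lam j) * β j) ^ 2
      = ∑ j, (1 - lam j / r) * t.eval (lam j) ^ 2 * β j ^ 2 := by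
    have h2 : ∑ j, ((p.eval (lam j) * β j) ^ 2 - (1 - lam j / r) * t.eval (lam j) ^ 2 * β j ^ 2)
        = (r⁻¹) ^ 2 * ∑ j, β j ^ 2 * lam j * ((lam j - r) * t.eval (lam j) ^ 2) := by
      rw [Finset.mul_sum]
      refine Finset.sum_congr rfl fun j _ => ?_
      rw [hpe]; field_simp; ring
    rw [← sub_eq_zero, ← Finset.sum_sub_distrib, h2, horth, mul_zero]
  rw [h1, Finset.sum_filter]
  refine Finset.sum_le_sum fun j _ => ?_
  by_cases hj : β j = 0
  · simp [hj]
  have hl := hlam j hj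
  split_ifs with hlt
  · refine mul_le_mul_of_nonneg_right ?_ (sq_nonneg _)
    have hx : ∀ r' ∈ p.roots, lam j ≤ r' := fun r' hr' => hlt.le.trans (hmin r' hr')
    have hx' : ∀ r' ∈ p.roots.erase r, lam j ≤ r' := fun r' hr' => hx r' (Multiset.mem_of_mem_erase hr')
    have hpos : ∀ r' ∈ p.roots, 0 < r' := fun r' => hp.root_pos hlam hm
    have hpos' : ∀ r' ∈ p.roots.erase r, 0 < r' := fun r' hr' => hpos r' (Multiset.mem_of_mem_erase hr')
    have a1 : p.eval (lam j) ≤ Real.exp (-(lam j * -p.derivative.eval 0)) := by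
      rw [hp.neg_derivative_eval_zero hlam hm, hp.eval_eq_prod hlam hm]
      exact prod_one_sub_div_le_exp hpos hx
    have hsum : 0 ≤ ((p.roots.erase r).map fun r => r⁻¹).sum := Multiset.sum_nonneg fun b hb => by
      obtain ⟨r, hr, rfl⟩ := Multiset.mem_map.1 hb
      exact (inv_pos.2 (hpos' r hr)).le
    have a2 : 0 ≤ t.eval (lam j) := by rw [hte]; exact prod_one_sub_div_nonneg hpos' hx'
    have a3 : t.eval (lam j) ≤ 1 := by
      rw [hte]
      exact (prod_one_sub_div_le_exp hpos' hx').trans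
        (Real.exp_le_one_iff.2 (neg_nonpos.2 (mul_nonneg hl.le hsum)))
    have a4 : 0 ≤ p.eval (lam j) := by
      rw [hp.eval_eq_prod hlam hm]; exact prod_one_sub_div_nonneg hpos hx
    rw [sq, ← mul_assoc, ← hpe]
    nlinarith
  · refine mul_nonpos_of_nonpos_of_nonneg (mul_nonpos_of_nonpos_of_nonneg ?_ (sq_nonneg _)) (sq_nonneg _)
    rw [sub_nonpos, one_le_div hr0]
    exact not_lt.1 hlt

/-- Deleting the smallest root `r` when the other roots lie above `A r`: the orthogonality of `p`
to its cofactor `t` shows that `t(lam) β` is concentrated on `lam ≤ A r`, where `0 ≤ t ≤ 1`. -/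
theorem exists_degree_lt_sum_sq_le (hp : IsResidualPoly lam β m p)
    (hlam : ∀ j, β j ≠ 0 → 0 < lam j) (hm : m ≤ activeNodes lam β) {r : ℝ} (hr : r ∈ p.roots)
    {A : ℝ} (hA : 2 ≤ A) (hmin : ∀ r' ∈ p.roots.erase r, A * r ≤ r') :
    ∃ t : ℝ[X], t.eval 0 = 1 ∧ t.degree < m ∧
      ∑ j, (t.eval (lam j) * β j) ^ 2 ≤ (1 + A⁻¹ ^ 2) * ∑ j with lam j ≤ A * r, β j ^ 2 := by
  obtain ⟨t, hpe, ht0, htd, hte, horth⟩ := hp.exists_cofactor hlam hm hr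
  have hr0 := hp.root_pos hlam hm hr
  refine ⟨t, ht0, htd, ?_⟩
  have hA0 : 0 < A := by linarith
  have hAA : (1 + A⁻¹ ^ 2) * ∑ j with lam j ≤ A * r, β j ^ 2
      = ∑ j with lam j ≤ A * r, β j ^ 2 + ∑ j with lam j ≤ A * r, A⁻¹ ^ 2 * β j ^ 2 := by
    rw [add_mul, one_mul, Finset.mul_sum]
  have hsq : ∀ j, lam j ≤ A * r → β j ≠ 0 → t.eval (lam j) ^ 2 ≤ 1 := fun j hle hj => by
    have hl := hlam j hj
    have hx' : ∀ r' ∈ p.roots.erase r, lam j ≤ r' := fun r' hr' => hle.trans (hmin r' hr')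
    have hpos' : ∀ r' ∈ p.roots.erase r, 0 < r' := fun r' hr' =>
      hp.root_pos hlam hm (Multiset.mem_of_mem_erase hr')
    have hsum : 0 ≤ ((p.roots.erase r).map fun r => r⁻¹).sum := Multiset.sum_nonneg fun b hb => by
      obtain ⟨r, hr, rfl⟩ := Multiset.mem_map.1 hb
      exact (inv_pos.2 (hpos' r hr)).le
    have a2 : 0 ≤ t.eval (lam j) := by rw [hte]; exact prod_one_sub_div_nonneg hpos' hx'
    have a3 : t.eval (lam j) ≤ 1 := by
      rw [hte]
      exact (prod_one_sub_div_le_exp hpos' hx').trans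
        (Real.exp_le_one_iff.2 (neg_nonpos.2 (mul_nonneg hl.le hsum)))
    exact pow_le_one₀ a2 a3
  -- pointwise, `t ^ 2 β ^ 2 ≤` (the claimed weights) `+ c lam (lam - r) t ^ 2 β ^ 2`
  have hpt : ∀ j, (t.eval (lam j) * β j) ^ 2 ≤
      (if lam j ≤ A * r then (1 + A⁻¹ ^ 2) * β j ^ 2 else 0)
        + 4 * A⁻¹ ^ 2 * (r⁻¹) ^ 2 * (β j ^ 2 * lam j * ((lam j - r) * t.eval (lam j) ^ 2)) := fun j => by
    by_cases hj : β j = 0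
    · simp [hj]
    have hl := hlam j hj
    have hb : 0 < β j ^ 2 := by positivity
    set T := t.eval (lam j) ^ 2 with hT
    have hT0 : 0 ≤ T := sq_nonneg _
    set y := lam j / r with hy
    have hly : lam j = y * r := by rw [hy]; field_simp
    have e1 : 4 * A⁻¹ ^ 2 * (r⁻¹) ^ 2 * (β j ^ 2 * lam j * ((lam j - r) * T))
        = 4 * A⁻¹ ^ 2 * (y * (y - 1)) * T * β j ^ 2 := by
      rw [hly]; field_simp
    rw [e1, mul_pow, ← hT]
    have hy0 : 0 < y := div_pos hl hr0
    have hAi : 0 < A⁻¹ ^ 2 := by positivity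
    split_ifs with hle
    · have hT1 := hsq j hle hj
      have : T ≤ (1 + A⁻¹ ^ 2) + 4 * A⁻¹ ^ 2 * (y * (y - 1)) * T := by
        have h3 : -1 ≤ 4 * (y * (y - 1)) := by nlinarith [sq_nonneg (2 * y - 1)]
        nlinarith [mul_nonneg hAi.le hT0, mul_nonneg hAi.le (sub_nonneg.2 hT1),
          mul_nonneg (mul_nonneg hAi.le hT0) (by linarith : 0 ≤ 4 * (y * (y - 1)) + 1)]
      nlinarith
    · have hyA : A < y := by rw [hy, lt_div_iff₀ hr0]; exact not_le.1 hle
      have : 1 ≤ 4 * A⁻¹ ^ 2 * (y * (y - 1)) := by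
        have h4 : A ^ 2 ≤ 4 * (y * (y - 1)) := by nlinarith
        calc (1 : ℝ) = A⁻¹ ^ 2 * A ^ 2 := by field_simp
          _ ≤ A⁻¹ ^ 2 * (4 * (y * (y - 1))) := mul_le_mul_of_nonneg_left h4 hAi.le
          _ = _ := by ring
      rw [zero_add]
      exact mul_le_mul_of_nonneg_right (le_mul_of_one_le_left hT0 this) hb.le
  refine (Finset.sum_le_sum fun j _ => hpt j).trans (le_of_eq ?_)
  rw [Finset.sum_add_distrib, ← Finset.mul_sum, horth, mul_zero, add_zero, ← Finset.sum_filter,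
    Finset.mul_sum]

end IsResidualPoly
end Residual

/-! ### Growth of `q(0)` from one iteration to the next -/

section Residual

variable {ι : Type*} [Fintype ι]

namespace IsResidualPoly

variable {lam β : ι → ℝ} {m : ℕ} {p : ℝ[X]}

/-- The negative derivative `P` of the residual polynomial at `0` grows by at most the inverse of the
smallest root in one step. The polynomials `f x = p' / (X - x)`, `x` a root of the next residual
polynomial `p'`, are orthogonal; the coefficients `c x` of `p` in this basis have constant sign,
because `p` has the same inner product with every `f x`. Hence the `-c x / x` are nonnegative with sum `p(0) = 1`, and `P` is the mean of
the `P' - 1 / x` with these weights, where `-P'` is the derivative of `p'` at `0`. -/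
theorem neg_derivative_succ_le {p' : ℝ[X]} (hp : IsResidualPoly lam β m p)
    (hp' : IsResidualPoly lam β (m + 1) p') (hlam : ∀ j, β j ≠ 0 → 0 < lam j)
    (hm : m + 1 ≤ activeNodes lam β) {r : ℝ} (hr : r ∈ p'.roots) (hmin : ∀ r' ∈ p'.roots, r ≤ r') :
    -p'.derivative.eval 0 ≤ -p.derivative.eval 0 + r⁻¹ := by
  have hr0 := hp'.root_pos hlam hm hr
  have hdvd : ∀ x ∈ p'.roots, ∃ g, p' = (X - C x) * g := fun x hx =>
    dvd_iff_isRoot.2 (isRoot_of_mem_roots hx)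
  choose! f hf using hdvd
  have hpos : ∀ x ∈ p'.roots, 0 < x := fun x => hp'.root_pos hlam hm
  have hcof := fun x hx => hp'.orth_cofactor (hf x hx)
  set R := p'.roots.toFinset with hR
  have hmem : ∀ {x}, x ∈ R ↔ x ∈ p'.roots := Multiset.mem_toFinset
  have hcard : R.card = m + 1 := by
    rw [hR, Multiset.toFinset_card_of_nodup (hp'.roots_nodup hlam hm),
      ← (hp'.splits hlam hm).natDegree_eq_card_roots, hp'.natDegree_eq hlam hm]
  -- the inner product, for which `p` is orthogonal to all polynomials of degree less than `m`
  set B : ℝ[X] → ℝ[X] → ℝ := fun a b => ∑ j, β j ^ 2 * lam j * (a.eval (lam j) * b.eval (lam j))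
    with hB
  have hBpos : ∀ x ∈ R, 0 < B (f x) (f x) := fun x hx => by
    obtain ⟨h0, hd, -, -⟩ := hcof x (hmem.1 hx)
    have := sum_sq_weight_pos hlam h0 (by lia)
    simpa only [hB, ← sq] using this
  have horth : ∀ x ∈ R, ∀ y ∈ R, x ≠ y → B (f y) (f x) = 0 := fun x hx y hy hxy => by
    obtain ⟨-, -, hdx, hox⟩ := hcof x (hmem.1 hx)
    obtain ⟨-, -, hdy, hoy⟩ := hcof y (hmem.1 hy)
    have h1 := hox (f y) hdy
    have h2 := hoy (f x) hdx
    have h3 : (y - x) * B (f y) (f x) = 0 := by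
      rw [← sub_self (0 : ℝ)]
      nth_rw 1 [← h1]
      rw [← h2, hB, Finset.mul_sum, ← Finset.sum_sub_distrib]
      exact Finset.sum_congr rfl fun j _ => by ring
    exact (mul_eq_zero.1 h3).resolve_left (sub_ne_zero.2 hxy.symm)
  have hfx : ∀ x ∈ R, (f x).eval x ≠ 0 := fun x hx h0 => by
    have hroots : p'.roots = x ::ₘ (f x).roots := by
      conv_lhs => rw [hf x (hmem.1 hx)]
      rw [roots_mul (by rw [← hf x (hmem.1 hx)]; exact hp'.ne_zero), roots_X_sub_C,
        Multiset.singleton_add]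
    have hnd := hp'.roots_nodup hlam hm
    rw [hroots, Multiset.nodup_cons] at hnd
    exact hnd.1 ((mem_roots (hcof x (hmem.1 hx)).1).2 h0)
  have hfy : ∀ x ∈ R, ∀ y ∈ R, x ≠ y → (f y).eval x = 0 := fun x hx y hy hxy => by
    have h1 : p'.eval x = 0 := isRoot_of_mem_roots (hmem.1 hx)
    rw [hf y (hmem.1 hy), eval_mul, eval_sub, eval_X, eval_C] at h1
    exact (mul_eq_zero.1 h1).resolve_left (sub_ne_zero.2 hxy)
  -- Lagrange interpolation of `p` at the roots of `p'`
  set c : ℝ → ℝ := fun x => p.eval x / (f x).eval x with hc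
  have hexp : p = ∑ x ∈ R, C (c x) * f x := by
    rw [← sub_eq_zero]
    refine eq_zero_of_degree_lt_of_eval_finset_eq_zero R ?_ fun x hx => ?_
    · rw [hcard]
      refine (degree_sub_le _ _).trans_lt (max_lt ?_ ?_)
      · refine degree_le_natDegree.trans_lt ?_
        have := hp.natDegree_le
        exact_mod_cast this.trans_lt (Nat.lt_succ_self m)
      · refine (degree_sum_le _ _).trans_lt ?_
        rw [Finset.sup_lt_iff (WithBot.bot_lt_coe _)]
        intro x hx
        rw [← smul_eq_C_mul]
        exact (degree_smul_le _ _).trans_lt (hcof x (hmem.1 hx)).2.2.1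
    · rw [eval_sub, eval_finsetSum, Finset.sum_eq_single_of_mem x hx fun y hy hyx => by
        rw [eval_mul, hfy x hx y hy hyx.symm, mul_zero]]
      rw [eval_mul, eval_C, hc]
      simp only
      rw [div_mul_cancel₀ _ (hfx x hx), sub_self]
  have hBp : ∀ x ∈ R, B p (f x) = c x * B (f x) (f x) := fun x hx => by
    have h1 : B p (f x) = ∑ y ∈ R, c y * B (f y) (f x) := by
      simp only [hB]
      simp_rw [Finset.mul_sum]
      rw [Finset.sum_comm]
      refine Finset.sum_congr rfl fun j _ => ?_
      conv_lhs => rw [hexp]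
      rw [eval_finsetSum, Finset.sum_mul, Finset.mul_sum]
      refine Finset.sum_congr rfl fun y _ => ?_
      rw [eval_mul, eval_C]; ring
    rw [h1, Finset.sum_eq_single_of_mem x hx fun y hy hyx => by
      rw [horth x hx y hy hyx.symm, mul_zero]]
  -- the `f x` have the same leading coefficient, so that `f x - f y` has degree less than `m`
  have hconst : ∀ x ∈ R, ∀ y ∈ R, B p (f x) = B p (f y) := fun x hx y hy => by
    have hdeg : (f x - f y).degree < m := by
      rcases eq_or_ne (f x - f y) 0 with h0 | h0
      · rw [h0, degree_zero]; exact WithBot.bot_lt_coe _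
      have h1 : (X - C x) * (f x - f y) = C (x - y) * f y := by
        have := hf y (hmem.1 hy)
        rw [mul_sub, ← hf x (hmem.1 hx), this, C_sub]; ring
      have h2 : ((X - C x) * (f x - f y)).natDegree = 1 + (f x - f y).natDegree := by
        rw [natDegree_mul (X_sub_C_ne_zero x) h0, natDegree_X_sub_C]
      have h3 : (C (x - y) * f y).natDegree ≤ (f y).natDegree := natDegree_C_mul_le _ _
      have h4 := (hcof y (hmem.1 hy)).2.1
      rw [degree_eq_natDegree h0, Nat.cast_lt]
      rw [← h1, h2] at h3
      lia
    have := hp.orth _ hdeg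
    rw [← sub_eq_zero, ← this]
    simp only [hB]
    rw [← Finset.sum_sub_distrib]
    exact Finset.sum_congr rfl fun j _ => by rw [eval_sub]; ring
  have hf0 : ∀ x ∈ R, (f x).eval 0 = -x⁻¹ := fun x hx => by
    have h1 := hp'.eval_zero
    rw [hf x (hmem.1 hx), eval_mul, eval_sub, eval_X, eval_C] at h1
    have := (hpos x (hmem.1 hx)).ne'
    field_simp
    linarith
  have hf0' : ∀ x ∈ R, (f x).derivative.eval 0 = (-p'.derivative.eval 0 - x⁻¹) * x⁻¹ :=
    fun x hx => by
    have h1 : p'.derivative.eval 0 = (f x).eval 0 + (0 - x) * (f x).derivative.eval 0 := by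
      conv_lhs => rw [hf x (hmem.1 hx)]
      simp
    rw [h1, hf0 x hx]
    have := (hpos x (hmem.1 hx)).ne'
    field_simp; ring
  have hsum : ∑ x ∈ R, -c x * x⁻¹ = 1 := by
    have h1 := hp.eval_zero
    rw [hexp, eval_finsetSum] at h1
    rw [← h1]
    refine Finset.sum_congr rfl fun x hx => ?_
    rw [eval_mul, eval_C, hf0 x hx]; ring
  have hsign : ∀ x ∈ R, 0 ≤ -c x := fun x hx => by
    by_contra hneg
    have hcx : 0 < c x := by linarith
    have hall : ∀ y ∈ R, 0 ≤ c y := fun y hy => by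
      have h1 : 0 < c x * B (f x) (f x) := mul_pos hcx (hBpos x hx)
      rw [← hBp x hx, hconst x hx y hy, hBp y hy] at h1
      exact (pos_of_mul_pos_left h1 (hBpos y hy).le).le
    have h2 : ∑ x ∈ R, -c x * x⁻¹ ≤ 0 := Finset.sum_nonpos fun y hy => by
      have := hall y hy
      have := inv_pos.2 (hpos y (hmem.1 hy))
      nlinarith
    linarith
  have hder : -p.derivative.eval 0
      = ∑ x ∈ R, (-p'.derivative.eval 0 - x⁻¹) * (-c x * x⁻¹) := by
    rw [hexp, derivative_sum, eval_finsetSum, ← Finset.sum_neg_distrib]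
    refine Finset.sum_congr rfl fun x hx => ?_
    rw [derivative_C_mul, eval_mul, eval_C, hf0' x hx]; ring
  have hfin : (-p'.derivative.eval 0 - r⁻¹) * ∑ x ∈ R, -c x * x⁻¹ ≤ -p.derivative.eval 0 := by
    rw [hder, Finset.mul_sum]
    refine Finset.sum_le_sum fun x hx => ?_
    have hx0 := hpos x (hmem.1 hx)
    refine mul_le_mul_of_nonneg_right ?_ (mul_nonneg (hsign x hx) (inv_pos.2 hx0).le)
    have := inv_anti₀ hr0 (hmin x (hmem.1 hx))
    linarith
  rw [hsum, mul_one] at hfin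
  linarith

end IsResidualPoly
end Residual

/-! ### The Euclidean norm of a finite sequence -/

section SequenceNorm

variable {ι : Type*} [Fintype ι]

/-- The Euclidean norm of a finite real sequence. -/
noncomputable def l2 (x : ι → ℝ) : ℝ := √(∑ j, x j ^ 2)

theorem l2_nonneg (x : ι → ℝ) : 0 ≤ l2 x := Real.sqrt_nonneg _

theorem l2_sq (x : ι → ℝ) : l2 x ^ 2 = ∑ j, x j ^ 2 :=
  Real.sq_sqrt (Finset.sum_nonneg fun _ _ => sq_nonneg _)

theorem l2_le_l2_iff {x y : ι → ℝ} : l2 x ≤ l2 y ↔ ∑ j, x j ^ 2 ≤ ∑ j, y j ^ 2 :=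
  Real.sqrt_le_sqrt_iff (Finset.sum_nonneg fun _ _ => sq_nonneg _)

theorem l2_mono {x y : ι → ℝ} (h : ∀ j, |x j| ≤ |y j|) : l2 x ≤ l2 y :=
  l2_le_l2_iff.2 (Finset.sum_le_sum fun j _ => sq_le_sq.2 (h j))

theorem l2_add_le (x y : ι → ℝ) : l2 (fun j => x j + y j) ≤ l2 x + l2 y := by
  have h := norm_add_le (WithLp.toLp 2 x : EuclideanSpace ℝ ι) (WithLp.toLp 2 y)
  simpa [EuclideanSpace.norm_eq, l2] using h

theorem l2_const_mul {c : ℝ} (hc : 0 ≤ c) (x : ι → ℝ) : l2 (fun j => c * x j) = c * l2 x := by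
  unfold l2
  simp_rw [mul_pow]
  rw [← Finset.mul_sum, Real.sqrt_mul (sq_nonneg c), Real.sqrt_sq hc]

theorem l2_abs (x : ι → ℝ) : l2 (fun j => |x j|) = l2 x := by
  simp [l2]

theorem l2_le_add {w x y : ι → ℝ} (h : ∀ j, |w j| ≤ |x j| + |y j|) : l2 w ≤ l2 x + l2 y := by
  rw [← l2_abs x, ← l2_abs y]
  refine le_trans (l2_mono fun j => ?_) (l2_add_le _ _)
  rw [abs_of_nonneg (by positivity : 0 ≤ |x j| + |y j|)]
  exact h j

theorem l2_le_add₄ {w x y a b : ι → ℝ} (h : ∀ j, |w j| ≤ |x j| + |y j| + |a j| + |b j|) :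
    l2 w ≤ l2 x + l2 y + l2 a + l2 b := by
  rw [← l2_abs x, ← l2_abs y, ← l2_abs a, ← l2_abs b]
  refine le_trans (l2_mono (y := fun j => |x j| + |y j| + |a j| + |b j|) fun j => ?_) ?_
  · rw [abs_of_nonneg (by positivity : 0 ≤ |x j| + |y j| + |a j| + |b j|)]
    exact h j
  · refine (l2_add_le (fun j => |x j| + |y j| + |a j|) _).trans (add_le_add_left ?_ _)
    refine (l2_add_le (fun j => |x j| + |y j|) _).trans (add_le_add_left ?_ _)
    exact l2_add_le _ _

end SequenceNorm

/-! ### Decay of the residual for a diagonal system -/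

section Spectral

variable {ι : Type*} [Fintype ι] {lam β h g : ι → ℝ} {N Z : ℝ} {k : ℕ}

/-- The constant in the decay `residual ≤ N + C Z / P` of the residual. -/
noncomputable def decayConst (k : ℕ) : ℝ := 2 ^ (k + 2) * (k + 1).factorial

theorem four_le_decayConst (k : ℕ) : 4 ≤ decayConst k := by
  unfold decayConst
  have h1 : (1 : ℝ) ≤ (k + 1).factorial := by exact_mod_cast Nat.succ_le_of_lt (Nat.factorial_pos _)
  have h2 : (1 : ℝ) ≤ 2 ^ k := one_le_pow₀ (by norm_num)
  rw [pow_add]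
  nlinarith

/-- Low-frequency part of the data. With `β = e + lam h`, `h = z + lam ^ k g`, a damping factor
`ψ` that is small against `lam` and `lam ^ (k + 1)` leaves little more than the noise `e`. -/
theorem l2_damped_le (hlam : ∀ j, 0 ≤ lam j)
    (he : l2 (fun j => β j - lam j * h j) ≤ N) (hg : l2 g ≤ Z)
    (hz : l2 (fun j => h j - lam j ^ k * g j) ≤ Z) {ψ : ι → ℝ} {a b : ℝ} (ha : 0 ≤ a) (hb : 0 ≤ b)
    (hψ0 : ∀ j, 0 ≤ ψ j) (hψ1 : ∀ j, ψ j ≤ 1) (hψa : ∀ j, ψ j * lam j ≤ a)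
    (hψb : ∀ j, ψ j * lam j ^ (k + 1) ≤ b) :
    l2 (fun j => ψ j * β j) ≤ N + (a + b) * Z := by
  have hsplit : ∀ j, |ψ j * β j| ≤ |β j - lam j * h j| + |a * (h j - lam j ^ k * g j)|
      + |b * g j| + |(0 : ℝ)| := fun j => by
    have e1 : ψ j * β j = ψ j * (β j - lam j * h j) + ψ j * lam j * (h j - lam j ^ k * g j)
        + ψ j * lam j ^ (k + 1) * g j := by ring
    have hl := hlam j
    have h0 := hψ0 j
    rw [e1, abs_zero, add_zero]
    refine (abs_add_three _ _ _).trans (add_le_add_three ?_ ?_ ?_)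
    · rw [abs_mul, abs_of_nonneg h0]
      exact mul_le_of_le_one_left (abs_nonneg _) (hψ1 j)
    · rw [abs_mul, abs_mul a, abs_of_nonneg (mul_nonneg h0 hl), abs_of_nonneg ha]
      exact mul_le_mul_of_nonneg_right (hψa j) (abs_nonneg _)
    · rw [abs_mul, abs_mul b, abs_of_nonneg (mul_nonneg h0 (pow_nonneg hl _)), abs_of_nonneg hb]
      exact mul_le_mul_of_nonneg_right (hψb j) (abs_nonneg _)
  refine (l2_le_add₄ hsplit).trans ?_
  rw [l2_const_mul ha, l2_const_mul hb]
  have h0 : l2 (fun _ : ι => (0 : ℝ)) = 0 := by simp [l2]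
  rw [h0]
  nlinarith [mul_le_mul_of_nonneg_left hg hb, mul_le_mul_of_nonneg_left hz ha]

theorem pow_mul_exp_neg_le (j : ℕ) {x : ℝ} (hx : 0 ≤ x) : x ^ j * Real.exp (-x) ≤ j.factorial := by
  have h1 := Real.pow_div_factorial_le_exp x hx j
  rw [div_le_iff₀ (by positivity)] at h1
  rw [Real.exp_neg]
  have := Real.exp_pos x
  rw [← div_eq_mul_inv, div_le_iff₀ this]
  linarith

/-- Every polynomial of degree at most `m` with value `1` at `0` is a competitor for the `m`-th
residual polynomial. -/
theorem IsMinResidual.l2_residual_le {m : ℕ} {q : ℝ[X]} (hq : IsMinResidual lam β m q)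
    {t : ℝ[X]} (ht0 : t.eval 0 = 1) (ht : t.degree < (m + 1 : ℕ)) :
    l2 (fun j => (1 - lam j * q.eval (lam j)) * β j) ≤ l2 (fun j => t.eval (lam j) * β j) := by
  have h1 : t = 1 - X * (-t.divX) := by
    have := X_mul_divX_add t
    rw [← coeff_zero_eq_eval_zero] at ht0
    rw [ht0] at this
    rw [mul_neg, sub_neg_eq_add, add_comm]
    simpa using this.symm
  rw [l2_le_l2_iff]
  refine (hq.2 (-t.divX) ?_).trans (Finset.sum_le_sum fun j _ => le_of_eq ?_)
  · rw [degree_neg]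
    rcases eq_or_ne t.divX 0 with h0 | h0
    · rw [h0, degree_zero]; exact WithBot.bot_lt_coe _
    · have ht1 : t ≠ 0 := by rintro rfl; simp at h0
      rw [degree_eq_natDegree ht1, Nat.cast_lt] at ht
      rw [degree_eq_natDegree h0, Nat.cast_lt, natDegree_divX_eq_natDegree_tsub_one]
      have : t.natDegree ≠ 0 := fun h => h0 (divX_eq_zero_iff.2 (eq_C_of_natDegree_eq_zero h))
      lia
  · conv_rhs => rw [h1]
    simp

theorem IsMinResidual.neg_derivative_eval_zero (q : ℝ[X]) :
    -(1 - X * q).derivative.eval 0 = q.eval 0 := by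
  simp

/-- After many iterations, in the sense that `P = q(0)` is large, the residual is essentially at
the level of the noise. -/
theorem IsMinResidual.residual_le {m : ℕ} {q : ℝ[X]} (hq : IsMinResidual lam β m q)
    (hm : m ≤ activeNodes lam β) (hlam : ∀ j, 0 ≤ lam j) (hβ : ∀ j, lam j = 0 → β j = 0)
    (he : l2 (fun j => β j - lam j * h j) ≤ N) (hg : l2 g ≤ Z)
    (hz : l2 (fun j => h j - lam j ^ k * g j) ≤ Z) (hP : 1 ≤ q.eval 0) :
    l2 (fun j => (1 - lam j * q.eval (lam j)) * β j) ≤ N + decayConst k * Z / q.eval 0 := by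
  have hp := hq.isResidualPoly
  have hlam' : ∀ j, β j ≠ 0 → 0 < lam j := fun j hj =>
    lt_of_le_of_ne (hlam j) fun h0 => hj (hβ j h0.symm)
  have hm0 : m ≠ 0 := by
    rintro rfl
    have := hq.1
    simp only [Nat.cast_zero, Nat.WithBot.lt_zero_iff, degree_eq_bot] at this
    rw [this, eval_zero] at hP
    linarith
  obtain ⟨r, hr, hmin⟩ := hp.exists_min_root hlam' hm hm0
  have h1 := hp.sum_residual_sq_le hlam' hm hr hmin
  rw [IsMinResidual.neg_derivative_eval_zero] at h1
  set P := q.eval 0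
  have hP0 : 0 < P := by linarith
  set ψ : ι → ℝ := fun j => if lam j < r then Real.exp (-(lam j * P / 2)) else 0 with hψ
  have hψb : ∀ (i : ℕ) j, ψ j * lam j ^ i ≤ i.factorial * (2 / P) ^ i := fun i j => by
    simp only [hψ]
    split_ifs
    · have h2 := pow_mul_exp_neg_le i (x := lam j * P / 2) (by have := hlam j; positivity)
      calc Real.exp (-(lam j * P / 2)) * lam j ^ i
          = ((lam j * P / 2) ^ i * Real.exp (-(lam j * P / 2))) * (2 / P) ^ i := by
            rw [mul_right_comm, ← mul_pow, mul_comm]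
            congr 2; field_simp
        _ ≤ _ := mul_le_mul_of_nonneg_right h2 (by positivity)
    · rw [zero_mul]; positivity
  have h2P : (2 : ℝ) / P ^ 1 ≤ 2 := by
    rw [pow_one, div_le_iff₀ hP0]; linarith
  have hmain : l2 (fun j => ψ j * β j) ≤ N + (2 / P + (k + 1).factorial * (2 / P) ^ (k + 1)) * Z := by
    refine l2_damped_le hlam he hg hz (by positivity) (by positivity) (fun j => ?_) (fun j => ?_)
      (fun j => ?_) (hψb (k + 1))
    · simp only [hψ]; split_ifs <;> positivity
    · simpa using hψb 0 j
    · simpa using hψb 1 j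
  have hres : l2 (fun j => (1 - lam j * q.eval (lam j)) * β j) ≤ l2 (fun j => ψ j * β j) := by
    rw [l2_le_l2_iff]
    have e1 : ∑ j, ((1 - lam j * q.eval (lam j)) * β j) ^ 2
        = ∑ j, ((1 - X * q).eval (lam j) * β j) ^ 2 := by simp
    rw [e1]
    refine h1.trans (le_of_eq ?_)
    rw [Finset.sum_filter]
    refine Finset.sum_congr rfl fun j _ => ?_
    simp only [hψ]
    split_ifs
    · rw [mul_pow, ← Real.exp_nat_mul]; congr 2; push_cast; ring
    · simp
  refine (hres.trans hmain).trans ?_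
  have hZ : 0 ≤ Z := (l2_nonneg _).trans hg
  rw [mul_div_right_comm]
  gcongr
  have h3 : (2 / P) ^ (k + 1) ≤ 2 ^ (k + 1) / P := by
    rw [div_pow]
    gcongr
    exact le_self_pow₀ hP (by lia)
  have h4 : (1 : ℝ) ≤ (k + 1).factorial := by exact_mod_cast Nat.succ_le_of_lt (Nat.factorial_pos _)
  have h5 : (1 : ℝ) ≤ 2 ^ k := one_le_pow₀ (by norm_num)
  calc 2 / P + (k + 1).factorial * (2 / P) ^ (k + 1)
      ≤ 2 / P + (k + 1).factorial * (2 ^ (k + 1) / P) := by gcongr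
    _ = (2 + (k + 1).factorial * 2 ^ (k + 1)) / P := by ring
    _ ≤ decayConst k / P := by
      gcongr
      unfold decayConst
      rw [pow_add, pow_add]
      nlinarith

/-- One step before `P' = q'(0)` becomes large, the residual already is essentially at the level of
the noise. Either `P = q(0)` is itself comparable to `P'`, or the smallest root of the new residual
polynomial is isolated, and deleting it gives a good competitor of lower degree. -/
theorem IsMinResidual.residual_le_of_succ {m : ℕ} {q q' : ℝ[X]} (hq : IsMinResidual lam β m q)
    (hq' : IsMinResidual lam β (m + 1) q')
    (hm : m + 1 ≤ activeNodes lam β) (hlam : ∀ j, 0 ≤ lam j) (hβ : ∀ j, lam j = 0 → β j = 0)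
    (he : l2 (fun j => β j - lam j * h j) ≤ N) (hg : l2 g ≤ Z)
    (hz : l2 (fun j => h j - lam j ^ k * g j) ≤ Z) {A : ℝ} (hA : 2 ≤ A)
    (hP : 2 * A ≤ q'.eval 0) :
    l2 (fun j => (1 - lam j * q.eval (lam j)) * β j)
      ≤ (1 + A⁻¹) * N + 2 * A * decayConst k * Z / q'.eval 0 := by
  have hp := hq.isResidualPoly
  have hp' := hq'.isResidualPoly
  have hlam' : ∀ j, β j ≠ 0 → 0 < lam j := fun j hj =>
    lt_of_le_of_ne (hlam j) fun h0 => hj (hβ j h0.symm)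
  obtain ⟨r, hr, hmin⟩ := hp'.exists_min_root hlam' hm (Nat.succ_ne_zero m)
  have hr0 := hp'.root_pos hlam' hm hr
  have hstep := hp.neg_derivative_succ_le hp' hlam' hm hr hmin
  have hPsum := hp'.neg_derivative_eval_zero hlam' hm
  rw [IsMinResidual.neg_derivative_eval_zero, IsMinResidual.neg_derivative_eval_zero] at hstep
  rw [IsMinResidual.neg_derivative_eval_zero] at hPsum
  set P := q.eval 0
  set P' := q'.eval 0
  have hZ : 0 ≤ Z := (l2_nonneg _).trans hg
  have hN : 0 ≤ N := (l2_nonneg _).trans he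
  have hA0 : 0 < A := by linarith
  have hP'0 : 0 < P' := by linarith
  have hC := four_le_decayConst k
  by_cases hcase : 1 ≤ P * (A * r)
  · -- `P'` is comparable to `P`, since `P' ≤ P + 1 / r`
    have h1 : r⁻¹ ≤ A * P := by
      rw [inv_le_iff_one_le_mul₀ hr0]; linarith
    have h2 : P' ≤ (1 + A) * P := by linarith
    have hP1 : 1 ≤ P := by
      by_contra hlt
      nlinarith
    refine (hq.residual_le (by lia) hlam hβ he hg hz hP1).trans (add_le_add ?_ ?_)
    · have := inv_pos.2 hA0
      nlinarith
    · rw [div_le_div_iff₀ (by linarith) hP'0]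
      have h3 : decayConst k * Z * P' ≤ decayConst k * Z * ((2 * A) * P) := by
        gcongr
        nlinarith
      linarith
  · -- the inverses of the other roots sum to at most `P < 1 / (A r)`
    have hlt : P * (A * r) < 1 := not_le.1 hcase
    have hrP : A * r ≤ 2 * A / P' := by
      rw [le_div_iff₀ hP'0]
      have h1 : P' * r ≤ P * r + 1 := by
        have := mul_le_mul_of_nonneg_right hstep hr0.le
        rwa [add_mul, inv_mul_cancel₀ hr0.ne'] at this
      have h2 : A * (P * r) < 1 := by linarith
      nlinarith
    have hAr1 : A * r ≤ 1 := hrP.trans ((div_le_one hP'0).2 hP)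
    have hAr0 : 0 < A * r := by positivity
    have hsep : ∀ r' ∈ (1 - X * q').roots.erase r, A * r ≤ r' := fun r' hr' => by
      have hr'0 := hp'.root_pos hlam' hm (Multiset.mem_of_mem_erase hr')
      have hsum : ((1 - X * q').roots.map fun r => r⁻¹).sum
          = r⁻¹ + (((1 - X * q').roots.erase r).map fun r => r⁻¹).sum := by
        conv_lhs => rw [← Multiset.cons_erase hr]
        simp
      have hle : r'⁻¹ ≤ (((1 - X * q').roots.erase r).map fun r => r⁻¹).sum := by
        refine Multiset.single_le_sum (fun b hb => ?_) _ (Multiset.mem_map_of_mem _ hr')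
        obtain ⟨x, hx, rfl⟩ := Multiset.mem_map.1 hb
        exact (inv_pos.2 (hp'.root_pos hlam' hm (Multiset.mem_of_mem_erase hx))).le
      have h1 : r'⁻¹ ≤ P := by linarith
      by_contra hcon
      have h2 : r' < A * r := not_le.1 hcon
      have h3 : (A * r)⁻¹ < r'⁻¹ := inv_strictAnti₀ hr'0 h2
      have h4 : P < (A * r)⁻¹ := by rwa [← one_div, lt_div_iff₀ hAr0]
      linarith
    obtain ⟨t, ht0, htd, ht⟩ := hp'.exists_degree_lt_sum_sq_le hlam' hm hr hA hsep
    have h1 := hq.l2_residual_le ht0 htd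
    set ψ : ι → ℝ := fun j => if lam j ≤ A * r then 1 else 0 with hψ
    have h2 : l2 (fun j => t.eval (lam j) * β j) ≤ (1 + A⁻¹) * l2 (fun j => ψ j * β j) := by
      have hA1 : 0 ≤ 1 + A⁻¹ := by positivity
      rw [← l2_const_mul hA1, l2_le_l2_iff]
      refine ht.trans ?_
      rw [Finset.sum_filter, Finset.mul_sum]
      refine Finset.sum_le_sum fun j _ => ?_
      simp only [hψ]
      split_ifs
      · have := inv_pos.2 hA0
        nlinarith [sq_nonneg (β j)]
      · simp
    have h3 : l2 (fun j => ψ j * β j) ≤ N + (A * r + A * r) * Z := by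
      refine l2_damped_le hlam he hg hz hAr0.le hAr0.le (fun j => ?_) (fun j => ?_) (fun j => ?_)
        (fun j => ?_)
      · simp only [hψ]; split_ifs <;> norm_num
      · simp only [hψ]; split_ifs <;> norm_num
      · simp only [hψ]; split_ifs with hj
        · linarith
        · linarith
      · simp only [hψ]; split_ifs with hj
        · rw [one_mul]
          exact (pow_le_of_le_one (hlam j) (hj.trans hAr1) (by lia)).trans hj
        · linarith
    have hAi : A⁻¹ ≤ 1 := inv_le_one_of_one_le₀ (by linarith)
    have hAi0 := inv_pos.2 hA0
    calc l2 (fun j => (1 - lam j * q.eval (lam j)) * β j)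
        ≤ (1 + A⁻¹) * (N + (A * r + A * r) * Z) :=
          h1.trans (h2.trans (mul_le_mul_of_nonneg_left h3 (by positivity)))
      _ = (1 + A⁻¹) * N + (1 + A⁻¹) * (A * r + A * r) * Z := by ring
      _ ≤ (1 + A⁻¹) * N + 2 * (2 * A / P' + 2 * A / P') * Z := by gcongr; linarith
      _ = (1 + A⁻¹) * N + 2 * A * 4 * Z / P' := by ring
      _ ≤ (1 + A⁻¹) * N + 2 * A * decayConst k * Z / P' := by gcongr

/-- The residual vanishes after as many iterations as there are active nodes: the competitor
`∏ (1 - X / x)` over the active nodes `x` annihilates the data. -/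
theorem IsMinResidual.residual_eq_zero {q : ℝ[X]}
    (hq : IsMinResidual lam β (activeNodes lam β) q) (hβ : ∀ j, lam j = 0 → β j = 0) :
    l2 (fun j => (1 - lam j * q.eval (lam j)) * β j) = 0 := by
  classical
  have hfin : (lam '' {j | β j ≠ 0}).Finite := Set.toFinite _
  set F := hfin.toFinset with hF
  have hcard : F.card = activeNodes lam β := (Set.ncard_eq_toFinset_card _ hfin).symm
  set t : ℝ[X] := ∏ x ∈ F, (1 - C x⁻¹ * X) with ht
  refine le_antisymm ((hq.l2_residual_le (t := t) ?_ ?_).trans (le_of_eq ?_)) (l2_nonneg _)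
  · simp [ht, eval_prod]
  · refine degree_le_natDegree.trans_lt ?_
    rw [Nat.cast_lt, Nat.lt_succ_iff, ← hcard]
    refine (natDegree_prod_le _ _).trans ((Finset.sum_le_card_nsmul _ _ 1 fun x _ => ?_).trans (by simp))
    compute_degree
  · have : ∀ j, t.eval (lam j) * β j = 0 := fun j => by
      by_cases hj : β j = 0
      · rw [hj, mul_zero]
      have hl : lam j ≠ 0 := fun h0 => hj (hβ j h0)
      have : t.eval (lam j) = 0 := by
        rw [ht, eval_prod]
        refine Finset.prod_eq_zero (i := lam j) (by rw [hF]; simpa using ⟨j, hj, rfl⟩) ?_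
        simp [hl]
      rw [this, zero_mul]
    simp [l2, this]

end Spectral

/-! ### The discrepancy principle for a diagonal system -/

section Stopping

variable {ι : Type*} [Fintype ι] {lam β h g : ι → ℝ} {ε δ τ Z : ℝ} {k : ℕ}

/-- The target is not much larger than an iterate with a small residual. -/
theorem l2_source_le {q : ℝ[X]} {N : ℝ} (hlam : ∀ j, 0 ≤ lam j)
    (he : l2 (fun j => β j - lam j * h j) ≤ N) (hg : l2 g ≤ Z)
    (hz : l2 (fun j => h j - lam j ^ k * g j) ≤ Z) :
    l2 h ≤ l2 (fun j => q.eval (lam j) * β j)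
      + l2 (fun j => (1 - lam j * q.eval (lam j)) * β j) + N + 2 * Z := by
  set hm : ι → ℝ := fun j => q.eval (lam j) * β j
  set res : ι → ℝ := fun j => (1 - lam j * q.eval (lam j)) * β j
  have h1 : l2 h ≤ l2 (fun j => |hm j| + |res j|) + l2 (fun j => β j - lam j * h j)
      + l2 (fun j => h j - lam j ^ k * g j) + l2 g := by
    refine l2_le_add₄ fun j => ?_
    rw [abs_of_nonneg (by positivity : 0 ≤ |hm j| + |res j|)]
    have hl := hlam j
    rcases le_total (lam j) 1 with hle | hle
    · have e1 : h j = (h j - lam j ^ k * g j) + lam j ^ k * g j := by ring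
      have e2 : |lam j ^ k * g j| ≤ |g j| := by
        rw [abs_mul, abs_of_nonneg (pow_nonneg hl k)]
        exact mul_le_of_le_one_left (abs_nonneg _) (pow_le_one₀ hl hle)
      have e3 := abs_add_le (h j - lam j ^ k * g j) (lam j ^ k * g j)
      rw [← e1] at e3
      have := abs_nonneg (hm j); have := abs_nonneg (res j)
      have := abs_nonneg (β j - lam j * h j)
      linarith
    · have e1 : lam j * (hm j - h j) = (β j - lam j * h j) - res j := by
        simp only [hm, res]; ring
      have e2 : |hm j - h j| ≤ |β j - lam j * h j| + |res j| := by
        refine le_trans ?_ (abs_sub _ _)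
        rw [← e1, abs_mul, abs_of_nonneg hl]
        exact le_mul_of_one_le_left (abs_nonneg _) hle
      have e3 : |h j| ≤ |hm j| + |hm j - h j| := by
        have := abs_sub (hm j) (hm j - h j)
        rwa [sub_sub_cancel] at this
      have := abs_nonneg (h j - lam j ^ k * g j)
      have := abs_nonneg (g j)
      linarith
  have h2 : l2 (fun j => |hm j| + |res j|) ≤ l2 hm + l2 res := by
    have := l2_add_le (fun j => |hm j|) (fun j => |res j|)
    rwa [l2_abs, l2_abs] at this
  linarith

/-- Below `1 / q(0)`, hence below all roots of the residual polynomial, the residual polynomial is a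
contraction and the iteration polynomial is bounded by its value at `0`. -/
theorem iteration_poly_bounds {m : ℕ} {q : ℝ[X]} (hq : IsMinResidual lam β m q)
    (hm : m ≤ activeNodes lam β) (hlam : ∀ j, β j ≠ 0 → 0 < lam j) {x : ℝ} (hx0 : 0 < x)
    (hx : x * q.eval 0 ≤ 1) :
    0 ≤ q.eval 0 ∧ |1 - x * q.eval x| ≤ 1 ∧ |q.eval x| ≤ q.eval 0 := by
  have hp := hq.isResidualPoly
  have hsum := hp.neg_derivative_eval_zero hlam hm
  rw [IsMinResidual.neg_derivative_eval_zero] at hsum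
  have hpos : ∀ r ∈ (1 - X * q).roots, 0 < r := fun r => hp.root_pos hlam hm
  have hnn : ∀ b ∈ (1 - X * q).roots.map fun r => r⁻¹, 0 ≤ b := fun b hb => by
    obtain ⟨r, hr, rfl⟩ := Multiset.mem_map.1 hb
    exact (inv_pos.2 (hpos r hr)).le
  have hP : 0 ≤ q.eval 0 := by rw [hsum]; exact Multiset.sum_nonneg hnn
  have hxr : ∀ r ∈ (1 - X * q).roots, x ≤ r := fun r hr => by
    have h1 : r⁻¹ ≤ q.eval 0 := by
      rw [hsum]
      exact Multiset.single_le_sum hnn _ (Multiset.mem_map_of_mem _ hr)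
    have h2 : x * r⁻¹ ≤ 1 := (mul_le_mul_of_nonneg_left h1 hx0.le).trans hx
    have := hpos r hr
    rwa [← div_eq_mul_inv, div_le_one this] at h2
  have e1 := hp.eval_eq_prod hlam hm x
  have h1 : 0 ≤ (1 - X * q).eval x := by rw [e1]; exact prod_one_sub_div_nonneg hpos hxr
  have h2 : (1 - X * q).eval x ≤ 1 := by
    rw [e1]
    refine (prod_one_sub_div_le_exp hpos hxr).trans (Real.exp_le_one_iff.2 (neg_nonpos.2 ?_))
    rw [← hsum]; exact mul_nonneg hx0.le hP
  have h3 : 1 - x * q.eval 0 ≤ (1 - X * q).eval x := by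
    rw [e1, hsum]; exact one_sub_le_prod_one_sub_div hpos hx0.le hxr
  simp only [eval_sub, eval_one, eval_mul, eval_X] at h1 h2 h3
  refine ⟨hP, by rw [abs_of_nonneg h1]; exact h2, ?_⟩
  have h4 : 0 ≤ q.eval x := by
    by_contra hneg
    nlinarith
  rw [abs_of_nonneg h4]
  by_contra hcon
  nlinarith

/-- Error bounds at an iterate in terms of its residual and of a bound `Q ≥ 1` for `q(0)`. The two
norms stand for that of the feature space and that of the empirical `L²` space. -/
theorem l2_error_le {m : ℕ} {q : ℝ[X]} {N Q : ℝ} (hq : IsMinResidual lam β m q)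
    (hm : m ≤ activeNodes lam β) (hlam : ∀ j, 0 ≤ lam j) (hβ : ∀ j, lam j = 0 → β j = 0)
    (he : l2 (fun j => β j - lam j * h j) ≤ N) (hg : l2 g ≤ Z)
    (hz : l2 (fun j => h j - lam j ^ k * g j) ≤ Z) (hQ1 : 1 ≤ Q) (hQ : q.eval 0 ≤ Q) :
    l2 (fun j => q.eval (lam j) * β j - h j)
        ≤ 2 * Z + Q * (N + l2 (fun j => (1 - lam j * q.eval (lam j)) * β j)) ∧
    l2 (fun j => √(lam j) * (q.eval (lam j) * β j - h j))
        ≤ 2 * Z + √Q * (N + l2 (fun j => (1 - lam j * q.eval (lam j)) * β j)) := by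
  set res : ι → ℝ := fun j => (1 - lam j * q.eval (lam j)) * β j with hres
  set e : ι → ℝ := fun j => β j - lam j * h j with he'
  set z : ι → ℝ := fun j => h j - lam j ^ k * g j with hz'
  have hQ0 : 0 < Q := by linarith
  have hsQ : 0 ≤ √Q := Real.sqrt_nonneg _
  have hsQQ : √Q * √Q = Q := Real.mul_self_sqrt hQ0.le
  -- low frequencies `lam Q ≤ 1`: the error is `-p h + q e` with `|p| ≤ 1` and `|q| ≤ Q`
  have hlow : ∀ j, lam j * Q ≤ 1 →
      |q.eval (lam j) * β j - h j| ≤ |z j| + |g j| + Q * |e j| := fun j hj => by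
    have hl := hlam j
    have hl1 : lam j ≤ 1 := by nlinarith
    have hh : |h j| ≤ |z j| + |g j| := by
      have e1 : h j = z j + lam j ^ k * g j := by simp only [hz']; ring
      have e2 : |lam j ^ k * g j| ≤ |g j| := by
        rw [abs_mul, abs_of_nonneg (pow_nonneg hl k)]
        exact mul_le_of_le_one_left (abs_nonneg _) (pow_le_one₀ hl hl1)
      calc |h j| = |z j + lam j ^ k * g j| := by rw [← e1]
        _ ≤ _ := (abs_add_le _ _).trans (by linarith)
    by_cases hb : β j = 0
    · have hQe : 0 ≤ Q * |e j| := by positivity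
      rw [hb, mul_zero, zero_sub, abs_neg]; linarith
    have hl0 : 0 < lam j := lt_of_le_of_ne hl fun h0 => hb (hβ j h0.symm)
    obtain ⟨hP, h1, h2⟩ := iteration_poly_bounds hq hm
      (fun j hj => lt_of_le_of_ne (hlam j) fun h0 => hj (hβ j h0.symm)) hl0
      ((mul_le_mul_of_nonneg_left hQ hl).trans hj)
    have e1 : q.eval (lam j) * β j - h j
        = -((1 - lam j * q.eval (lam j)) * h j) + q.eval (lam j) * e j := by
      simp only [he']; ring
    rw [e1]
    refine (abs_add_le _ _).trans ?_
    rw [abs_neg, abs_mul, abs_mul]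
    have h3 : |1 - lam j * q.eval (lam j)| * |h j| ≤ |h j| :=
      mul_le_of_le_one_left (abs_nonneg _) h1
    have h4 : |q.eval (lam j)| * |e j| ≤ Q * |e j| :=
      mul_le_mul_of_nonneg_right (h2.trans hQ) (abs_nonneg _)
    linarith
  -- all frequencies: `lam` times the error is `e - res`
  have hhigh : ∀ j, lam j * |q.eval (lam j) * β j - h j| ≤ |e j| + |res j| := fun j => by
    rw [← abs_of_nonneg (hlam j), ← abs_mul, abs_of_nonneg (hlam j)]
    have e1 : lam j * (q.eval (lam j) * β j - h j) = e j - res j := by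
      simp only [he', hres]; ring
    rw [e1]; exact abs_sub _ _
  constructor
  · have h1 : l2 (fun j => q.eval (lam j) * β j - h j)
        ≤ l2 z + l2 g + l2 (fun j => Q * e j) + l2 (fun j => Q * res j) := by
      refine l2_le_add₄ fun j => ?_
      rw [abs_mul, abs_mul, abs_of_pos hQ0]
      have a1 := abs_nonneg (z j); have a2 := abs_nonneg (g j)
      have a3 := mul_nonneg hQ0.le (abs_nonneg (res j))
      rcases le_total (lam j * Q) 1 with hj | hj
      · have := hlow j hj; linarith
      · have h2 := mul_le_mul_of_nonneg_left (hhigh j) hQ0.le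
        have h3 : |q.eval (lam j) * β j - h j| ≤ Q * (lam j * |q.eval (lam j) * β j - h j|) := by
          rw [← mul_assoc, mul_comm Q]
          exact le_mul_of_one_le_left (abs_nonneg _) hj
        linarith
    rw [l2_const_mul hQ0.le, l2_const_mul hQ0.le] at h1
    nlinarith
  · have h1 : l2 (fun j => √(lam j) * (q.eval (lam j) * β j - h j))
        ≤ l2 z + l2 g + l2 (fun j => √Q * e j) + l2 (fun j => √Q * res j) := by
      refine l2_le_add₄ fun j => ?_
      rw [abs_mul, abs_mul, abs_mul, abs_of_nonneg hsQ, abs_of_nonneg (Real.sqrt_nonneg _)]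
      have a1 := abs_nonneg (z j); have a2 := abs_nonneg (g j)
      have a3 := mul_nonneg hsQ (abs_nonneg (res j))
      have a4 := abs_nonneg (e j)
      have a5 := Real.sqrt_nonneg (lam j)
      have a6 : √(lam j) * √(lam j) = lam j := Real.mul_self_sqrt (hlam j)
      have a7 : √(lam j) * √Q = √(lam j * Q) := (Real.sqrt_mul (hlam j) Q).symm
      rcases le_total (lam j * Q) 1 with hj | hj
      · have h2 := mul_le_mul_of_nonneg_left (hlow j hj) a5
        have h3 : √(lam j) * √Q ≤ 1 := by
          rw [a7]; exact Real.sqrt_le_one.2 hj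
        have h4 : √(lam j) ≤ 1 := Real.sqrt_le_one.2 (by have := hlam j; nlinarith)
        have h5 : √(lam j) * (Q * |e j|) = (√(lam j) * √Q) * (√Q * |e j|) := by
          calc √(lam j) * (Q * |e j|) = √(lam j) * ((√Q * √Q) * |e j|) := by rw [hsQQ]
            _ = _ := by ring
        have h6 := mul_le_mul_of_nonneg_right h3 (mul_nonneg hsQ a4)
        nlinarith
      · have h2 := mul_le_mul_of_nonneg_left (hhigh j) hsQ
        have h3 : 1 ≤ √(lam j) * √Q := by
          rw [a7]; exact Real.one_le_sqrt.2 hj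
        have h4 : √(lam j) * |q.eval (lam j) * β j - h j|
            ≤ √Q * (lam j * |q.eval (lam j) * β j - h j|) := by
          calc √(lam j) * |q.eval (lam j) * β j - h j|
              ≤ (√(lam j) * √Q) * (√(lam j) * |q.eval (lam j) * β j - h j|) :=
                le_mul_of_one_le_left (mul_nonneg a5 (abs_nonneg _)) h3
            _ = √Q * ((√(lam j) * √(lam j)) * |q.eval (lam j) * β j - h j|) := by ring
            _ = _ := by rw [a6]
        linarith
    rw [l2_const_mul hsQ, l2_const_mul hsQ] at h1
    nlinarith

/-- The discrepancy condition for a diagonal system: the residual of the iterate `q(lam) β` is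
below `τ` times the noise `δ ‖q(lam) β‖ + ε` it has to be expected to carry. -/
def Discrepancy (lam β : ι → ℝ) (τ δ ε : ℝ) (q : ℝ[X]) : Prop :=
  l2 (fun j => (1 - lam j * q.eval (lam j)) * β j)
    < τ * (δ * l2 (fun j => q.eval (lam j) * β j) + ε)

/-- If the discrepancy condition holds with `q(0) < 1 / (2 τ δ)` and `q(0)` times the noise is of
order one, the iterate has optimal accuracy. -/
theorem error_le_of_discrepancy {m : ℕ} {q : ℝ[X]} {C : ℝ} (hq : IsMinResidual lam β m q)
    (hm : m ≤ activeNodes lam β) (hlam : ∀ j, 0 ≤ lam j) (hβ : ∀ j, lam j = 0 → β j = 0)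
    (hτ : 1 < τ) (hδ : 0 < δ) (hδτ : δ * (8 * τ) ≤ 1) (hε : 0 < ε)
    (he : l2 (fun j => β j - lam j * h j) ≤ ε + δ * l2 h) (hN : ε + δ * l2 h ≤ Z) (hg : l2 g ≤ Z)
    (hz : l2 (fun j => h j - lam j ^ k * g j) ≤ Z) (hdp : Discrepancy lam β τ δ ε q)
    (hP : q.eval 0 * (2 * τ * δ) ≤ 1) (hC : 1 ≤ C) (hPN : q.eval 0 * (ε + δ * l2 h) ≤ C * Z) :
    ∑ j, lam j * (q.eval (lam j) * β j - h j) ^ 2 + δ * ∑ j, (q.eval (lam j) * β j - h j) ^ 2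
      ≤ 2 * (2 * τ + 6) ^ 2 * C ^ 2 * Z ^ 2 := by
  set N := ε + δ * l2 h with hNdef
  have hZ : 0 ≤ Z := (l2_nonneg _).trans hg
  have hh0 := l2_nonneg h
  have hN0 : 0 < N := by positivity
  set Q := max 1 (q.eval 0) with hQdef
  have hQ1 : 1 ≤ Q := le_max_left _ _
  have hτδ : 0 < τ * δ := by positivity
  have hQδ : Q * (2 * (τ * δ)) ≤ 1 := by
    rcases max_choice 1 (q.eval 0) with hmx | hmx <;> rw [hQdef, hmx] <;> nlinarith
  have hQN : Q * N ≤ C * Z := by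
    rcases max_choice 1 (q.eval 0) with hmx | hmx <;> rw [hQdef, hmx] <;> nlinarith
  obtain ⟨hv1, hv2⟩ := l2_error_le hq hm hlam hβ he hg hz hQ1 (le_max_right _ _)
  have hH : l2 (fun j => q.eval (lam j) * β j)
      ≤ l2 h + l2 (fun j => q.eval (lam j) * β j - h j) := by
    have := l2_add_le h (fun j => q.eval (lam j) * β j - h j)
    simpa using this
  unfold Discrepancy at hdp
  set R := l2 (fun j => (1 - lam j * q.eval (lam j)) * β j)
  set H := l2 (fun j => q.eval (lam j) * β j)
  set V := l2 (fun j => q.eval (lam j) * β j - h j) with hV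
  have hR0 : 0 ≤ R := l2_nonneg _
  have hV0 : 0 ≤ V := l2_nonneg _
  have hR : N + R ≤ (2 * τ + 2) * N + 4 * (τ * δ) * Z := by
    have h1 : τ * (δ * H + ε) ≤ τ * N + τ * δ * V := by
      rw [hNdef]; nlinarith
    have h2 : τ * δ * V ≤ τ * δ * (2 * Z) + (Q * (τ * δ)) * (N + R) := by nlinarith
    have h3 : (Q * (τ * δ)) * (N + R) ≤ 1 / 2 * (N + R) :=
      mul_le_mul_of_nonneg_right (by linarith) (by linarith)
    linarith
  set y := √Q with hy
  have hyy : y * y = Q := Real.mul_self_sqrt (by linarith)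
  have hy1 : 1 ≤ y := Real.one_le_sqrt.2 hQ1
  have hyQ : y ≤ Q := by nlinarith
  have hCZ : 0 ≤ C * Z := by positivity
  have hyN : y * N ≤ C * Z := by
    refine abs_le_of_sq_le_sq' ?_ hCZ |>.2
    calc (y * N) ^ 2 = (Q * N) * N := by rw [← hyy]; ring
      _ ≤ (C * Z) * Z := mul_le_mul hQN hN hN0.le hCZ
      _ ≤ (C * Z) * (C * Z) := mul_le_mul_of_nonneg_left (le_mul_of_one_le_left hZ hC) hCZ
      _ = (C * Z) ^ 2 := (sq _).symm
  have hZCZ : Z ≤ C * Z := le_mul_of_one_le_left hZ hC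
  have hyNR : y * (N + R) ≤ (2 * τ + 4) * (C * Z) := by
    have h1 : y * (τ * δ) ≤ 1 / 2 := by nlinarith
    have h2 := mul_le_mul_of_nonneg_left hR (by linarith : 0 ≤ y)
    have h3 := mul_le_mul_of_nonneg_right h1 hZ
    nlinarith
  have hsum1 : ∑ j, lam j * (q.eval (lam j) * β j - h j) ^ 2 ≤ ((2 * τ + 6) * (C * Z)) ^ 2 := by
    have h1 : ∑ j, lam j * (q.eval (lam j) * β j - h j) ^ 2
        = l2 (fun j => √(lam j) * (q.eval (lam j) * β j - h j)) ^ 2 := by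
      rw [l2_sq]
      refine Finset.sum_congr rfl fun j _ => ?_
      rw [mul_pow, Real.sq_sqrt (hlam j)]
    rw [h1]
    refine pow_le_pow_left₀ (l2_nonneg _) (hv2.trans ?_) 2
    linarith
  have hsum2 : δ * ∑ j, (q.eval (lam j) * β j - h j) ^ 2 ≤ ((2 * τ + 6) * (C * Z)) ^ 2 := by
    rw [← l2_sq, ← hV]
    have h1 : V ≤ y * ((2 * τ + 6) * (C * Z)) := by
      have h2 : Q * (N + R) ≤ y * ((2 * τ + 4) * (C * Z)) := by
        rw [← hyy, mul_assoc]
        exact mul_le_mul_of_nonneg_left hyNR (by linarith)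
      have h3 : Z ≤ y * (C * Z) := hZCZ.trans (le_mul_of_one_le_left hCZ hy1)
      linarith
    have h3 : V ^ 2 ≤ (y * ((2 * τ + 6) * (C * Z))) ^ 2 := pow_le_pow_left₀ hV0 h1 2
    have h4 : δ * Q ≤ 1 := by
      have h5 : δ * Q ≤ δ * Q * (2 * τ) :=
        le_mul_of_one_le_right (by positivity) (by linarith)
      linarith
    calc δ * V ^ 2 ≤ δ * (y * ((2 * τ + 6) * (C * Z))) ^ 2 := mul_le_mul_of_nonneg_left h3 hδ.le
      _ = (δ * Q) * ((2 * τ + 6) * (C * Z)) ^ 2 := by rw [← hyy]; ring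
      _ ≤ _ := mul_le_of_le_one_left (sq_nonneg _) h4
  linarith [show 2 * (2 * τ + 6) ^ 2 * C ^ 2 * Z ^ 2
    = ((2 * τ + 6) * (C * Z)) ^ 2 + ((2 * τ + 6) * (C * Z)) ^ 2 by ring]

/-- If the discrepancy condition fails at an iterate whose residual is of the order `δ Z`, then this
iterate is bounded by a multiple of `Z`, hence accurate as soon as the target is bounded as well. -/
theorem error_le_of_not_discrepancy {q : ℝ[X]} {C C' : ℝ} (hlam : ∀ j, 0 ≤ lam j)
    (hτ : 1 < τ) (hδ : 0 < δ) (hδτ : δ * (8 * τ) ≤ 1) (hε : 0 < ε)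
    (he : l2 (fun j => β j - lam j * h j) ≤ ε + δ * l2 h) (hN : ε + δ * l2 h ≤ Z)
    (hdp : ¬ Discrepancy lam β τ δ ε q) (hC' : 0 ≤ C')
    (hN' : ε + δ * l2 h ≤ C * (δ * Z))
    (hres : l2 (fun j => (1 - lam j * q.eval (lam j)) * β j) ≤ C' * (δ * Z)) :
    ∑ j, lam j * (q.eval (lam j) * β j - h j) ^ 2 + δ * ∑ j, (q.eval (lam j) * β j - h j) ^ 2
      ≤ 2 * (C + 2 * C' + 1) ^ 2 * Z ^ 2 := by
  have hh0 := l2_nonneg h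
  have hZ : 0 ≤ Z := le_trans (by positivity) hN
  unfold Discrepancy at hdp
  rw [not_lt] at hdp
  have hv : l2 (fun j => q.eval (lam j) * β j - h j) ≤ l2 (fun j => q.eval (lam j) * β j) + l2 h := by
    refine l2_le_add fun j => abs_sub _ _
  have hδ1 : δ ≤ 1 := by nlinarith
  have hw : l2 (fun j => √(lam j) * (q.eval (lam j) * β j - h j))
      ≤ l2 (fun j => q.eval (lam j) * β j - h j) + l2 (fun j => β j - lam j * h j)
        + l2 (fun j => (1 - lam j * q.eval (lam j)) * β j) + l2 (fun _ : ι => (0 : ℝ)) := by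
    refine l2_le_add₄ fun j => ?_
    rw [abs_zero, add_zero, abs_mul, abs_of_nonneg (Real.sqrt_nonneg _)]
    have a1 := abs_nonneg (q.eval (lam j) * β j - h j)
    rcases le_total (lam j) 1 with hj | hj
    · have h1 : √(lam j) ≤ 1 := Real.sqrt_le_one.2 hj
      have := abs_nonneg (β j - lam j * h j)
      have := abs_nonneg ((1 - lam j * q.eval (lam j)) * β j)
      nlinarith
    · have h1 : √(lam j) ≤ lam j := by
        rw [Real.sqrt_le_left (by linarith)]; nlinarith
      have h2 : lam j * |q.eval (lam j) * β j - h j|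
          ≤ |β j - lam j * h j| + |(1 - lam j * q.eval (lam j)) * β j| := by
        rw [← abs_of_nonneg (hlam j), ← abs_mul, abs_of_nonneg (hlam j)]
        have e1 : lam j * (q.eval (lam j) * β j - h j)
            = (β j - lam j * h j) - (1 - lam j * q.eval (lam j)) * β j := by ring
        rw [e1]; exact abs_sub _ _
      nlinarith
  have h0 : l2 (fun _ : ι => (0 : ℝ)) = 0 := by simp [l2]
  rw [h0] at hw
  set R := l2 (fun j => (1 - lam j * q.eval (lam j)) * β j)
  set H := l2 (fun j => q.eval (lam j) * β j)
  set V := l2 (fun j => q.eval (lam j) * β j - h j) with hV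
  have hH0 : 0 ≤ H := l2_nonneg _
  have hV0 : 0 ≤ V := l2_nonneg _
  have hH : H ≤ C' * Z := by
    have h1 : δ * H ≤ δ * (C' * Z) := by nlinarith [mul_nonneg hδ.le hH0]
    exact le_of_mul_le_mul_left h1 hδ
  have hh : l2 h ≤ C * Z := by
    have h1 : δ * l2 h ≤ δ * (C * Z) := by linarith
    exact le_of_mul_le_mul_left h1 hδ
  have hVle : V ≤ (C + 2 * C' + 1) * Z := by nlinarith [mul_nonneg hC' hZ]
  have hRZ : R ≤ C' * Z := by
    have : C' * (δ * Z) ≤ C' * Z := by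
      refine mul_le_mul_of_nonneg_left ?_ hC'
      exact mul_le_of_le_one_left hZ hδ1
    linarith
  have hsum1 : ∑ j, lam j * (q.eval (lam j) * β j - h j) ^ 2 ≤ ((C + 2 * C' + 1) * Z) ^ 2 := by
    have h1 : ∑ j, lam j * (q.eval (lam j) * β j - h j) ^ 2
        = l2 (fun j => √(lam j) * (q.eval (lam j) * β j - h j)) ^ 2 := by
      rw [l2_sq]
      refine Finset.sum_congr rfl fun j _ => ?_
      rw [mul_pow, Real.sq_sqrt (hlam j)]
    rw [h1]
    refine pow_le_pow_left₀ (l2_nonneg _) (hw.trans ?_) 2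
    nlinarith
  have hsum2 : δ * ∑ j, (q.eval (lam j) * β j - h j) ^ 2 ≤ ((C + 2 * C' + 1) * Z) ^ 2 := by
    rw [← l2_sq, ← hV]
    have h3 : V ^ 2 ≤ ((C + 2 * C' + 1) * Z) ^ 2 := pow_le_pow_left₀ hV0 hVle 2
    exact (mul_le_of_le_one_left (sq_nonneg _) hδ1).trans h3
  linarith [show 2 * (C + 2 * C' + 1) ^ 2 * Z ^ 2
    = ((C + 2 * C' + 1) * Z) ^ 2 + ((C + 2 * C' + 1) * Z) ^ 2 by ring]

/-- The separation factor `A` of the smallest root for which a residual `(1 + 2 / A) N` stays below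
`τ N` with room to spare. -/
noncomputable def marginConst (τ : ℝ) : ℝ := max 2 (8 / (τ - 1))

/-- When the noise `N` dominates, `q(0)` is at most this multiple of `Z / N` up to the first iterate
satisfying the discrepancy condition. -/
noncomputable def stopConst (τ : ℝ) (k : ℕ) : ℝ := 2 * marginConst τ ^ 2 * decayConst k

/-- The value of the ratio of the noise `ε + δ ‖h‖` to `δ Z` which separates the regime of dominating
noise from the regime of bounded targets. -/
noncomputable def regimeConst (τ : ℝ) (k : ℕ) : ℝ := 10 * τ / (τ - 1) + 4 * τ * stopConst τ k

/-- The constant in the error bound for the stopped iterates. -/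
noncomputable def errorConst (τ : ℝ) (k : ℕ) : ℝ :=
  2 * (2 * τ + 6) ^ 2 * (1 + stopConst τ k + regimeConst τ k) ^ 2
    + 2 * (regimeConst τ k + 2 * (2 * regimeConst τ k + 8 * τ * decayConst k) + 1) ^ 2

theorem stopConst_pos (τ : ℝ) (k : ℕ) : 0 < stopConst τ k := by
  have h1 : 2 ≤ marginConst τ := le_max_left _ _
  have h2 := four_le_decayConst k
  unfold stopConst; positivity

/-- If the noise `N` dominates `δ Z`, then `q(0)` does not exceed a multiple of `Z / N` one step after
the discrepancy condition failed. Otherwise the earlier residual would have been close to `N`, and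
the earlier iterate large enough for the threshold to exceed it. -/
theorem eval_zero_succ_mul_le {m : ℕ} {q q' : ℝ[X]} (hq : IsMinResidual lam β m q)
    (hq' : IsMinResidual lam β (m + 1) q')
    (hm : m + 1 ≤ activeNodes lam β) (hlam : ∀ j, 0 ≤ lam j) (hβ : ∀ j, lam j = 0 → β j = 0)
    (hτ : 1 < τ) (hδ : 0 < δ) (hε : 0 < ε)
    (he : l2 (fun j => β j - lam j * h j) ≤ ε + δ * l2 h) (hN : ε + δ * l2 h ≤ Z) (hg : l2 g ≤ Z)
    (hz : l2 (fun j => h j - lam j ^ k * g j) ≤ Z)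
    (hdp : ¬ Discrepancy lam β τ δ ε q)
    (hreg : regimeConst τ k * (δ * Z) ≤ ε + δ * l2 h) :
    q'.eval 0 * (ε + δ * l2 h) ≤ stopConst τ k * Z := by
  have hh0 := l2_nonneg h
  unfold Discrepancy at hdp
  rw [not_lt] at hdp
  have hlow := l2_source_le (q := q) hlam he hg hz
  set N := ε + δ * l2 h with hNdef
  have hN0 : 0 < N := by positivity
  have hZ : 0 < Z := hN0.trans_le hN
  set A := marginConst τ with hAdef
  have hA2 : 2 ≤ A := le_max_left _ _
  have hA8 : 8 / (τ - 1) ≤ A := le_max_right _ _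
  have hτ1 : 0 < τ - 1 := by linarith
  have hC := four_le_decayConst k
  have hC3 : stopConst τ k = 2 * A ^ 2 * decayConst k := rfl
  by_contra! hcon
  have hP : 2 * A ≤ q'.eval 0 := by
    by_contra hlt
    have h1 : q'.eval 0 * N ≤ 2 * A * N := mul_le_mul_of_nonneg_right (by linarith) hN0.le
    have h2 : 2 * A * N ≤ 2 * A * Z := mul_le_mul_of_nonneg_left hN (by linarith)
    have h3 : 2 * A * Z ≤ stopConst τ k * Z := by
      rw [hC3]; refine mul_le_mul_of_nonneg_right ?_ hZ.le
      nlinarith [mul_nonneg (by linarith : (0:ℝ) ≤ A - 2) (by linarith : (0:ℝ) ≤ A)]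
    linarith
  have hres := hq.residual_le_of_succ hq' hm hlam hβ he hg hz hA2 hP
  set P' := q'.eval 0
  set R := l2 (fun j => (1 - lam j * q.eval (lam j)) * β j)
  set H := l2 (fun j => q.eval (lam j) * β j)
  have hA0 : 0 < A := by linarith
  have hP'0 : 0 < P' := by linarith
  have hAi : A⁻¹ ≤ (τ - 1) / 8 := by
    rw [inv_le_comm₀ hA0 (by positivity), inv_div]; exact hA8
  have hAi2 : A⁻¹ ≤ 1 / 2 := by
    rw [inv_le_comm₀ hA0 (by norm_num)]; linarith
  have h1 : 2 * A * decayConst k * Z / P' ≤ A⁻¹ * N := by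
    rw [div_le_iff₀ hP'0, inv_mul_eq_div, div_mul_eq_mul_div, le_div_iff₀ hA0]
    rw [hC3] at hcon
    nlinarith
  have hR1 : R ≤ (1 + 2 * A⁻¹) * N := by linarith
  have hR2 : R ≤ 2 * N := by nlinarith
  have h2 : δ * (l2 h) ≤ δ * (H + 5 * Z) := mul_le_mul_of_nonneg_left (by linarith) hδ.le
  have h3 : τ * N - 5 * τ * (δ * Z) ≤ τ * (δ * H + ε) := by rw [hNdef]; nlinarith
  have h4 : 5 * τ * (δ * Z) ≤ (τ - 1) / 2 * N := by
    have h5 : 10 * τ / (τ - 1) * (δ * Z) ≤ N := by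
      refine le_trans (mul_le_mul_of_nonneg_right ?_ (by positivity)) hreg
      unfold regimeConst
      have := stopConst_pos τ k
      have : 0 < 4 * τ * stopConst τ k := by positivity
      linarith
    rw [div_mul_eq_mul_div, div_le_iff₀ hτ1] at h5
    linarith
  nlinarith

/-- **Accuracy of the modified discrepancy principle** (Nemirovskii), for a diagonal system
`lam h = β` with noise level `ε + δ ‖h‖ ≤ Z` in the data, and with a target `h` that is
the sum of an element `lam ^ k g` of the range of `lam ^ k` and an error, both of size `Z`. -/
theorem error_le_modified_discrepancy {q : ℕ → ℝ[X]}
    (hq : ∀ m, IsMinResidual lam β m (q m)) (hlam : ∀ j, 0 ≤ lam j) (hβ : ∀ j, lam j = 0 → β j = 0)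
    (hτ : 1 < τ) (hδ : 0 < δ) (hδτ : δ * (8 * τ) ≤ 1) (hε : 0 < ε)
    (he : l2 (fun j => β j - lam j * h j) ≤ ε + δ * l2 h) (hN : ε + δ * l2 h ≤ Z) (hg : l2 g ≤ Z)
    (hz : l2 (fun j => h j - lam j ^ k * g j) ≤ Z) {m₀ m₁ : ℕ}
    (hm₀ : Discrepancy lam β τ δ ε (q m₀)) (hmin : ∀ m < m₀, ¬ Discrepancy lam β τ δ ε (q m))
    (hm₁ : ((2 * τ)⁻¹ * δ⁻¹ ≤ (q m₀).eval 0 ∧ m₁ = m₀ - 1) ∨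
      ((q m₀).eval 0 < (2 * τ)⁻¹ * δ⁻¹ ∧ m₁ = m₀)) :
    ∑ j, lam j * ((q m₁).eval (lam j) * β j - h j) ^ 2
      + δ * ∑ j, ((q m₁).eval (lam j) * β j - h j) ^ 2 ≤ errorConst τ k * Z ^ 2 := by
  have hh0 := l2_nonneg h
  have hN0 : 0 < ε + δ * l2 h := by positivity
  have hZ : 0 < Z := hN0.trans_le hN
  have hτ0 : 0 < τ := by linarith
  have hS := stopConst_pos τ k
  have hD := four_le_decayConst k
  have hG0 : 0 < 10 * τ / (τ - 1) := div_pos (by linarith) (by linarith)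
  have hG : 4 * τ * stopConst τ k ≤ regimeConst τ k := by
    unfold regimeConst; linarith
  have hG1 : 0 < regimeConst τ k := lt_of_lt_of_le (by positivity) hG
  have hd : m₀ ≤ activeNodes lam β := by
    by_contra! hlt
    refine hmin _ hlt ?_
    unfold Discrepancy
    rw [(hq _).residual_eq_zero hβ]
    have := l2_nonneg (fun j => (q (activeNodes lam β)).eval (lam j) * β j)
    positivity
  have h2τδ : (2 * τ)⁻¹ * δ⁻¹ = 1 / (2 * τ * δ) := by rw [← mul_inv, one_div]
  rw [h2τδ] at hm₁
  -- the accuracy of `m₀` if it is not rejected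
  have hgood : (q m₀).eval 0 * (2 * τ * δ) ≤ 1 →
      (q m₀).eval 0 * (ε + δ * l2 h) ≤ (1 + stopConst τ k + regimeConst τ k) * Z →
      ∑ j, lam j * ((q m₀).eval (lam j) * β j - h j) ^ 2
        + δ * ∑ j, ((q m₀).eval (lam j) * β j - h j) ^ 2 ≤ errorConst τ k * Z ^ 2 := by
    intro h1 h2
    refine (error_le_of_discrepancy (hq m₀) hd hlam hβ hτ hδ hδτ hε he hN hg hz hm₀ h1
      (by linarith) h2).trans (mul_le_mul_of_nonneg_right ?_ (sq_nonneg Z))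
    unfold errorConst
    have := sq_nonneg (regimeConst τ k + 2 * (2 * regimeConst τ k + 8 * τ * decayConst k) + 1)
    linarith
  have h2τδ0 : 0 < 2 * τ * δ := by positivity
  by_cases hreg : regimeConst τ k * (δ * Z) ≤ ε + δ * l2 h
  · -- noise dominates: `q m₀` is never rejected
    have hPN : (q m₀).eval 0 * (ε + δ * l2 h) ≤ stopConst τ k * Z := by
      rcases Nat.eq_zero_or_pos m₀ with h0 | h0
      · have h1 := (hq m₀).1
        rw [h0] at h1
        simp only [Nat.cast_zero, Nat.WithBot.lt_zero_iff, degree_eq_bot] at h1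
        rw [h0, h1, eval_zero, zero_mul]; positivity
      · obtain ⟨m, rfl⟩ := Nat.exists_eq_succ_of_ne_zero h0.ne'
        exact eval_zero_succ_mul_le (hq m) (hq (m + 1)) hd hlam hβ hτ hδ hε he hN hg hz
          (hmin m (Nat.lt_succ_self m)) hreg
    have hP : (q m₀).eval 0 * (2 * τ * δ) ≤ 1 / 2 := by
      by_contra! hcon
      have hP0 : 0 < (q m₀).eval 0 := by
        by_contra hneg
        nlinarith
      have h1 : (q m₀).eval 0 * (4 * τ * stopConst τ k * (δ * Z)) ≤ stopConst τ k * Z := by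
        refine le_trans (mul_le_mul_of_nonneg_left ?_ hP0.le) hPN
        exact le_trans (mul_le_mul_of_nonneg_right hG (by positivity)) hreg
      have h2 : stopConst τ k * Z * (2 * ((q m₀).eval 0 * (2 * τ * δ))) ≤ stopConst τ k * Z * 1 := by
        linarith
      have h3 := le_of_mul_le_mul_left h2 (by positivity)
      linarith
    rcases hm₁ with ⟨h1, -⟩ | ⟨-, rfl⟩
    · rw [div_le_iff₀ h2τδ0] at h1
      linarith
    · refine hgood (by linarith) (hPN.trans (mul_le_mul_of_nonneg_right ?_ hZ.le))
      linarith
  · -- the target is bounded by a multiple of `Z`, and the noise by a multiple of `δ Z`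
    have hreg' := (not_le.1 hreg).le
    rcases hm₁ with ⟨h1, rfl⟩ | ⟨h1, rfl⟩
    · have h0 : m₀ ≠ 0 := by
        rintro rfl
        have h2 := (hq 0).1
        simp only [Nat.cast_zero, Nat.WithBot.lt_zero_iff, degree_eq_bot] at h2
        rw [h2, eval_zero] at h1
        have : 0 < 1 / (2 * τ * δ) := by positivity
        linarith
      obtain ⟨m, rfl⟩ := Nat.exists_eq_succ_of_ne_zero h0
      rw [Nat.succ_sub_one]
      have hP : 2 * 2 ≤ (q (m + 1)).eval 0 := by
        refine le_trans ?_ h1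
        rw [le_div_iff₀ h2τδ0]; linarith
      have hres := (hq m).residual_le_of_succ (hq (m + 1)) hd hlam hβ he hg hz le_rfl hP
      refine (error_le_of_not_discrepancy (C := regimeConst τ k)
        (C' := 2 * regimeConst τ k + 8 * τ * decayConst k) hlam hτ hδ hδτ hε he hN
        (hmin m (Nat.lt_succ_self m)) (by positivity) hreg' (hres.trans ?_)).trans
        (mul_le_mul_of_nonneg_right ?_ (sq_nonneg Z))
      · have h3 : 2 * 2 * decayConst k * Z / (q (m + 1)).eval 0
            ≤ 8 * τ * decayConst k * (δ * Z) := by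
          rw [div_le_iff₀ (by linarith)]
          rw [Nat.succ_eq_add_one, div_le_iff₀ h2τδ0] at h1
          have h4 : 4 * decayConst k * Z * 1
              ≤ 4 * decayConst k * Z * ((q (m + 1)).eval 0 * (2 * τ * δ)) :=
            mul_le_mul_of_nonneg_left h1 (by positivity)
          linarith
        have h5 : (1 + (2 : ℝ)⁻¹) * (ε + δ * l2 h) ≤ 2 * (ε + δ * l2 h) :=
          mul_le_mul_of_nonneg_right (by norm_num) hN0.le
        linarith
      · unfold errorConst
        have : 0 ≤ 2 * (2 * τ + 6) ^ 2 * (1 + stopConst τ k + regimeConst τ k) ^ 2 := by positivity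
        linarith
    · rw [lt_div_iff₀ h2τδ0] at h1
      refine hgood h1.le ?_
      by_cases hP0 : 0 ≤ (q m₁).eval 0
      · have h2 : (q m₁).eval 0 * (ε + δ * l2 h) ≤ (q m₁).eval 0 * (regimeConst τ k * (δ * Z)) :=
          mul_le_mul_of_nonneg_left hreg' hP0
        have h3 : (q m₁).eval 0 * δ ≤ 1 := by nlinarith [mul_nonneg hP0 hδ.le]
        have h4 : regimeConst τ k * Z * ((q m₁).eval 0 * δ) ≤ regimeConst τ k * Z * 1 :=
          mul_le_mul_of_nonneg_left h3 (by positivity)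
        nlinarith
      · refine (mul_nonpos_of_nonpos_of_nonneg (not_le.1 hP0).le hN0.le).trans ?_
        positivity

end Stopping

/-! ### Concentration of empirical means in `ℓ²` -/

section BoundedDifferences

variable {Ω : Type*} [MeasurableSpace Ω] (P : Measure Ω) [IsProbabilityMeasure P]

/-- The moment generating function in **McDiarmid's inequality**: a function of `n` independent
variables that changes by at most `c` when one variable changes is sub-Gaussian. The induction
conditions on the first variable and applies Hoeffding's lemma to the conditional mean. -/
theorem integral_exp_le_of_bounded_differences {c C : ℝ} (hc : 0 ≤ c) (t : ℝ) (n : ℕ)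
    (F : (Fin n → Ω) → ℝ) (hF : Measurable F) (hFC : ∀ z, |F z| ≤ C)
    (hdiff : ∀ z i a, |F (Function.update z i a) - F z| ≤ c) :
    ∫ z, Real.exp (t * (F z - ∫ y, F y ∂Measure.pi fun _ => P)) ∂(Measure.pi fun _ => P)
      ≤ Real.exp (n * (c / 2) ^ 2 * t ^ 2 / 2) := by
  obtain ⟨a₀⟩ : Nonempty Ω := nonempty_of_isProbabilityMeasure P
  induction n with
  | zero =>
    have h1 : ∀ z : Fin 0 → Ω, F z = F Fin.elim0 := fun z => by congr 1; exact Subsingleton.elim _ _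
    simp [h1]
  | succ n ih =>
    set π : Measure (Fin n → Ω) := Measure.pi fun _ => P
    have hmp := (measurePreserving_piFinSuccAbove (fun _ : Fin (n + 1) => P) 0).symm
    set F' : Ω × (Fin n → Ω) → ℝ := fun w => F (Fin.cons w.1 w.2) with hF'
    have hcons : Measurable fun w : Ω × (Fin n → Ω) => (Fin.cons w.1 w.2 : Fin (n + 1) → Ω) := by
      refine measurable_pi_iff.2 fun i => ?_
      refine Fin.cases ?_ (fun j => ?_) i
      · simpa using measurable_fst
      · simp only [Fin.cons_succ]
        exact (measurable_pi_apply j).comp measurable_snd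
    have hF'm : Measurable F' := hF.comp hcons
    have hint : ∀ f : (Fin (n + 1) → Ω) → ℝ, Measurable f → (∃ D, ∀ z, |f z| ≤ D) →
        ∫ z, f z ∂(Measure.pi fun _ => P) = ∫ a, ∫ z, f (Fin.cons a z) ∂π ∂P := by
      rintro f hf ⟨D, hD⟩
      rw [← hmp.integral_comp']
      have : ∀ w : Ω × (Fin n → Ω), (MeasurableEquiv.piFinSuccAbove (fun _ => Ω) 0).symm w
          = Fin.cons w.1 w.2 := fun w => by
        simp [MeasurableEquiv.piFinSuccAbove, Fin.insertNthEquiv]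
      simp_rw [this]
      refine integral_prod _ ?_
      exact Integrable.of_bound (hf.comp hcons).aestronglyMeasurable D
        (Filter.Eventually.of_forall fun w => hD _)
    have hslice : ∀ a, Measurable fun z : Fin n → Ω => F (Fin.cons a z) := fun a =>
      hF'm.comp measurable_prodMk_left
    have hslint : ∀ a, Integrable (fun z : Fin n → Ω => F (Fin.cons a z)) π := fun a =>
      Integrable.of_bound (hslice a).aestronglyMeasurable C
        (Filter.Eventually.of_forall fun z => hFC _)
    set G : Ω → ℝ := fun a => ∫ z, F (Fin.cons a z) ∂π with hG
    have hGm : Measurable G :=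
      (StronglyMeasurable.integral_prod_right (f := fun a z => F (Fin.cons a z))
        hF'm.stronglyMeasurable).measurable
    have hGdiff : ∀ a b, |G a - G b| ≤ c := fun a b => by
      rw [hG]
      simp only
      rw [← integral_sub (hslint a) (hslint b)]
      have h1 : ∀ᵐ z ∂π, ‖F (Fin.cons a z) - F (Fin.cons b z)‖ ≤ c :=
        Filter.Eventually.of_forall fun z => by
          have := hdiff (Fin.cons b z) 0 a
          rwa [Fin.update_cons_zero] at this
      simpa using norm_integral_le_of_norm_le_const h1
    have hGbdd : BddBelow (Set.range G) := ⟨G a₀ - c, by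
      rintro _ ⟨a, rfl⟩
      have := abs_le.1 (hGdiff a₀ a)
      linarith [this.2]⟩
    have : Nonempty Ω := ⟨a₀⟩
    set l := ⨅ a, G a
    have hGIcc : ∀ a, G a ∈ Set.Icc l (l + c) := fun a => by
      refine ⟨ciInf_le hGbdd a, ?_⟩
      have : G a - c ≤ l := le_ciInf fun b => by
        have := abs_le.1 (hGdiff a b)
        linarith [this.2]
      linarith
    have hH := (hasSubgaussianMGF_of_mem_Icc (μ := P) hGm.aemeasurable
      (Filter.Eventually.of_forall hGIcc)).mgf_le t
    have hEF : ∫ z, F z ∂(Measure.pi fun _ => P) = ∫ a, G a ∂P := hint F hF ⟨C, hFC⟩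
    have hGC : ∀ a, |G a| ≤ C := fun a => by
      have := norm_integral_le_of_norm_le_const (μ := π) (f := fun z => F (Fin.cons a z)) (C := C)
        (Filter.Eventually.of_forall fun z => hFC _)
      simpa using this
    have hC0 : 0 ≤ C := (abs_nonneg _).trans (hGC a₀)
    set m := ∫ a, G a ∂P
    have hm : |m| ≤ C := by
      have := norm_integral_le_of_norm_le_const (μ := P) (f := G) (C := C)
        (Filter.Eventually.of_forall hGC)
      simpa using this
    rw [hEF, hint _ (by fun_prop) ⟨Real.exp (|t| * (C + C)), fun z => by
      rw [abs_of_pos (Real.exp_pos _)]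
      refine Real.exp_le_exp.2 ((le_abs_self _).trans ?_)
      rw [abs_mul]
      exact mul_le_mul_of_nonneg_left ((abs_sub _ _).trans (add_le_add (hFC z) hm))
        (abs_nonneg _)⟩]
    have hinner : ∀ a, ∫ z, Real.exp (t * (F (Fin.cons a z) - m)) ∂π
        ≤ Real.exp (t * (G a - m)) * Real.exp (n * (c / 2) ^ 2 * t ^ 2 / 2) := fun a => by
      have h1 := ih (fun z => F (Fin.cons a z)) (hslice a) (fun z => hFC _) fun z i b => by
        have := hdiff (Fin.cons a z) i.succ b
        rwa [← Fin.cons_update] at this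
      have h2 : ∀ z : Fin n → Ω, Real.exp (t * (F (Fin.cons a z) - m))
          = Real.exp (t * (G a - m)) * Real.exp (t * (F (Fin.cons a z) - G a)) := fun z => by
        rw [← Real.exp_add]; congr 1; ring
      simp_rw [h2]
      rw [integral_const_mul]
      exact mul_le_mul_of_nonneg_left h1 (Real.exp_nonneg _)
    have hGint : Integrable (fun a => Real.exp (t * (G a - m))) P := by
      refine Integrable.of_bound (by fun_prop) (Real.exp (|t| * (C + C)))
        (Filter.Eventually.of_forall fun a => ?_)
      rw [Real.norm_eq_abs, abs_of_pos (Real.exp_pos _)]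
      refine Real.exp_le_exp.2 ((le_abs_self _).trans ?_)
      rw [abs_mul]
      exact mul_le_mul_of_nonneg_left ((abs_sub _ _).trans (add_le_add (hGC a) hm)) (abs_nonneg _)
    have hmgf : ∫ a, Real.exp (t * (G a - m)) ∂P ≤ Real.exp ((c / 2) ^ 2 * t ^ 2 / 2) := by
      refine hH.trans (le_of_eq ?_)
      congr 2
      simp [abs_of_nonneg hc]
    calc ∫ a, ∫ z, Real.exp (t * (F (Fin.cons a z) - m)) ∂π ∂P
        ≤ ∫ a, Real.exp (t * (G a - m)) * Real.exp (n * (c / 2) ^ 2 * t ^ 2 / 2) ∂P :=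
          integral_mono_of_nonneg (Filter.Eventually.of_forall fun a =>
            integral_nonneg fun z => (Real.exp_pos _).le) (hGint.mul_const _)
            (Filter.Eventually.of_forall hinner)
      _ ≤ Real.exp ((c / 2) ^ 2 * t ^ 2 / 2) * Real.exp (n * (c / 2) ^ 2 * t ^ 2 / 2) := by
          rw [integral_mul_const]
          exact mul_le_mul_of_nonneg_right hmgf (Real.exp_nonneg _)
      _ = Real.exp ((n + 1 : ℕ) * (c / 2) ^ 2 * t ^ 2 / 2) := by
          rw [← Real.exp_add]; congr 1; push_cast; ring

/-- **McDiarmid's inequality.** -/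
theorem measure_ge_le_of_bounded_differences {c C : ℝ} (hc : 0 ≤ c) {n : ℕ}
    (F : (Fin n → Ω) → ℝ) (hF : Measurable F) (hFC : ∀ z, |F z| ≤ C)
    (hdiff : ∀ z i a, |F (Function.update z i a) - F z| ≤ c) {s : ℝ} (hs : 0 ≤ s) :
    (Measure.pi fun _ : Fin n => P).real {z | s ≤ F z - ∫ y, F y ∂Measure.pi fun _ => P}
      ≤ Real.exp (-s ^ 2 / (2 * (n * (c / 2) ^ 2))) := by
  have hsub : HasSubgaussianMGF (fun z => F z - ∫ y, F y ∂Measure.pi fun _ => P)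
      ⟨n * (c / 2) ^ 2, by positivity⟩ (Measure.pi fun _ : Fin n => P) := by
    refine ⟨fun t => ?_, fun t => ?_⟩
    · have hm : |∫ y, F y ∂Measure.pi fun _ : Fin n => P| ≤ C := by
        have := norm_integral_le_of_norm_le_const (μ := Measure.pi fun _ : Fin n => P) (f := F)
          (C := C) (Filter.Eventually.of_forall hFC)
        simpa using this
      refine Integrable.of_bound (by fun_prop) (Real.exp (|t| * (C + C)))
        (Filter.Eventually.of_forall fun a => ?_)
      rw [Real.norm_eq_abs, abs_of_pos (Real.exp_pos _)]
      refine Real.exp_le_exp.2 ((le_abs_self _).trans ?_)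
      rw [abs_mul]
      exact mul_le_mul_of_nonneg_left ((abs_sub _ _).trans (add_le_add (hFC a) hm)) (abs_nonneg _)
    · exact integral_exp_le_of_bounded_differences P hc t n F hF hFC hdiff
  exact hsub.measure_ge_le hs

end BoundedDifferences

section EmpiricalMean

theorem lp_two_hasSum_sq {ι : Type*} (v : lp (fun _ : ι => ℝ) 2) :
    HasSum (fun i => v i ^ 2) (‖v‖ ^ 2) := by
  have h := lp.hasSum_norm (p := 2) (by norm_num) v
  simpa using h

variable {Ω ι : Type*}

/-- The deviation of the empirical mean of a random element of `ℓ²` from `m`. -/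
noncomputable def meanDeviation {n : ℕ} (Ψ : Ω → lp (fun _ : ι => ℝ) 2)
    (m : lp (fun _ : ι => ℝ) 2) (z : Fin n → Ω) : ℝ :=
  ‖(n : ℝ)⁻¹ • ∑ l, Ψ (z l) - m‖

section Deviation

variable {n : ℕ} {Ψ : Ω → lp (fun _ : ι => ℝ) 2} {m : lp (fun _ : ι => ℝ) 2} {B : ℝ}

theorem meanDeviation_hasSum (z : Fin n → Ω) :
    HasSum (fun i => ((n : ℝ)⁻¹ * ∑ l, Ψ (z l) i - m i) ^ 2) (meanDeviation Ψ m z ^ 2) := by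
  have h := lp_two_hasSum_sq ((n : ℝ)⁻¹ • ∑ l, Ψ (z l) - m)
  have h1 : ∀ i, ((n : ℝ)⁻¹ • ∑ l, Ψ (z l) - m : lp (fun _ : ι => ℝ) 2) i
      = (n : ℝ)⁻¹ * ∑ l, Ψ (z l) i - m i := fun i => by
    rw [lp.coeFn_sub, Pi.sub_apply, lp.coeFn_smul, Pi.smul_apply, lp.coeFn_sum, Finset.sum_apply,
      smul_eq_mul]
  simp only [h1] at h
  exact h

theorem meanDeviation_nonneg (z : Fin n → Ω) : 0 ≤ meanDeviation Ψ m z := norm_nonneg _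

theorem meanDeviation_update_le (hB : ∀ z, ‖Ψ z‖ ≤ B) (z : Fin n → Ω) (i : Fin n) (a : Ω) :
    |meanDeviation Ψ m (Function.update z i a) - meanDeviation Ψ m z| ≤ 2 * B / n := by
  unfold meanDeviation
  refine (abs_norm_sub_norm_le _ _).trans ?_
  rw [sub_sub_sub_cancel_right, ← smul_sub, ← Finset.sum_sub_distrib]
  have h1 : ∑ l, (Ψ (Function.update z i a l) - Ψ (z l)) = Ψ a - Ψ (z i) := by
    rw [Finset.sum_eq_single i (fun l _ hl => by rw [Function.update_of_ne hl, sub_self])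
      (fun h => absurd (Finset.mem_univ i) h), Function.update_self]
  rw [h1, norm_smul, norm_inv, Real.norm_natCast, inv_mul_eq_div]
  gcongr
  refine (norm_sub_le _ _).trans ?_
  linarith [hB a, hB (z i)]

theorem meanDeviation_le (hB0 : 0 ≤ B) (hB : ∀ z, ‖Ψ z‖ ≤ B) (z : Fin n → Ω) :
    meanDeviation Ψ m z ≤ B + ‖m‖ := by
  unfold meanDeviation
  refine (norm_sub_le _ _).trans (add_le_add_left ?_ _)
  rcases Nat.eq_zero_or_pos n with rfl | hn
  · simpa using hB0
  · rw [norm_smul, norm_inv, Real.norm_natCast, inv_mul_le_iff₀ (by exact_mod_cast hn)]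
    refine (norm_sum_le _ _).trans ((Finset.sum_le_card_nsmul _ _ B fun l _ => hB _).trans ?_)
    simp

end Deviation

variable [MeasurableSpace Ω] (P : Measure Ω) [IsProbabilityMeasure P]

theorem lp_two_coord_sq_le {v : lp (fun _ : ι => ℝ) 2} {B : ℝ} (hB : ‖v‖ ≤ B) (s : Finset ι) :
    ∑ i ∈ s, v i ^ 2 ≤ B ^ 2 :=
  (sum_le_hasSum s (fun _ _ => sq_nonneg _) (lp_two_hasSum_sq v)).trans
    (pow_le_pow_left₀ (norm_nonneg _) hB 2)

theorem lp_two_abs_coord_le {v : lp (fun _ : ι => ℝ) 2} {B : ℝ} (hB : ‖v‖ ≤ B) (i : ι) :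
    |v i| ≤ B := by
  have := lp_two_coord_sq_le hB {i}
  rw [Finset.sum_singleton] at this
  exact abs_le_of_sq_le_sq this ((norm_nonneg _).trans hB)

theorem integral_sq_le_integral_sq {f : Ω → ℝ} {B : ℝ} (hf : Measurable f) (hB : ∀ z, |f z| ≤ B) :
    (∫ z, f z ∂P) ^ 2 ≤ ∫ z, f z ^ 2 ∂P := by
  have h2 : MemLp f 2 P := MemLp.of_bound hf.aestronglyMeasurable B
    (Filter.Eventually.of_forall hB)
  have h := variance_nonneg f P
  rw [variance_eq_sub h2] at h
  simpa using h

theorem sum_integral_coord_sq_le {Ψ : Ω → lp (fun _ : ι => ℝ) 2}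
    (hΨ : ∀ i, Measurable fun z => Ψ z i) {B : ℝ} (hB : ∀ z, ‖Ψ z‖ ≤ B) (s : Finset ι) :
    ∑ i ∈ s, ∫ z, Ψ z i ^ 2 ∂P ≤ B ^ 2 := by
  calc ∑ i ∈ s, ∫ z, Ψ z i ^ 2 ∂P = ∫ z, ∑ i ∈ s, Ψ z i ^ 2 ∂P := by
        rw [integral_finsetSum]
        refine fun i _ => Integrable.of_bound ((hΨ i).pow_const 2).aestronglyMeasurable (B ^ 2)
          (Filter.Eventually.of_forall fun z => ?_)
        rw [Real.norm_eq_abs, abs_pow]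
        exact pow_le_pow_left₀ (abs_nonneg _) (lp_two_abs_coord_le (hB z) i) 2
    _ ≤ ∫ _, B ^ 2 ∂P :=
        integral_mono_of_nonneg (Filter.Eventually.of_forall fun z =>
          Finset.sum_nonneg fun i _ => sq_nonneg _) (integrable_const _)
          (Filter.Eventually.of_forall fun z => lp_two_coord_sq_le (hB z) s)
    _ = B ^ 2 := by simp

/-- The mean of a bounded random element of `ℓ²` with measurable coordinates. -/
theorem exists_lp_mean {Ψ : Ω → lp (fun _ : ι => ℝ) 2} (hΨ : ∀ i, Measurable fun z => Ψ z i)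
    {B : ℝ} (hB : ∀ z, ‖Ψ z‖ ≤ B) : ∃ m : lp (fun _ : ι => ℝ) 2, ∀ i, m i = ∫ z, Ψ z i ∂P := by
  have hmem : Memℓp (fun i => ∫ z, Ψ z i ∂P) 2 := by
    rw [memℓp_gen_iff (by norm_num)]
    have : Summable fun i => (∫ z, Ψ z i ∂P) ^ 2 := by
      refine summable_of_sum_le (c := B ^ 2) (fun i => sq_nonneg _) fun s => ?_
      exact (Finset.sum_le_sum fun i _ =>
        integral_sq_le_integral_sq P (hΨ i) fun z => lp_two_abs_coord_le (hB z) i).trans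
          (sum_integral_coord_sq_le P hΨ hB s)
    simpa using this
  exact ⟨⟨_, hmem⟩, fun i => rfl⟩

variable {P} {n : ℕ} {Ψ : Ω → lp (fun _ : ι => ℝ) 2} {m : lp (fun _ : ι => ℝ) 2} {B : ℝ}

theorem measurable_meanDeviation [Countable ι] (hΨ : ∀ i, Measurable fun z => Ψ z i) :
    Measurable fun z : Fin n → Ω => meanDeviation Ψ m z := by
  have h1 : ∀ z : Fin n → Ω, meanDeviation Ψ m z
      = √(∑' i, ((n : ℝ)⁻¹ * ∑ l, Ψ (z l) i - m i) ^ 2) := fun z => by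
    rw [(meanDeviation_hasSum z).tsum_eq, Real.sqrt_sq (meanDeviation_nonneg z)]
  simp_rw [h1]
  refine Real.continuous_sqrt.measurable.comp ?_
  refine Measurable.tsum fun i => ?_
  refine Measurable.pow_const (Measurable.sub_const (Measurable.const_mul ?_ _) _) 2
  exact Finset.measurable_sum _ fun l _ => (hΨ i).comp (measurable_pi_apply l)

/-- The variances of the coordinates add up to at most `B ^ 2 / n`. -/
theorem integral_meanDeviation_le [Countable ι] (hn : 0 < n) (hΨ : ∀ i, Measurable fun z => Ψ z i)
    (hB : ∀ z, ‖Ψ z‖ ≤ B) (hm : ∀ i, m i = ∫ z, Ψ z i ∂P) :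
    ∫ z, meanDeviation Ψ m z ∂(Measure.pi fun _ : Fin n => P) ≤ B / √n := by
  obtain ⟨a₀⟩ : Nonempty Ω := nonempty_of_isProbabilityMeasure P
  have hB0 : 0 ≤ B := (norm_nonneg _).trans (hB a₀)
  set π := Measure.pi fun _ : Fin n => P
  have hn0 : (0 : ℝ) < n := by exact_mod_cast hn
  have hmeas := measurable_meanDeviation (n := n) (m := m) hΨ
  have hcoord : ∀ i, ∫ z, ((n : ℝ)⁻¹ * ∑ l, Ψ (z l) i - m i) ^ 2 ∂π
      ≤ (n : ℝ)⁻¹ * ∫ z, Ψ z i ^ 2 ∂P := fun i => by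
    have hbd : ∀ z, |Ψ z i| ≤ B := fun z => lp_two_abs_coord_le (hB z) i
    have hL2 : MemLp (fun z => Ψ z i) 2 P := MemLp.of_bound (hΨ i).aestronglyMeasurable B
      (Filter.Eventually.of_forall hbd)
    have hvar := variance_sum_pi (μ := fun _ : Fin n => P) (X := fun _ z => Ψ z i) fun _ => hL2
    have hsumm : Measurable fun z : Fin n → Ω => ∑ l, Ψ (z l) i :=
      Finset.measurable_sum _ fun l _ => (hΨ i).comp (measurable_pi_apply l)
    have hmean : ∫ z, (∑ l, fun z : Fin n → Ω => Ψ (z l) i) z ∂π = n * m i := by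
      simp only [Finset.sum_apply]
      rw [integral_finsetSum]
      · have : ∀ l : Fin n, ∫ z, Ψ (z l) i ∂π = m i := fun l => by
          rw [hm i]
          have h := integral_map (μ := π) (φ := Function.eval l) (f := fun z => Ψ z i)
            (measurable_pi_apply l).aemeasurable (hΨ i).aestronglyMeasurable
          rw [(measurePreserving_eval (fun _ : Fin n => P) l).map_eq] at h
          exact h.symm
        simp [this]
      · intro l _
        exact Integrable.of_bound ((hΨ i).comp (measurable_pi_apply l)).aestronglyMeasurable B
          (Filter.Eventually.of_forall fun z => hbd _)
    rw [variance_eq_integral (by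
      refine Measurable.aemeasurable ?_
      simpa only [Finset.sum_fn] using hsumm), hmean] at hvar
    have h1 : ∀ z : Fin n → Ω, ((n : ℝ)⁻¹ * ∑ l, Ψ (z l) i - m i) ^ 2
        = ((n : ℝ)⁻¹) ^ 2 * ((∑ l, fun z : Fin n → Ω => Ψ (z l) i) z - n * m i) ^ 2 := fun z => by
      simp only [Finset.sum_apply]
      field_simp
    simp_rw [h1]
    rw [integral_const_mul, hvar]
    simp only [Finset.sum_const, Finset.card_univ, Fintype.card_fin, nsmul_eq_mul]
    have h2 : Var[fun z => Ψ z i; P] ≤ ∫ z, Ψ z i ^ 2 ∂P := by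
      have := variance_le_expectation_sq (μ := P) (X := fun z => Ψ z i) (hΨ i).aestronglyMeasurable
      simpa using this
    calc ((n : ℝ)⁻¹) ^ 2 * (n * Var[fun z => Ψ z i; P])
        = (n : ℝ)⁻¹ * Var[fun z => Ψ z i; P] := by field_simp
      _ ≤ _ := mul_le_mul_of_nonneg_left h2 (by positivity)
  have hbound : ∀ z : Fin n → Ω, |meanDeviation Ψ m z| ≤ B + ‖m‖ := fun z => by
    rw [abs_of_nonneg (meanDeviation_nonneg z)]; exact meanDeviation_le hB0 hB z
  have hsq : ∫ z, meanDeviation Ψ m z ^ 2 ∂π ≤ (n : ℝ)⁻¹ * B ^ 2 := by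
    set F : ι → (Fin n → Ω) → ℝ := fun i z => ((n : ℝ)⁻¹ * ∑ l, Ψ (z l) i - m i) ^ 2 with hFdef
    have hF0 : ∀ i z, 0 ≤ F i z := fun i z => sq_nonneg _
    have hFm : ∀ i, Measurable (F i) := fun i => by
      refine Measurable.pow_const (Measurable.sub_const (Measurable.const_mul ?_ _) _) 2
      exact Finset.measurable_sum _ fun l _ => (hΨ i).comp (measurable_pi_apply l)
    have hFint : ∀ i, Integrable (F i) π := fun i => by
      refine Integrable.of_bound (hFm i).aestronglyMeasurable ((B + ‖m‖) ^ 2)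
        (Filter.Eventually.of_forall fun z => ?_)
      rw [Real.norm_eq_abs, abs_of_nonneg (hF0 i z)]
      exact (le_hasSum (meanDeviation_hasSum z) i fun j _ => hF0 j z).trans
        (pow_le_pow_left₀ (meanDeviation_nonneg z) (meanDeviation_le hB0 hB z) 2)
    have hsum : ∀ s : Finset ι, ∑ i ∈ s, ∫ z, F i z ∂π ≤ (n : ℝ)⁻¹ * B ^ 2 := fun s => by
      refine (Finset.sum_le_sum fun i _ => hcoord i).trans ?_
      rw [← Finset.mul_sum]
      exact mul_le_mul_of_nonneg_left (sum_integral_coord_sq_le P hΨ hB s) (by positivity)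
    have hsm : Summable fun i => ∫ z, F i z ∂π :=
      summable_of_sum_le (fun i => integral_nonneg (hF0 i)) hsum
    have hH := hasSum_integral_of_summable_integral_norm hFint (by
      simpa only [Real.norm_eq_abs, abs_of_nonneg (hF0 _ _)] using hsm)
    have h2 : ∀ z, ∑' i, F i z = meanDeviation Ψ m z ^ 2 := fun z =>
      (meanDeviation_hasSum z).tsum_eq
    simp_rw [h2] at hH
    rw [← hH.tsum_eq]
    exact hsm.tsum_le_of_sum_le hsum
  have h1 := (integral_sq_le_integral_sq π hmeas hbound).trans hsq
  refine abs_le_of_sq_le_sq' (h1.trans (le_of_eq ?_)) (by positivity) |>.2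
  rw [div_pow, Real.sq_sqrt hn0.le, inv_mul_eq_div]

/-- Concentration of the empirical mean of a bounded random element of `ℓ²`: McDiarmid's inequality
for the deviation, whose expectation is at most `B / √n`. -/
theorem measure_meanDeviation_gt_le [Countable ι] (hn : 0 < n)
    (hΨ : ∀ i, Measurable fun z => Ψ z i) (hB : ∀ z, ‖Ψ z‖ ≤ B) (hB0 : 0 < B)
    (hm : ∀ i, m i = ∫ z, Ψ z i ∂P) {γ : ℝ} (hγ : 0 < γ) (hγ1 : γ < 1) :
    (Measure.pi fun _ : Fin n => P) {z | B / √n * (1 + √(2 * Real.log γ⁻¹)) < meanDeviation Ψ m z}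
      ≤ ENNReal.ofReal γ := by
  set π := Measure.pi fun _ : Fin n => P
  have hn0 : (0 : ℝ) < n := by exact_mod_cast hn
  have hlog : 0 < Real.log γ⁻¹ := Real.log_pos ((one_lt_inv₀ hγ).2 hγ1)
  have hbound : ∀ z : Fin n → Ω, |meanDeviation Ψ m z| ≤ B + ‖m‖ := fun z => by
    rw [abs_of_nonneg (meanDeviation_nonneg z)]; exact meanDeviation_le hB0.le hB z
  have h1 := measure_ge_le_of_bounded_differences P (c := 2 * B / n) (by positivity)
    (fun z : Fin n → Ω => meanDeviation Ψ m z) (measurable_meanDeviation hΨ) hbound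
    (meanDeviation_update_le hB) (s := B / √n * √(2 * Real.log γ⁻¹)) (by positivity)
  have h2 : Real.exp (-(B / √n * √(2 * Real.log γ⁻¹)) ^ 2 / (2 * (n * (2 * B / n / 2) ^ 2))) = γ := by
    rw [mul_pow, div_pow, Real.sq_sqrt hn0.le, Real.sq_sqrt (by positivity)]
    have : -(B ^ 2 / n * (2 * Real.log γ⁻¹)) / (2 * (n * (2 * B / n / 2) ^ 2)) = Real.log γ := by
      rw [Real.log_inv]; field_simp
    rw [this, Real.exp_log hγ]
  rw [h2] at h1
  have h3 := integral_meanDeviation_le hn hΨ hB hm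
  rw [measureReal_def] at h1
  rw [← ENNReal.ofReal_toReal (measure_ne_top π _)]
  refine ENNReal.ofReal_le_ofReal (le_trans (ENNReal.toReal_mono (measure_ne_top π _)
    (measure_mono fun z hz => ?_)) h1)
  simp only [Set.mem_ofPred_eq] at hz ⊢
  rw [mul_add, mul_one] at hz
  linarith

end EmpiricalMean

/-! ### The source condition -/

section Source

variable {H : Type v} [NormedAddCommGroup H] [InnerProductSpace ℝ H] [CompleteSpace H]

/-- Sums `∑ w(μ) c_μ` over eigenvectors `c_μ` of a symmetric operator, with a bounded weight `w`. -/
theorem exists_hasSum_eigenvectors {A : H →L[ℝ] H} (hA : (A : H →ₗ[ℝ] H).IsSymmetric) {c : ℝ → H}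
    (hc : ∀ μ, A (c μ) = μ • c μ) {U : ℝ} (hU0 : 0 ≤ U)
    (hU : ∀ s : Finset ℝ, ∑ μ ∈ s, ‖c μ‖ ^ 2 ≤ U ^ 2) {w : ℝ → ℝ} {D : ℝ} (hD : 0 ≤ D)
    (hw : ∀ μ, c μ ≠ 0 → |w μ| ≤ D) :
    ∃ x : H, HasSum (fun μ => w μ • c μ) x ∧ ‖x‖ ≤ D * U := by
  have hle : ∀ μ, ‖w μ • c μ‖ ^ 2 ≤ D ^ 2 * ‖c μ‖ ^ 2 := fun μ => by
    by_cases h0 : c μ = 0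
    · simp [h0]
    rw [norm_smul, mul_pow, Real.norm_eq_abs]
    exact mul_le_mul_of_nonneg_right (pow_le_pow_left₀ (abs_nonneg _) (hw μ h0) 2) (sq_nonneg _)
  have hsumle : ∀ s : Finset ℝ, ∑ μ ∈ s, ‖w μ • c μ‖ ^ 2 ≤ (D * U) ^ 2 := fun s => by
    refine (Finset.sum_le_sum fun μ _ => hle μ).trans ?_
    rw [← Finset.mul_sum, mul_pow]
    exact mul_le_mul_of_nonneg_left (hU s) (sq_nonneg _)
  have hO := hA.orthogonalFamily_eigenspaces
  set l : ∀ μ : ℝ, Module.End.eigenspace (A : H →ₗ[ℝ] H) μ := fun μ => ⟨w μ • c μ, by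
    rw [Module.End.mem_eigenspace_iff]
    simp only [ContinuousLinearMap.coe_coe, map_smul, hc]
    rw [smul_comm]⟩
  have hsm : Summable fun μ => w μ • c μ := by
    have := (hO.summable_iff_norm_sq_summable l).2
      (summable_of_sum_le (fun μ => sq_nonneg _) hsumle)
    simpa [l] using this
  refine ⟨_, hsm.hasSum, ?_⟩
  have hfin : ∀ s : Finset ℝ, ‖∑ μ ∈ s, w μ • c μ‖ ≤ D * U := fun s => by
    have h1 := hO.norm_sum l s
    have h2 : ‖∑ μ ∈ s, w μ • c μ‖ ^ 2 = ∑ μ ∈ s, ‖w μ • c μ‖ ^ 2 := by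
      simpa [l] using h1
    exact abs_le_of_sq_le_sq' (h2.trans_le (hsumle s)) (mul_nonneg hD hU0) |>.2
  exact le_of_tendsto hsm.hasSum.norm (Filter.Eventually.of_forall hfin)

/-- The source condition `f = (T T†) ^ r u` with `r ≥ 1 / 2` in terms of `A = T† T`: `f = T h`, and
at every level `σ`, the element `h` splits into `A ^ k g`, collecting the eigenvalues above
`σ`, and a remainder. -/
theorem exists_source_decomposition {E : Type u} [NormedAddCommGroup E] [InnerProductSpace ℝ E]
    [CompleteSpace E] (T : H →L[ℝ] E) {κ : ℝ} (hκ : 0 < κ) (hT : ‖T‖ ^ 2 ≤ κ) {r : ℝ}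
    (hr : 1 / 2 ≤ r) {w f : E} (hf : IsSpectralPowerImage (T ∘L T.adjoint) r w f) :
    ∃ h : H, T h = f ∧ ‖h‖ ≤ κ ^ (r - 1 / 2) * ‖w‖ ∧
      ∀ σ : ℝ, 0 < σ → ∀ k : ℕ, r - 1 / 2 ≤ k → ∃ g : H, ‖g‖ ≤ σ ^ (r - 1 / 2 - k) * ‖w‖ ∧
        ‖h - ((T.adjoint ∘L T) ^ k) g‖ ≤ σ ^ (r - 1 / 2) * ‖w‖ ∧ (κ ≤ σ → g = 0) := by
  set K := T ∘L T.adjoint with hK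
  set A := T.adjoint ∘L T with hA
  have hKs : (K : E →ₗ[ℝ] E).IsSymmetric := fun x y => by
    simp [hK, ← ContinuousLinearMap.adjoint_inner_left]
  have hAs : (A : H →ₗ[ℝ] H).IsSymmetric := fun x y => by
    simp [hA, ContinuousLinearMap.adjoint_inner_right, ContinuousLinearMap.adjoint_inner_left]
  -- the component of `w` in the eigenspace of `K` for `μ`, and below, for `μ > 0`, its image `c μ`
  -- under the partial isometry of the polar decomposition of `T†`, which is an eigenvector of `A`
  set a : ℝ → E := fun μ => (K - μ • ContinuousLinearMap.id ℝ E).ker.starProjection w with ha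
  have hKa : ∀ μ, K (a μ) = μ • a μ := fun μ => by
    have h1 : a μ ∈ (K - μ • ContinuousLinearMap.id ℝ E).ker :=
      Submodule.starProjection_apply_mem _ _
    have h2 : (K - μ • ContinuousLinearMap.id ℝ E) (a μ) = 0 := h1
    simpa [sub_eq_zero] using h2
  have hnormT : ∀ μ, ‖T.adjoint (a μ)‖ ^ 2 = μ * ‖a μ‖ ^ 2 := fun μ => by
    rw [← real_inner_self_eq_norm_sq, ContinuousLinearMap.adjoint_inner_left,
      ← real_inner_self_eq_norm_sq, ← real_inner_smul_right, ← hKa μ]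
    rfl
  have hneg : ∀ μ, μ < 0 → a μ = 0 := fun μ hμ => by
    have h1 := hnormT μ
    have h2 : ‖a μ‖ ^ 2 ≤ 0 := by
      have := sq_nonneg ‖T.adjoint (a μ)‖
      nlinarith
    exact norm_eq_zero.1 (pow_eq_zero_iff two_ne_zero |>.1 (le_antisymm h2 (sq_nonneg _)))
  have hTa0 : ∀ μ, μ ≤ 0 → T.adjoint (a μ) = 0 := fun μ hμ => by
    have h1 := hnormT μ
    have h2 : ‖T.adjoint (a μ)‖ ^ 2 ≤ 0 := by
      rw [h1]; exact mul_nonpos_of_nonpos_of_nonneg hμ (sq_nonneg _)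
    exact norm_eq_zero.1 (pow_eq_zero_iff two_ne_zero |>.1 (le_antisymm h2 (sq_nonneg _)))
  have hbig : ∀ μ, κ < μ → a μ = 0 := fun μ hμ => by
    have h1 := hnormT μ
    have h2 : ‖T.adjoint (a μ)‖ ≤ ‖T‖ * ‖a μ‖ := by
      have := T.adjoint.le_opNorm (a μ)
      rwa [LinearIsometryEquiv.norm_map] at this
    have h3 : ‖T.adjoint (a μ)‖ ^ 2 ≤ κ * ‖a μ‖ ^ 2 := by
      refine (pow_le_pow_left₀ (norm_nonneg _) h2 2).trans ?_
      rw [mul_pow]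
      exact mul_le_mul_of_nonneg_right hT (sq_nonneg _)
    have h4 : ‖a μ‖ ^ 2 ≤ 0 := by
      have := sq_nonneg ‖a μ‖
      nlinarith
    exact norm_eq_zero.1 (pow_eq_zero_iff two_ne_zero |>.1 (le_antisymm h4 (sq_nonneg _)))
  have hasum : ∀ s : Finset ℝ, ∑ μ ∈ s, ‖a μ‖ ^ 2 ≤ ‖w‖ ^ 2 := fun s => by
    have h1 : ‖∑ μ ∈ s, a μ‖ ^ 2 = ∑ μ ∈ s, ‖a μ‖ ^ 2 := by
      have := hKs.orthogonalFamily_eigenspaces.norm_sum (fun μ => ⟨a μ, by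
        rw [Module.End.mem_eigenspace_iff]; exact hKa μ⟩) s
      simpa using this
    have h2 : inner ℝ w (∑ μ ∈ s, a μ) = ∑ μ ∈ s, ‖a μ‖ ^ 2 := by
      rw [inner_sum]
      refine Finset.sum_congr rfl fun μ _ => ?_
      rw [← real_inner_self_eq_norm_sq]
      have h3 : (K - μ • ContinuousLinearMap.id ℝ E).ker.starProjection (a μ) = a μ :=
        Submodule.starProjection_eq_self_iff.2 (Submodule.starProjection_apply_mem _ _)
      have h4 := Submodule.inner_starProjection_left_eq_right
        (K - μ • ContinuousLinearMap.id ℝ E).ker w (a μ)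
      rw [h3] at h4
      exact h4.symm
    have h3 := real_inner_le_norm w (∑ μ ∈ s, a μ)
    rw [h2, ← h1] at h3
    rw [← h1]
    have := norm_nonneg (∑ μ ∈ s, a μ)
    have := norm_nonneg w
    by_contra! hcon
    nlinarith [abs_lt_of_sq_lt_sq hcon (norm_nonneg _), le_abs_self ‖w‖]
  set c : ℝ → H := fun μ => μ ^ (-(1 / 2) : ℝ) • T.adjoint (a μ) with hc
  have hc0 : ∀ μ, c μ ≠ 0 → 0 < μ ∧ μ ≤ κ := fun μ hμ => by
    constructor
    · by_contra hcon
      exact hμ (by simp only [hc]; rw [hTa0 μ (not_lt.1 hcon), smul_zero])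
    · by_contra hcon
      exact hμ (by simp only [hc]; rw [hbig μ (not_le.1 hcon), map_zero, smul_zero])
  have hAc : ∀ μ, A (c μ) = μ • c μ := fun μ => by
    have : T.adjoint (K (a μ)) = μ • T.adjoint (a μ) := by rw [hKa, map_smul]
    simp only [hc]
    rw [map_smul, smul_comm, ← this]
    rfl
  have hcsum : ∀ s : Finset ℝ, ∑ μ ∈ s, ‖c μ‖ ^ 2 ≤ ‖w‖ ^ 2 := fun s => by
    refine (Finset.sum_le_sum fun μ _ => ?_).trans (hasum s)
    by_cases h0 : c μ = 0
    · rw [h0]; simp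
    obtain ⟨hμ, -⟩ := hc0 μ h0
    refine le_of_eq ?_
    simp only [hc]
    rw [norm_smul, mul_pow, hnormT, Real.norm_eq_abs, sq_abs, ← Real.rpow_natCast,
      ← Real.rpow_mul hμ.le, ← mul_assoc]
    norm_num
    rw [Real.rpow_neg_one, inv_mul_cancel₀ hμ.ne', one_mul]
  have hs0 : 0 ≤ r - 1 / 2 := by linarith
  obtain ⟨h, hh, hhn⟩ := exists_hasSum_eigenvectors hAs hAc (norm_nonneg w) hcsum
    (w := fun μ => μ ^ (r - 1 / 2)) (D := κ ^ (r - 1 / 2)) (by positivity) fun μ hμ => by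
      obtain ⟨h1, h2⟩ := hc0 μ hμ
      rw [abs_of_nonneg (by positivity)]
      exact Real.rpow_le_rpow h1.le h2 hs0
  have hAk : ∀ (k : ℕ) μ, (A ^ k) (c μ) = μ ^ k • c μ := fun k μ => by
    induction k with
    | zero => simp
    | succ k ih => rw [pow_succ', mul_apply_eq_comp, ih, map_smul, hAc, smul_smul, pow_succ]
  refine ⟨h, ?_, hhn, fun σ hσ k hk => ?_⟩
  · have h1 := hh.mapL T
    refine h1.unique ?_
    unfold IsSpectralPowerImage at hf
    convert hf using 2 with μ
    rw [map_smul]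
    change _ = μ ^ r • a μ
    rcases lt_trichotomy μ 0 with hμ | hμ | hμ
    · simp [hc, hneg μ hμ]
    · rw [hμ, Real.zero_rpow (by linarith : r ≠ 0)]
      simp [hc, hTa0 0 le_rfl]
    · simp only [hc]
      have : T (T.adjoint (a μ)) = μ • a μ := hKa μ
      rw [map_smul, this, smul_smul, smul_smul, ← Real.rpow_add hμ, ← Real.rpow_add_one hμ.ne']
      congr 2; ring
  · set wg : ℝ → ℝ := fun μ => if σ < μ then μ ^ (r - 1 / 2 - k) else 0 with hwg
    obtain ⟨g, hg, hgn⟩ := exists_hasSum_eigenvectors hAs hAc (norm_nonneg w) hcsum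
      (w := wg) (D := σ ^ (r - 1 / 2 - k)) (by positivity) fun μ hμ => by
        simp only [hwg]
        split_ifs with h1
        · rw [abs_of_nonneg (Real.rpow_nonneg (hσ.trans h1).le _)]
          exact Real.rpow_le_rpow_of_nonpos hσ h1.le (by linarith)
        · rw [abs_zero]; positivity
    obtain ⟨z, hz, hzn⟩ := exists_hasSum_eigenvectors hAs hAc (norm_nonneg w) hcsum
      (w := fun μ => μ ^ (r - 1 / 2) - wg μ * μ ^ k) (D := σ ^ (r - 1 / 2)) (by positivity)
      fun μ hμ => by
        obtain ⟨h1, h2⟩ := hc0 μ hμ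
        simp only [hwg]
        split_ifs with h3
        · rw [← Real.rpow_natCast, ← Real.rpow_add h1, sub_add_cancel, sub_self, abs_zero]
          positivity
        · rw [zero_mul, sub_zero, abs_of_nonneg (by positivity)]
          exact Real.rpow_le_rpow h1.le (not_lt.1 h3) hs0
    refine ⟨g, hgn, ?_, fun hκσ => ?_⟩
    · have h1 := hh.sub (hg.mapL (A ^ k))
      have h2 : z = h - (A ^ k) g := by
        refine hz.unique ?_
        convert h1 using 2 with μ
        rw [map_smul, hAk, sub_smul, mul_smul]
      rw [← h2]; exact hzn
    · refine hg.unique ?_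
      convert hasSum_zero using 2 with μ
      by_cases h0 : c μ = 0
      · rw [h0, smul_zero]
      · have := (hc0 μ h0).2
        simp only [hwg]
        rw [if_neg (by linarith), zero_smul]

end Source

/-! ### Feature maps and their covariance operators -/

section Feature

variable {H : Type v} [NormedAddCommGroup H] [InnerProductSpace ℝ H]

theorem HilbertBasis.countable_of_separable [TopologicalSpace.SeparableSpace H] {ι : Type*}
    (b : HilbertBasis ι ℝ H) : Countable ι := by
  have hdist : ∀ i j, i ≠ j → ‖b i - b j‖ ^ 2 = 2 := fun i j hij => by
    rw [norm_sub_sq_real, b.orthonormal.1 i, b.orthonormal.1 j, b.orthonormal.2 hij]; norm_num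
  have h : (Set.univ : Set ι).Countable := by
    refine Set.PairwiseDisjoint.countable_of_isOpen (s := fun i => Metric.ball (b i) (1 / 2)) ?_
      (fun _ _ => Metric.isOpen_ball) fun i _ => ⟨b i, Metric.mem_ball_self (by norm_num)⟩
    intro i _ j _ hij
    refine Set.disjoint_left.2 fun x hxi hxj => ?_
    rw [Metric.mem_ball, dist_eq_norm] at hxi hxj
    have h1 : ‖b i - b j‖ ≤ ‖x - b j‖ + ‖x - b i‖ := by
      simpa using norm_sub_le (x - b j) (x - b i)
    have h2 := hdist i j hij
    have h3 := norm_nonneg (b i - b j)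
    nlinarith
  exact Set.countable_univ_iff.1 h

theorem HilbertBasis.hasSum_inner_sq [CompleteSpace H] {ι : Type*} (b : HilbertBasis ι ℝ H) (x : H) :
    HasSum (fun i => inner ℝ (b i) x ^ 2) (‖x‖ ^ 2) := by
  have h := lp_two_hasSum_sq (b.repr x)
  rw [LinearIsometryEquiv.norm_map] at h
  simpa only [b.repr_apply_apply] using h

/-- The tensor square of an element of `ℓ²`. -/
theorem exists_lp_tensor_sq {ι : Type*} (a : lp (fun _ : ι => ℝ) 2) :
    ∃ t : lp (fun _ : ι × ι => ℝ) 2, (∀ p, t p = a p.1 * a p.2) ∧ ‖t‖ = ‖a‖ ^ 2 := by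
  have h := lp_two_hasSum_sq a
  have hs : Summable fun p : ι × ι => a p.1 ^ 2 * a p.2 ^ 2 :=
    Summable.mul_of_nonneg (f := fun i => a i ^ 2) (g := fun i => a i ^ 2) h.summable h.summable
      (fun i => sq_nonneg _) fun i => sq_nonneg _
  have h1 : HasSum (fun p : ι × ι => (a p.1 * a p.2) ^ 2) (‖a‖ ^ 2 * ‖a‖ ^ 2) := by
    simp only [mul_pow]
    exact HasSum.mul (f := fun i => a i ^ 2) (g := fun i => a i ^ 2) h h hs
  have hmem : Memℓp (fun p : ι × ι => a p.1 * a p.2) 2 := by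
    rw [memℓp_gen_iff (by norm_num)]
    simpa [mul_pow] using h1.summable
  refine ⟨⟨_, hmem⟩, fun p => rfl, ?_⟩
  have h2 := (lp_two_hasSum_sq (⟨_, hmem⟩ : lp (fun _ : ι × ι => ℝ) 2)).unique h1
  rw [← sq] at h2
  exact (pow_left_inj₀ (norm_nonneg _) (sq_nonneg _) two_ne_zero).1 h2

variable [CompleteSpace H]

/-- The operator norm is bounded by the Hilbert–Schmidt norm. -/
theorem opNorm_le_hilbertSchmidt {ι : Type*} (b : HilbertBasis ι ℝ H) {D : H →L[ℝ] H}
    (hD : (D : H →ₗ[ℝ] H).IsSymmetric) {t : lp (fun _ : ι × ι => ℝ) 2}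
    (ht : ∀ i j, t (i, j) = inner ℝ (b j) (D (b i))) : ‖D‖ ≤ ‖t‖ := by
  refine ContinuousLinearMap.opNorm_le_bound _ (norm_nonneg _) fun f => ?_
  have h1 : HasSum (fun i => ‖D (b i)‖ ^ 2) (‖t‖ ^ 2) := by
    refine (lp_two_hasSum_sq t).prod_fiberwise fun i => ?_
    simp only [ht]
    exact b.hasSum_inner_sq (D (b i))
  have h2 := b.hasSum_inner_sq (D f)
  have h3 := h1.mul_right (‖f‖ ^ 2)
  have h4 : ‖D f‖ ^ 2 ≤ ‖t‖ ^ 2 * ‖f‖ ^ 2 := by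
    refine hasSum_le (fun i => ?_) h2 h3
    have h5 : inner ℝ (b i) (D f) = inner ℝ (D (b i)) f := (hD (b i) f).symm
    rw [h5, ← mul_pow]
    exact sq_le_sq' (neg_le_of_abs_le (abs_real_inner_le_norm _ _)) (real_inner_le_norm _ _)
  rw [← mul_pow] at h4
  exact abs_le_of_sq_le_sq' h4 (by positivity) |>.2

end Feature

/-- A bounded, weakly measurable feature map `φ : 𝒳 → H`. -/
structure IsFeatureMap {𝒳 : Type u} [MeasurableSpace 𝒳] {H : Type v} [NormedAddCommGroup H]
    [InnerProductSpace ℝ H] (φ : 𝒳 → H) (κ : ℝ) : Prop where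
  measurable_inner : ∀ f : H, Measurable fun x => inner ℝ (φ x) f
  norm_sq_le : ∀ x, ‖φ x‖ ^ 2 ≤ κ

namespace IsFeatureMap

variable {𝒳 : Type u} [MeasurableSpace 𝒳] {H : Type v} [NormedAddCommGroup H]
  [InnerProductSpace ℝ H] {φ : 𝒳 → H} {κ : ℝ}

theorem norm_le (hφ : IsFeatureMap φ κ) (x : 𝒳) : ‖φ x‖ ≤ √κ :=
  Real.le_sqrt_of_sq_le (hφ.norm_sq_le x)

theorem abs_inner_le (hφ : IsFeatureMap φ κ) (x : 𝒳) (f : H) : |inner ℝ (φ x) f| ≤ √κ * ‖f‖ :=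
  (abs_real_inner_le_norm _ _).trans (mul_le_mul_of_nonneg_right (hφ.norm_le x) (norm_nonneg _))

theorem memLp_inner (hφ : IsFeatureMap φ κ) (ν : Measure 𝒳) [IsProbabilityMeasure ν] (f : H) :
    MemLp (fun x => inner ℝ (φ x) f) 2 ν :=
  MemLp.of_bound (hφ.measurable_inner f).aestronglyMeasurable (√κ * ‖f‖)
    (Filter.Eventually.of_forall fun x => hφ.abs_inner_le x f)

/-- The embedding `f ↦ ⟨φ(·), f⟩` of `H` into `L²(ν)`. -/
noncomputable def toL2 (hφ : IsFeatureMap φ κ) (ν : Measure 𝒳) [IsProbabilityMeasure ν] :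
    H →L[ℝ] Lp ℝ 2 ν :=
  LinearMap.mkContinuous
    { toFun := fun f => (hφ.memLp_inner ν f).toLp _
      map_add' := fun f g => by
        rw [← MemLp.toLp_add]
        exact MemLp.toLp_congr _ _ (Filter.Eventually.of_forall fun x => inner_add_right _ _ _)
      map_smul' := fun c f => by
        rw [RingHom.id_apply, ← MemLp.toLp_const_smul]
        exact MemLp.toLp_congr _ _
          (Filter.Eventually.of_forall fun x => real_inner_smul_right _ _ _) }
    (√κ) fun f => by
      have h1 : ∀ᵐ x ∂ν, ‖((hφ.memLp_inner ν f).toLp _ : Lp ℝ 2 ν) x‖ ≤ √κ * ‖f‖ := by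
        filter_upwards [(hφ.memLp_inner ν f).coeFn_toLp] with x hx
        rw [hx]
        exact hφ.abs_inner_le x f
      have h2 := Lp.norm_le_of_ae_bound (by positivity) h1
      simpa [measureUnivNNReal] using h2

theorem toL2_norm_sq_le (hφ : IsFeatureMap φ κ) (hκ : 0 ≤ κ) (ν : Measure 𝒳)
    [IsProbabilityMeasure ν] : ‖hφ.toL2 ν‖ ^ 2 ≤ κ := by
  have h : ‖hφ.toL2 ν‖ ≤ √κ := LinearMap.mkContinuous_norm_le _ (Real.sqrt_nonneg _) _
  exact (pow_le_pow_left₀ (norm_nonneg _) h 2).trans_eq (Real.sq_sqrt hκ)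

theorem coeFn_toL2 (hφ : IsFeatureMap φ κ) (ν : Measure 𝒳) [IsProbabilityMeasure ν] (f : H) :
    hφ.toL2 ν f =ᵐ[ν] fun x => inner ℝ (φ x) f :=
  (hφ.memLp_inner ν f).coeFn_toLp

theorem norm_toL2_sub_sq (hφ : IsFeatureMap φ κ) (ν : Measure 𝒳) [IsProbabilityMeasure ν] (f : H)
    {F : 𝒳 → ℝ} (hF : MemLp F 2 ν) :
    ‖hφ.toL2 ν f - hF.toLp F‖ ^ 2 = ∫ x, (inner ℝ (φ x) f - F x) ^ 2 ∂ν := by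
  rw [← real_inner_self_eq_norm_sq, L2.inner_def]
  refine integral_congr_ae ?_
  filter_upwards [Lp.coeFn_sub (hφ.toL2 ν f) (hF.toLp F), hφ.coeFn_toL2 ν f, hF.coeFn_toLp]
    with x h1 h2 h3
  rw [h1, Pi.sub_apply, h2, h3, real_inner_self_eq_norm_sq, Real.norm_eq_abs, sq_abs]

variable [CompleteSpace H]

theorem inner_adjoint_toL2 (hφ : IsFeatureMap φ κ) (ν : Measure 𝒳) [IsProbabilityMeasure ν]
    (g : Lp ℝ 2 ν) (f : H) :
    inner ℝ ((hφ.toL2 ν).adjoint g) f = ∫ x, g x * inner ℝ (φ x) f ∂ν := by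
  rw [ContinuousLinearMap.adjoint_inner_left, L2.inner_def]
  refine integral_congr_ae ?_
  filter_upwards [hφ.coeFn_toL2 ν f] with x h1
  rw [h1, real_inner_eq_re_inner, RCLike.inner_apply]
  simp [mul_comm]

theorem inner_adjoint_toL2_toL2 (hφ : IsFeatureMap φ κ) (ν : Measure 𝒳) [IsProbabilityMeasure ν]
    (f g : H) : inner ℝ (((hφ.toL2 ν).adjoint ∘L hφ.toL2 ν) f) g
      = ∫ x, inner ℝ (φ x) f * inner ℝ (φ x) g ∂ν := by
  rw [ContinuousLinearMap.comp_apply, inner_adjoint_toL2]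
  refine integral_congr_ae ?_
  filter_upwards [hφ.coeFn_toL2 ν f] with x h1
  rw [h1]

/-- The integral operator of the kernel `⟨φ(x), φ(y)⟩` factors through the feature space. -/
theorem toL2_comp_adjoint (hφ : IsFeatureMap φ κ) (ν : Measure 𝒳) [IsProbabilityMeasure ν]
    {k : 𝒳 → 𝒳 → ℝ} (hk : Measurable (Function.uncurry k)) {B : ℝ} (hB : ∀ x y, |k x y| ≤ B)
    (hkφ : ∀ x y, k x y = inner ℝ (φ y) (φ x)) :
    hφ.toL2 ν ∘L (hφ.toL2 ν).adjoint = kernelOp ν k hk B hB := by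
  ext1 g
  refine Lp.ext ?_
  have h1 : (kernelOp ν k hk B hB g : 𝒳 → ℝ) =ᵐ[ν] fun x => ∫ y, k x y * g y ∂ν :=
    (memLp_kernelIntegral hk hB g).coeFn_toLp
  filter_upwards [h1, hφ.coeFn_toL2 ν ((hφ.toL2 ν).adjoint g)] with x h2 h3
  rw [ContinuousLinearMap.comp_apply, h2, h3, real_inner_comm, inner_adjoint_toL2]
  exact integral_congr_ae (Filter.Eventually.of_forall fun y => by
    simp only [hkφ, mul_comm])

end IsFeatureMap

/-- A map with dense span is a feature map if its kernel `⟨φ(y), φ(x)⟩` is measurable: each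
`x ↦ ⟨φ(x), f⟩` is a limit of combinations of sections of the kernel. -/
theorem IsFeatureMap.of_dense {𝒳 : Type u} [MeasurableSpace 𝒳] {H : Type v}
    [NormedAddCommGroup H] [InnerProductSpace ℝ H] {φ : 𝒳 → H} {k : 𝒳 → 𝒳 → ℝ} {κ : ℝ}
    (hk : Measurable (Function.uncurry k)) (hkφ : ∀ x y, k x y = inner ℝ (φ y) (φ x))
    (hdense : (Submodule.span ℝ (Set.range φ)).topologicalClosure = ⊤) (hκ : ∀ x, k x x ≤ κ) :
    IsFeatureMap φ κ := by
  refine ⟨fun f => ?_, fun x => ?_⟩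
  · have hf : f ∈ (Submodule.span ℝ (Set.range φ)).topologicalClosure := by
      rw [hdense]; exact Submodule.mem_top
    obtain ⟨g, hg, hlim⟩ := mem_closure_iff_seq_limit.1 hf
    have h : ∀ n, Measurable fun x => inner ℝ (φ x) (g n) := fun n => by
      refine Submodule.span_induction (p := fun h _ => Measurable fun x : 𝒳 =>
        inner ℝ (φ x) h) ?_ ?_ ?_ ?_ (hg n)
      · rintro _ ⟨y, rfl⟩
        simp only [← hkφ]
        exact hk.comp measurable_prodMk_left
      · simp
      · intro a b _ _ ha hb
        simp only [inner_add_right]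
        exact ha.add hb
      · intro c a _ ha
        simp only [real_inner_smul_right]
        exact ha.const_mul c
    exact measurable_of_tendsto_metrizable h
      (tendsto_pi_nhds.2 fun x => tendsto_const_nhds.inner hlim)
  · rw [← real_inner_self_eq_norm_sq, ← hkφ]
    exact hκ x

/-! ### The canonical feature map of a reproducing kernel Hilbert space -/

section Canonical

variable {𝒳 : Type u} {H : Type v} [NormedAddCommGroup H]
  [InnerProductSpace ℝ H] [CompleteSpace H] [RKHS ℝ H 𝒳 ℝ]

theorem rkhsKernel_eq_inner (x y : 𝒳) : rkhsKernel H x y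
    = inner ℝ (RKHS.kerFun H y (1 : ℝ)) (RKHS.kerFun H x (1 : ℝ)) := by
  rw [← RKHS.kernel_inner]; simp [rkhsKernel]

theorem topologicalClosure_span_kerFun_one : (Submodule.span ℝ
    (Set.range fun x : 𝒳 => RKHS.kerFun H x (1 : ℝ))).topologicalClosure = ⊤ := by
  have h0 := RKHS.kerFun_dense (𝕜 := ℝ) (X := 𝒳) (V := ℝ) H
  refine top_le_iff.1 (h0.symm.le.trans (Submodule.topologicalClosure_mono (Submodule.span_le.2 ?_)))
  rintro _ ⟨x, v, rfl⟩
  have h : RKHS.kerFun H x v = v • RKHS.kerFun H x (1 : ℝ) := by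
    have h1 := (RKHS.kerFun H x).map_smul v (1 : ℝ)
    rwa [smul_eq_mul, mul_one] at h1
  rw [h]
  exact Submodule.smul_mem _ _ (Submodule.subset_span ⟨x, rfl⟩)

theorem isFeatureMap_kerFun [MeasurableSpace 𝒳]
    (hk : Measurable (Function.uncurry (rkhsKernel (𝒳 := 𝒳) H))) {κ : ℝ}
    (hκ : ∀ x : 𝒳, rkhsKernel H x x ≤ κ) :
    IsFeatureMap (fun x : 𝒳 => RKHS.kerFun H x (1 : ℝ)) κ :=
  IsFeatureMap.of_dense hk rkhsKernel_eq_inner topologicalClosure_span_kerFun_one hκ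

end Canonical

/-! ### Sampling operators and their concentration -/

section Sampling

variable {𝒳 : Type u} {H : Type v} [NormedAddCommGroup H] [InnerProductSpace ℝ H] {n : ℕ}

/-- The empirical mean `(1 / n) ∑ a_i φ(x_i)`. -/
noncomputable def sampleSum (φ : 𝒳 → H) (x : Fin n → 𝒳) (a : Fin n → ℝ) : H :=
  (n : ℝ)⁻¹ • ∑ i, a i • φ (x i)

/-- The empirical covariance operator `f ↦ (1 / n) ∑ ⟨φ(x_i), f⟩ φ(x_i)`. -/
noncomputable def sampleOp (φ : 𝒳 → H) (x : Fin n → 𝒳) : H →L[ℝ] H :=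
  (n : ℝ)⁻¹ • ∑ i, (innerSL ℝ (φ (x i))).smulRight (φ (x i))

theorem sampleOp_apply (φ : 𝒳 → H) (x : Fin n → 𝒳) (f : H) :
    sampleOp φ x f = sampleSum φ x fun i => inner ℝ (φ (x i)) f := by
  simp [sampleOp, sampleSum]

theorem inner_sampleSum (φ : 𝒳 → H) (x : Fin n → 𝒳) (a : Fin n → ℝ) (f : H) :
    inner ℝ f (sampleSum φ x a) = (n : ℝ)⁻¹ * ∑ i, a i * inner ℝ (φ (x i)) f := by
  simp [sampleSum, real_inner_smul_right, inner_sum, real_inner_comm]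

theorem inner_sampleOp (φ : 𝒳 → H) (x : Fin n → 𝒳) (f g : H) :
    inner ℝ g (sampleOp φ x f)
      = (n : ℝ)⁻¹ * ∑ i, inner ℝ (φ (x i)) f * inner ℝ (φ (x i)) g := by
  rw [sampleOp_apply, inner_sampleSum]

theorem sampleOp_isSymmetric (φ : 𝒳 → H) (x : Fin n → 𝒳) :
    (sampleOp φ x : H →ₗ[ℝ] H).IsSymmetric := fun f g => by
  simp only [ContinuousLinearMap.coe_coe]
  rw [real_inner_comm, inner_sampleOp, inner_sampleOp]
  simp only [mul_comm]

variable [MeasurableSpace 𝒳] [CompleteSpace H] {φ : 𝒳 → H} {κ : ℝ}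

theorem integral_fst_eq (P : Measure (𝒳 × ℝ)) {F : 𝒳 → ℝ} (hF : AEStronglyMeasurable F P.fst) :
    ∫ x, F x ∂P.fst = ∫ z, F z.1 ∂P :=
  integral_map measurable_fst.aemeasurable hF

/-- Concentration of the empirical covariance operator, through its Hilbert–Schmidt norm. -/
theorem measure_sampleOp_sub_gt_le [TopologicalSpace.SeparableSpace H] (hφ : IsFeatureMap φ κ)
    (hκ : 0 < κ) (P : Measure (𝒳 × ℝ)) [IsProbabilityMeasure P] (hn : 0 < n) {γ : ℝ} (hγ : 0 < γ)
    (hγ1 : γ < 1) :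
    (Measure.pi fun _ : Fin n => P) {z | κ / √n * (1 + √(2 * Real.log γ⁻¹))
      < ‖sampleOp φ (fun i => (z i).1) - (hφ.toL2 P.fst).adjoint ∘L hφ.toL2 P.fst‖}
      ≤ ENNReal.ofReal γ := by
  obtain ⟨s, b, -⟩ := exists_hilbertBasis ℝ H
  have := b.countable_of_separable
  choose Ψ hΨ hΨn using fun z : 𝒳 × ℝ => exists_lp_tensor_sq (b.repr (φ z.1))
  have hΨ' : ∀ z p, Ψ z p = inner ℝ (φ z.1) (b p.1) * inner ℝ (φ z.1) (b p.2) := fun z p => by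
    rw [hΨ, b.repr_apply_apply, b.repr_apply_apply, real_inner_comm, real_inner_comm (b p.2)]
  have hmeas : ∀ p, Measurable fun z => Ψ z p := fun p => by
    simp only [hΨ']
    exact ((hφ.measurable_inner _).comp measurable_fst).mul
      ((hφ.measurable_inner _).comp measurable_fst)
  have hB : ∀ z, ‖Ψ z‖ ≤ κ := fun z => by
    rw [hΨn, LinearIsometryEquiv.norm_map]
    exact hφ.norm_sq_le _
  obtain ⟨m, hm⟩ := exists_lp_mean P hmeas hB
  refine (measure_mono fun z hz => ?_).trans
    (measure_meanDeviation_gt_le hn hmeas hB hκ hm hγ hγ1)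
  refine lt_of_lt_of_le hz (opNorm_le_hilbertSchmidt b ?_ fun i j => ?_)
  · intro f g
    have h1 := sampleOp_isSymmetric φ (fun i => (z i).1) f g
    simp only [ContinuousLinearMap.coe_coe] at h1
    simp only [ContinuousLinearMap.coe_coe, sub_apply, inner_sub_left,
      inner_sub_right, h1]
    rw [hφ.inner_adjoint_toL2_toL2,
      real_inner_comm (((hφ.toL2 P.fst).adjoint ∘L hφ.toL2 P.fst) g), hφ.inner_adjoint_toL2_toL2]
    simp only [mul_comm]
  · rw [lp.coeFn_sub, Pi.sub_apply, lp.coeFn_smul, Pi.smul_apply, lp.coeFn_sum, Finset.sum_apply,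
      smul_eq_mul, hm, sub_apply, inner_sub_right, inner_sampleOp,
      real_inner_comm, hφ.inner_adjoint_toL2_toL2, integral_fst_eq]
    · simp only [hΨ']
    · exact ((hφ.measurable_inner _).mul (hφ.measurable_inner _)).aestronglyMeasurable

/-- Integrating against a function of the first coordinate only sees the regression function. -/
theorem integral_snd_mul_eq (P : Measure (𝒳 × ℝ)) [IsProbabilityMeasure P] {M : ℝ}
    (hY : ∀ᵐ z ∂P, |z.2| ≤ M) {fstar : 𝒳 → ℝ}
    (hreg : P[fun z => z.2 | MeasurableSpace.comap Prod.fst inferInstance]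
      =ᵐ[P] fun z => fstar z.1) {F : 𝒳 → ℝ} (hF : Measurable F) {C : ℝ} (hC : ∀ x, |F x| ≤ C) :
    ∫ z, z.2 * F z.1 ∂P = ∫ z, fstar z.1 * F z.1 ∂P := by
  have hle : MeasurableSpace.comap (Prod.fst : 𝒳 × ℝ → 𝒳) inferInstance
      ≤ Prod.instMeasurableSpace :=
    measurable_fst.comap_le
  have hi : Integrable (fun z : 𝒳 × ℝ => z.2) P :=
    Integrable.of_bound measurable_snd.aestronglyMeasurable M (by simpa using hY)
  have hi2 : Integrable ((fun z : 𝒳 × ℝ => z.2) * fun z => F z.1) P :=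
    hi.mul_bdd (c := C) (hF.comp measurable_fst).aestronglyMeasurable
      (Filter.Eventually.of_forall fun z => hC z.1)
  have h1 := condExp_mul_of_stronglyMeasurable_right (m := MeasurableSpace.comap Prod.fst
    inferInstance) (g := fun z : 𝒳 × ℝ => F z.1)
    (hF.comp (comap_measurable Prod.fst)).stronglyMeasurable hi2 hi
  have h2 := integral_condExp hle (μ := P) (f := (fun z : 𝒳 × ℝ => z.2) * fun z => F z.1)
  calc ∫ z, z.2 * F z.1 ∂P = _ := h2.symm
    _ = _ := by
      refine integral_congr_ae ?_
      filter_upwards [h1, hreg] with z hz1 hz2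
      rw [hz1, Pi.mul_apply, hz2]

/-- Concentration of the empirical mean of `Y φ(X)`. -/
theorem measure_sampleSum_sub_gt_le [TopologicalSpace.SeparableSpace H] (hφ : IsFeatureMap φ κ)
    (hκ : 0 < κ) (P : Measure (𝒳 × ℝ)) [IsProbabilityMeasure P] {M : ℝ} (hM : 0 < M)
    (hY : ∀ᵐ z ∂P, |z.2| ≤ M) {fstar : 𝒳 → ℝ} (hf : MemLp fstar 2 P.fst)
    (hreg : P[fun z => z.2 | MeasurableSpace.comap Prod.fst inferInstance]
      =ᵐ[P] fun z => fstar z.1) (hn : 0 < n) {γ : ℝ} (hγ : 0 < γ) (hγ1 : γ < 1) :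
    (Measure.pi fun _ : Fin n => P) {z | (∀ i, |(z i).2| ≤ M) ∧
      M * √κ / √n * (1 + √(2 * Real.log γ⁻¹))
      < ‖sampleSum φ (fun i => (z i).1) (fun i => (z i).2)
        - (hφ.toL2 P.fst).adjoint (hf.toLp fstar)‖}
      ≤ ENNReal.ofReal γ := by
  obtain ⟨s, b, -⟩ := exists_hilbertBasis ℝ H
  have := b.countable_of_separable
  -- Truncating `Y`, which changes nothing almost surely, makes the summands bounded.
  set c : ℝ → ℝ := fun y => max (-M) (min y M) with hc
  have hcm : Measurable c := measurable_const.max (measurable_id.min measurable_const)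
  have hcM : ∀ y, |c y| ≤ M := fun y => abs_le.2
    ⟨le_max_left _ _, max_le (by linarith) (min_le_right _ _)⟩
  have hcy : ∀ y, |y| ≤ M → c y = y := fun y hy => by
    rw [hc]; simp only
    rw [min_eq_left (abs_le.1 hy).2, max_eq_right (abs_le.1 hy).1]
  set Ψ : 𝒳 × ℝ → lp (fun _ : s => ℝ) 2 := fun z => b.repr (c z.2 • φ z.1) with hΨdef
  have hΨ : ∀ z i, Ψ z i = c z.2 * inner ℝ (φ z.1) (b i) := fun z i => by
    rw [hΨdef]; simp only
    rw [b.repr_apply_apply, real_inner_smul_right, real_inner_comm]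
  have hmeas : ∀ p, Measurable fun z => Ψ z p := fun p => by
    simp only [hΨ]
    exact (hcm.comp measurable_snd).mul ((hφ.measurable_inner _).comp measurable_fst)
  have hB : ∀ z, ‖Ψ z‖ ≤ M * √κ := fun z => by
    rw [hΨdef]; simp only
    rw [LinearIsometryEquiv.norm_map, norm_smul]
    exact mul_le_mul (hcM _) (hφ.norm_le _) (norm_nonneg _) hM.le
  have hm : ∀ i, b.repr ((hφ.toL2 P.fst).adjoint (hf.toLp fstar)) i = ∫ z, Ψ z i ∂P := fun i => by
    rw [b.repr_apply_apply, real_inner_comm, hφ.inner_adjoint_toL2]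
    have h1 : ∫ z, Ψ z i ∂P = ∫ z, z.2 * inner ℝ (φ z.1) (b i) ∂P := by
      refine integral_congr_ae ?_
      filter_upwards [hY] with z hz
      rw [hΨ, hcy _ hz]
    rw [h1, integral_snd_mul_eq P hY hreg (hφ.measurable_inner (b i)) fun x =>
      hφ.abs_inner_le x (b i), ← integral_fst_eq P (F := fun x => fstar x * inner ℝ (φ x) (b i))]
    · refine integral_congr_ae ?_
      filter_upwards [hf.coeFn_toLp] with x hx
      rw [hx]
    · exact hf.1.mul (hφ.measurable_inner _).aestronglyMeasurable
  refine (measure_mono fun z hz => ?_).trans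
    (measure_meanDeviation_gt_le hn hmeas hB (by positivity) hm hγ hγ1)
  refine lt_of_lt_of_le hz.2 (le_of_eq ?_)
  have h2 : ∀ l, Ψ (z l) = b.repr ((z l).2 • φ (z l).1) := fun l => by
    rw [hΨdef]; simp only [hcy _ (hz.1 l)]
  unfold meanDeviation sampleSum
  simp only [h2]
  rw [← map_sum, ← map_smul, ← map_sub, LinearIsometryEquiv.norm_map]

/-- The simultaneous bounds hold on the complement of a measurable hull of the exceptional sets, so
that measurability of the operator norm is not needed. -/
theorem exists_concentration_event [TopologicalSpace.SeparableSpace H] (hφ : IsFeatureMap φ κ)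
    (hκ : 0 < κ) (P : Measure (𝒳 × ℝ)) [IsProbabilityMeasure P] {M : ℝ} (hM : 0 < M)
    (hY : ∀ᵐ z ∂P, |z.2| ≤ M) {fstar : 𝒳 → ℝ} (hf : MemLp fstar 2 P.fst)
    (hreg : P[fun z => z.2 | MeasurableSpace.comap Prod.fst inferInstance]
      =ᵐ[P] fun z => fstar z.1) (hn : 0 < n) {γ : ℝ} (hγ : 0 < γ) (hγ1 : γ < 1) :
    ∃ E : Set (Fin n → 𝒳 × ℝ), MeasurableSet E ∧
      ENNReal.ofReal (1 - 2 * γ) ≤ (Measure.pi fun _ : Fin n => P) E ∧ ∀ z ∈ E,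
        (∀ i, |(z i).2| ≤ M) ∧
        ‖sampleOp φ (fun i => (z i).1) - (hφ.toL2 P.fst).adjoint ∘L hφ.toL2 P.fst‖
          ≤ κ / √n * (1 + √(2 * Real.log γ⁻¹)) ∧
        ‖sampleSum φ (fun i => (z i).1) (fun i => (z i).2)
          - (hφ.toL2 P.fst).adjoint (hf.toLp fstar)‖
          ≤ M * √κ / √n * (1 + √(2 * Real.log γ⁻¹)) := by
  have hY' : (Measure.pi fun _ : Fin n => P) {z | ¬ ∀ i, |(z i).2| ≤ M} = 0 :=
    ae_iff.1 (Filter.eventually_all.2 fun i => (Measure.tendsto_eval_ae_ae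
      (μ := fun _ : Fin n => P) (i := i)).eventually (p := fun z => |z.2| ≤ M) hY)
  have h1 := measure_sampleOp_sub_gt_le hφ hκ P hn hγ hγ1
  have h2 := measure_sampleSum_sub_gt_le hφ hκ P hM hY hf hreg hn hγ hγ1
  set b₀ := {z : Fin n → 𝒳 × ℝ | ¬ ∀ i, |(z i).2| ≤ M}
  set b₁ := {z : Fin n → 𝒳 × ℝ | κ / √n * (1 + √(2 * Real.log γ⁻¹))
      < ‖sampleOp φ (fun i => (z i).1) - (hφ.toL2 P.fst).adjoint ∘L hφ.toL2 P.fst‖} with hb₁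
  set b₂ := {z : Fin n → 𝒳 × ℝ | (∀ i, |(z i).2| ≤ M) ∧
      M * √κ / √n * (1 + √(2 * Real.log γ⁻¹))
      < ‖sampleSum φ (fun i => (z i).1) (fun i => (z i).2)
        - (hφ.toL2 P.fst).adjoint (hf.toLp fstar)‖} with hb₂
  set π := Measure.pi fun _ : Fin n => P
  have h3 : π (toMeasurable π (b₀ ∪ (b₁ ∪ b₂))) ≤ ENNReal.ofReal (2 * γ) := by
    rw [measure_toMeasurable, two_mul, ENNReal.ofReal_add hγ.le hγ.le]
    refine (measure_union_le _ _).trans ?_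
    rw [hY', zero_add]
    exact (measure_union_le _ _).trans (add_le_add h1 h2)
  refine ⟨(toMeasurable π (b₀ ∪ (b₁ ∪ b₂)))ᶜ, (measurableSet_toMeasurable _ _).compl, ?_, ?_⟩
  · rw [prob_compl_eq_one_sub (measurableSet_toMeasurable _ _), ENNReal.ofReal_sub _ (by positivity),
      ENNReal.ofReal_one]
    exact tsub_le_tsub_left h3 1
  · intro z hz
    have h4 : z ∉ b₀ ∪ (b₁ ∪ b₂) := fun h => hz (subset_toMeasurable _ _ h)
    simp only [Set.mem_union, not_or] at h4
    obtain ⟨h5, h6, h7⟩ := h4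
    have h8 : ∀ i, |(z i).2| ≤ M := not_not.1 h5
    exact ⟨h8, not_lt.1 h6, not_lt.1 fun h => h7 ⟨h8, h⟩⟩

end Sampling

/-! ### Conjugate gradients for a positive operator -/

section Operator

variable {H : Type v} [NormedAddCommGroup H] [InnerProductSpace ℝ H]

/-- `q(A) b` minimizes the residual `‖b - A s(A) b‖` over polynomials `s` of degree `< m`. -/
def IsKrylovMinimizer (A : H →L[ℝ] H) (b : H) (m : ℕ) (q : ℝ[X]) : Prop :=
  q.degree < m ∧ ∀ s : ℝ[X], s.degree < m →
    ‖b - A (aeval A q b)‖ ≤ ‖b - A (aeval A s b)‖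

theorem aeval_apply_mem {A : H →L[ℝ] H} {W : Submodule ℝ H} (hW : ∀ f ∈ W, A f ∈ W) {b : H}
    (hb : b ∈ W) (s : ℝ[X]) : aeval A s b ∈ W := by
  induction s using Polynomial.induction_on' with
  | add p q hp hq => rw [map_add]; exact W.add_mem hp hq
  | monomial i a =>
    rw [aeval_monomial, Algebra.algebraMap_eq_smul_one]
    have h : ∀ i : ℕ, (A ^ i) b ∈ W := fun i => by
      induction i with
      | zero => simpa using hb
      | succ i ih => rw [pow_succ']; exact hW _ ih
    simpa using W.smul_mem a (h i)

/-- Simultaneous coordinates in an orthonormal eigenbasis of a finite dimensional invariant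
subspace. -/
theorem exists_eigen_coordinates {A : H →L[ℝ] H} (hA : (A : H →ₗ[ℝ] H).IsSymmetric)
    (hpos : ∀ f, 0 ≤ inner ℝ (A f) f) (W : Submodule ℝ H) [FiniteDimensional ℝ W]
    (hW : ∀ f ∈ W, A f ∈ W) {b : H} (hb : ∀ f, A f = 0 → inner ℝ f b = 0) :
    ∃ (d : ℕ) (lam : Fin d → ℝ) (c : Fin d → H →ₗ[ℝ] ℝ), (∀ j, 0 ≤ lam j) ∧
      (∀ j, lam j = 0 → c j b = 0) ∧ (∀ j f, c j (A f) = lam j * c j f) ∧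
      ∀ f ∈ W, ∀ g ∈ W, inner ℝ f g = ∑ j, c j f * c j g := by
  set B : W →ₗ[ℝ] W := (A : H →ₗ[ℝ] H).restrict hW with hB
  have hBs : B.IsSymmetric := hA.restrict_invariant hW
  set e := hBs.eigenvectorBasis rfl with he
  set lam := hBs.eigenvalues rfl with hlam
  have hAe : ∀ j, A (e j) = lam j • (e j : H) := fun j => by
    have h1 := hBs.apply_eigenvectorBasis rfl j
    exact congrArg Subtype.val h1
  refine ⟨_, lam, fun j => (innerSL ℝ (e j : H) : H →L[ℝ] ℝ).toLinearMap, fun j => ?_, fun j h0 => ?_,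
    fun j f => ?_, fun f hf g hg => ?_⟩
  · have h1 := hpos (e j)
    rw [hAe, real_inner_smul_left, real_inner_self_eq_norm_sq] at h1
    have h2 : ‖(e j : H)‖ = 1 := e.orthonormal.1 j
    simpa [h2] using h1
  · have h1 : A (e j) = 0 := by rw [hAe, h0, zero_smul]
    simpa using hb _ h1
  · have h1 := hA (e j) f
    simp only [ContinuousLinearMap.coe_coe] at h1 ⊢
    rw [innerSL_apply_apply, innerSL_apply_apply, ← h1, hAe, real_inner_smul_left]
  · have h1 := e.sum_inner_mul_inner ⟨f, hf⟩ ⟨g, hg⟩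
    rw [show inner ℝ f g = inner ℝ (⟨f, hf⟩ : W) ⟨g, hg⟩ from rfl, ← h1]
    refine Finset.sum_congr rfl fun j _ => ?_
    rw [real_inner_comm]
    rfl

theorem map_aeval_of_eigen {A : H →L[ℝ] H} {c : H →ₗ[ℝ] ℝ} {l : ℝ}
    (hc : ∀ f, c (A f) = l * c f) (s : ℝ[X]) (f : H) : c (aeval A s f) = s.eval l * c f := by
  have hpow : ∀ i : ℕ, c ((A ^ i) f) = l ^ i * c f := fun i => by
    induction i with
    | zero => simp
    | succ i ih => rw [pow_succ', pow_succ', mul_assoc, ← ih, ← hc]; rfl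
  induction s using Polynomial.induction_on' with
  | add p q hp hq =>
    rw [eval_add, add_mul, ← hp, ← hq, ← map_add c, map_add]; rfl
  | monomial i a =>
    rw [aeval_monomial, Algebra.algebraMap_eq_smul_one, smul_mul_assoc, one_mul, eval_monomial,
      mul_assoc, ← hpow, ← smul_eq_mul a, ← map_smul]
    rfl

theorem norm_eq_l2_of_inner {d : ℕ} {c : Fin d → H →ₗ[ℝ] ℝ} {f : H}
    (h : inner ℝ f f = ∑ j, c j f * c j f) : ‖f‖ = l2 fun j => c j f := by
  rw [← Real.sqrt_sq (norm_nonneg f), ← real_inner_self_eq_norm_sq, h, l2]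
  simp only [sq]

/-- In eigencoordinates Krylov minimizers are minimal residual polynomials. -/
theorem IsKrylovMinimizer.isMinResidual {A : H →L[ℝ] H} {b : H} {m : ℕ} {q : ℝ[X]}
    (hq : IsKrylovMinimizer A b m q) {d : ℕ} {lam : Fin d → ℝ} {c : Fin d → H →ₗ[ℝ] ℝ}
    (hres : ∀ s : ℝ[X], ‖b - A (aeval A s b)‖
      = l2 fun j => (1 - lam j * s.eval (lam j)) * c j b) :
    IsMinResidual lam (fun j => c j b) m q := by
  refine ⟨hq.1, fun s hs => l2_le_l2_iff.1 ?_⟩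
  rw [← hres, ← hres]
  exact hq.2 s hs

theorem degree_C_mul_comp_lt {q : ℝ[X]} {m : ℕ} (hq : q.degree < m) (a b : ℝ) :
    (C a * q.comp (C b * X)).degree < m := by
  rw [degree_lt_iff_coeff_zero] at hq ⊢
  intro i hi
  rw [coeff_C_mul, comp_C_mul_X_coeff, hq i hi, zero_mul, mul_zero]

/-- Minimal residual polynomials after dividing the operator and the right hand side by `σ`. -/
theorem IsMinResidual.rescale {ι : Type*} [Fintype ι] {lam β : ι → ℝ} {m : ℕ} {q : ℝ[X]}
    (hq : IsMinResidual lam β m q) {σ : ℝ} (hσ : 0 < σ) :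
    IsMinResidual (fun j => σ⁻¹ * lam j) (fun j => σ⁻¹ * β j) m
      (C σ * q.comp (C σ * X)) := by
  have hσ' := hσ.ne'
  refine ⟨degree_C_mul_comp_lt hq.1 σ σ, fun s hs => ?_⟩
  have h := hq.2 _ (degree_C_mul_comp_lt hs σ⁻¹ σ⁻¹)
  simp only [eval_mul, eval_C, eval_comp, eval_X] at h ⊢
  have h1 : ∀ j, ((1 - σ⁻¹ * lam j * (σ * q.eval (σ * (σ⁻¹ * lam j)))) * (σ⁻¹ * β j)) ^ 2
      = σ⁻¹ ^ 2 * ((1 - lam j * q.eval (lam j)) * β j) ^ 2 := fun j => by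
    rw [mul_inv_cancel_left₀ hσ']
    field_simp
  have h2 : ∀ j, ((1 - σ⁻¹ * lam j * s.eval (σ⁻¹ * lam j)) * (σ⁻¹ * β j)) ^ 2
      = σ⁻¹ ^ 2 * ((1 - lam j * (σ⁻¹ * s.eval (σ⁻¹ * lam j))) * β j) ^ 2 := fun j => by
    ring
  simp only [h1, h2, ← Finset.mul_sum]
  exact mul_le_mul_of_nonneg_left h (sq_nonneg _)

theorem norm_residual_eq_l2 {A : H →L[ℝ] H} {W : Submodule ℝ H} (hW : ∀ f ∈ W, A f ∈ W) {b : H}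
    (hbW : b ∈ W) {d : ℕ} {lam : Fin d → ℝ} {c : Fin d → H →ₗ[ℝ] ℝ}
    (hcA : ∀ j f, c j (A f) = lam j * c j f)
    (hin : ∀ f ∈ W, ∀ g ∈ W, inner ℝ f g = ∑ j, c j f * c j g) (s : ℝ[X]) :
    ‖b - A (aeval A s b)‖ = l2 fun j => (1 - lam j * s.eval (lam j)) * c j b := by
  have h := W.sub_mem hbW (hW _ (aeval_apply_mem hW hbW s))
  rw [norm_eq_l2_of_inner (hin _ h _ h)]
  congr 1
  funext j
  rw [map_sub, hcA, map_aeval_of_eigen (hcA j)]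
  ring

/-- The discrepancy condition holds eventually, since the residual vanishes after finitely many
steps. -/
theorem exists_discrepancy {A : H →L[ℝ] H} (hA : (A : H →ₗ[ℝ] H).IsSymmetric)
    (hpos : ∀ f, 0 ≤ inner ℝ (A f) f) (W : Submodule ℝ H) [FiniteDimensional ℝ W]
    (hW : ∀ f ∈ W, A f ∈ W) {b : H} (hb : ∀ f, A f = 0 → inner ℝ f b = 0) (hbW : b ∈ W)
    {q : ℕ → ℝ[X]} (hq : ∀ m, IsKrylovMinimizer A b m (q m)) {τ δ ε : ℝ} (hτ : 0 < τ)
    (hδ : 0 ≤ δ) (hε : 0 < ε) :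
    ∃ m, ‖b - A (aeval A (q m) b)‖ < τ * (δ * ‖aeval A (q m) b‖ + ε) := by
  obtain ⟨d, lam, c, -, hc0, hcA, hin⟩ := exists_eigen_coordinates hA hpos W hW hb
  have hres := norm_residual_eq_l2 hW hbW hcA hin
  refine ⟨activeNodes lam fun j => c j b, ?_⟩
  rw [hres, ((hq _).isMinResidual hres).residual_eq_zero hc0]
  positivity

/-- The bound of `error_le_modified_discrepancy` for a positive operator `A`, obtained by applying
it to `A / σ` in an orthonormal eigenbasis. -/
theorem operator_error_le {A : H →L[ℝ] H} (hA : (A : H →ₗ[ℝ] H).IsSymmetric)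
    (hpos : ∀ f, 0 ≤ inner ℝ (A f) f) (W : Submodule ℝ H) [FiniteDimensional ℝ W]
    (hW : ∀ f ∈ W, A f ∈ W) {b : H} (hb : ∀ f, A f = 0 → inner ℝ f b = 0) (hbW : b ∈ W)
    {q : ℕ → ℝ[X]} (hq : ∀ m, IsKrylovMinimizer A b m (q m)) {τ δ ε σ Z : ℝ} (hτ : 1 < τ)
    (hδ : 0 < δ) (hε : 0 < ε) (hσ : 0 < σ) (hδτ : δ * (8 * τ) ≤ σ) {h g : H} (hhW : h ∈ W)
    (hgW : g ∈ W) {k : ℕ} (he : ‖b - A h‖ ≤ ε + δ * ‖h‖) (hN : ε + δ * ‖h‖ ≤ σ * Z)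
    (hg : σ ^ k * ‖g‖ ≤ Z) (hz : ‖h - (A ^ k) g‖ ≤ Z) {m₀ m₁ : ℕ}
    (hm₀ : ‖b - A (aeval A (q m₀) b)‖ < τ * (δ * ‖aeval A (q m₀) b‖ + ε))
    (hmin : ∀ m < m₀, ¬ ‖b - A (aeval A (q m) b)‖ < τ * (δ * ‖aeval A (q m) b‖ + ε))
    (hm₁ : ((2 * τ)⁻¹ * δ⁻¹ ≤ (q m₀).eval 0 ∧ m₁ = m₀ - 1) ∨
      ((q m₀).eval 0 < (2 * τ)⁻¹ * δ⁻¹ ∧ m₁ = m₀)) :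
    inner ℝ (A (aeval A (q m₁) b - h)) (aeval A (q m₁) b - h)
      + δ * ‖aeval A (q m₁) b - h‖ ^ 2 ≤ errorConst τ k * σ * Z ^ 2 := by
  obtain ⟨d, lam, c, hlam, hc0, hcA, hin⟩ := exists_eigen_coordinates hA hpos W hW hb
  have hσ' := hσ.ne'
  have hres := norm_residual_eq_l2 hW hbW hcA hin
  have hnorm : ∀ f ∈ W, ‖f‖ = l2 fun j => c j f := fun f hf => norm_eq_l2_of_inner (hin f hf f hf)
  have hqW : ∀ s : ℝ[X], aeval A s b ∈ W := aeval_apply_mem hW hbW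
  have hpow : ∀ (f : H) j, c j ((A ^ k) f) = lam j ^ k * c j f := fun f j => by
    have h1 := map_aeval_of_eigen (hcA j) (X ^ k) f
    simpa using h1
  have hAkW : (A ^ k) g ∈ W := by
    have h1 := aeval_apply_mem hW hgW (X ^ k)
    simpa using h1
  have hq0 : ∀ m, (C σ * (q m).comp (C σ * X)).eval 0 = σ * (q m).eval 0 := fun m => by simp
  have hqe : ∀ m j, (C σ * (q m).comp (C σ * X)).eval (σ⁻¹ * lam j) * (σ⁻¹ * c j b)
      = c j (aeval A (q m) b) := fun m j => by
    rw [map_aeval_of_eigen (hcA j)]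
    simp only [eval_mul, eval_C, eval_comp, eval_X]
    rw [mul_inv_cancel_left₀ hσ']
    field_simp
  have hqn : ∀ m, l2 (fun j => (C σ * (q m).comp (C σ * X)).eval (σ⁻¹ * lam j) * (σ⁻¹ * c j b))
      = ‖aeval A (q m) b‖ := fun m => by
    rw [hnorm _ (hqW _)]
    simp only [hqe]
  have hqr : ∀ m, l2 (fun j => (1 - σ⁻¹ * lam j
      * (C σ * (q m).comp (C σ * X)).eval (σ⁻¹ * lam j)) * (σ⁻¹ * c j b))
      = σ⁻¹ * ‖b - A (aeval A (q m) b)‖ := fun m => by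
    rw [hres, ← l2_const_mul (inv_nonneg.2 hσ.le)]
    congr 1
    funext j
    simp only [eval_mul, eval_C, eval_comp, eval_X]
    rw [mul_inv_cancel_left₀ hσ']
    field_simp
  have hdisc : ∀ m, Discrepancy (fun j => σ⁻¹ * lam j) (fun j => σ⁻¹ * c j b) τ (σ⁻¹ * δ) (σ⁻¹ * ε)
      (C σ * (q m).comp (C σ * X))
      ↔ ‖b - A (aeval A (q m) b)‖ < τ * (δ * ‖aeval A (q m) b‖ + ε) := fun m => by
    rw [Discrepancy, hqn, hqr]
    have h1 : τ * (σ⁻¹ * δ * ‖aeval A (q m) b‖ + σ⁻¹ * ε)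
        = σ⁻¹ * (τ * (δ * ‖aeval A (q m) b‖ + ε)) := by ring
    rw [h1, mul_lt_mul_iff_right₀ (inv_pos.2 hσ)]
  have hhn := hnorm h hhW
  have hNs : σ⁻¹ * ε + σ⁻¹ * δ * l2 (fun j => c j h) = σ⁻¹ * (ε + δ * ‖h‖) := by rw [hhn]; ring
  have key := error_le_modified_discrepancy (lam := fun j => σ⁻¹ * lam j)
    (β := fun j => σ⁻¹ * c j b) (δ := σ⁻¹ * δ) (ε := σ⁻¹ * ε) (h := fun j => c j h)
    (g := fun j => σ ^ k * c j g) (k := k) (Z := Z) (τ := τ) (m₀ := m₀) (m₁ := m₁)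
    (q := fun m => C σ * (q m).comp (C σ * X))
    (fun m => ((hq m).isMinResidual hres).rescale hσ)
    (fun j => mul_nonneg (inv_nonneg.2 hσ.le) (hlam j))
    (fun j hj => by
      rcases mul_eq_zero.1 hj with h0 | h0
      · exact absurd h0 (inv_ne_zero hσ')
      · rw [hc0 j h0, mul_zero])
    hτ (by positivity)
    (by rw [mul_assoc, inv_mul_le_iff₀ hσ, mul_one]; exact hδτ) (by positivity)
    (by
      rw [hNs]
      refine le_trans (le_of_eq ?_) (mul_le_mul_of_nonneg_left he (inv_nonneg.2 hσ.le))
      rw [hnorm _ (W.sub_mem hbW (hW _ hhW)), ← l2_const_mul (inv_nonneg.2 hσ.le)]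
      congr 1
      funext j
      rw [map_sub, hcA]
      ring)
    (by rw [hNs, inv_mul_le_iff₀ hσ]; exact hN)
    (by
      rw [l2_const_mul (by positivity), ← hnorm g hgW]
      exact hg)
    (by
      refine le_trans (le_of_eq ?_) hz
      rw [hnorm _ (W.sub_mem hhW hAkW)]
      congr 1
      funext j
      rw [map_sub, hpow, mul_pow, inv_pow]
      field_simp)
    ((hdisc m₀).2 hm₀) (fun m hm hd => hmin m hm ((hdisc m).1 hd))
    (by
      have h1 : (2 * τ)⁻¹ * (σ⁻¹ * δ)⁻¹ = σ * ((2 * τ)⁻¹ * δ⁻¹) := by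
        rw [mul_inv σ⁻¹, inv_inv]; ring
      rw [hq0, h1, mul_le_mul_iff_right₀ hσ, mul_lt_mul_iff_right₀ hσ]
      exact hm₁)
  have hvW : aeval A (q m₁) b - h ∈ W := W.sub_mem (hqW _) hhW
  rw [hin _ (hW _ hvW) _ hvW, ← real_inner_self_eq_norm_sq, hin _ hvW _ hvW]
  simp only [hqe] at key
  have h2 : ∑ j, c j (A (aeval A (q m₁) b - h)) * c j (aeval A (q m₁) b - h)
      + δ * ∑ j, c j (aeval A (q m₁) b - h) * c j (aeval A (q m₁) b - h)
      = σ * (∑ j, σ⁻¹ * lam j * (c j (aeval A (q m₁) b) - c j h) ^ 2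
        + σ⁻¹ * δ * ∑ j, (c j (aeval A (q m₁) b) - c j h) ^ 2) := by
    simp only [mul_add, Finset.mul_sum]
    congr 1
    · refine Finset.sum_congr rfl fun j _ => ?_
      rw [hcA, map_sub]
      field_simp
    · refine Finset.sum_congr rfl fun j _ => ?_
      rw [map_sub]
      field_simp
  rw [h2, mul_comm (errorConst τ k) σ, mul_assoc σ]
  exact mul_le_mul_of_nonneg_left key hσ.le

end Operator

/-! ### The kernel matrix and the sampling operators -/

section KernelCG

variable {𝒳 : Type u} {H : Type v} [NormedAddCommGroup H] [InnerProductSpace ℝ H] {n : ℕ}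
  {φ : 𝒳 → H} {k : 𝒳 → 𝒳 → ℝ}

theorem sampleSum_add (φ : 𝒳 → H) (x : Fin n → 𝒳) (a b : Fin n → ℝ) :
    sampleSum φ x (a + b) = sampleSum φ x a + sampleSum φ x b := by
  simp [sampleSum, add_smul, Finset.sum_add_distrib]

theorem sampleSum_smul (φ : 𝒳 → H) (x : Fin n → 𝒳) (c : ℝ) (a : Fin n → ℝ) :
    sampleSum φ x (c • a) = c • sampleSum φ x a := by
  simp only [sampleSum, Pi.smul_apply, smul_eq_mul, mul_smul, ← Finset.smul_sum]
  rw [smul_comm]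

/-- `sampleSum` as a linear map in the coefficients. -/
noncomputable def sampleSumLin (φ : 𝒳 → H) (x : Fin n → 𝒳) : (Fin n → ℝ) →ₗ[ℝ] H where
  toFun := sampleSum φ x
  map_add' := sampleSum_add φ x
  map_smul' := sampleSum_smul φ x

theorem sampleSum_sub (φ : 𝒳 → H) (x : Fin n → 𝒳) (a b : Fin n → ℝ) :
    sampleSum φ x (a - b) = sampleSum φ x a - sampleSum φ x b :=
  map_sub (sampleSumLin φ x) a b

theorem kernelExpansion_eq_inner (hkφ : ∀ s t, k s t = inner ℝ (φ t) (φ s)) (x : Fin n → 𝒳)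
    (a : Fin n → ℝ) (t : 𝒳) : kernelExpansion k x a t = inner ℝ (φ t) (sampleSum φ x a) := by
  rw [inner_sampleSum]
  simp only [kernelExpansion, hkφ, real_inner_comm]

theorem kernelMatrix_mulVec_apply (hkφ : ∀ s t, k s t = inner ℝ (φ t) (φ s)) (x : Fin n → 𝒳)
    (a : Fin n → ℝ) (i : Fin n) :
    (kernelMatrix k x *ᵥ a) i = inner ℝ (φ (x i)) (sampleSum φ x a) := by
  rw [inner_sampleSum]
  simp only [kernelMatrix, Matrix.mulVec, dotProduct, Matrix.of_apply, hkφ, Finset.mul_sum]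
  exact Finset.sum_congr rfl fun j _ => by ring

/-- The kernel matrix on coefficient vectors corresponds to the empirical covariance operator. -/
theorem sampleSum_kernelMatrix (hkφ : ∀ s t, k s t = inner ℝ (φ t) (φ s)) (x : Fin n → 𝒳)
    (a : Fin n → ℝ) :
    sampleSum φ x (kernelMatrix k x *ᵥ a) = sampleOp φ x (sampleSum φ x a) := by
  rw [sampleOp_apply]
  congr 1
  funext i
  exact kernelMatrix_mulVec_apply hkφ x a i

theorem normK_kernelMatrix (hkφ : ∀ s t, k s t = inner ℝ (φ t) (φ s)) (x : Fin n → 𝒳)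
    (a : Fin n → ℝ) : normK (kernelMatrix k x) a = ‖sampleSum φ x a‖ := by
  rw [normK, ← Real.sqrt_sq (norm_nonneg (sampleSum φ x a)), ← real_inner_self_eq_norm_sq,
    inner_sampleSum]
  simp only [dotProduct, kernelMatrix_mulVec_apply hkφ]

theorem sampleSum_aeval_kernelMatrix (hkφ : ∀ s t, k s t = inner ℝ (φ t) (φ s)) (x : Fin n → 𝒳)
    (a : Fin n → ℝ) (q : ℝ[X]) :
    sampleSum φ x (aeval (kernelMatrix k x) q *ᵥ a) = aeval (sampleOp φ x) q (sampleSum φ x a) := by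
  induction q using Polynomial.induction_on' with
  | add p q hp hq => rw [map_add, map_add, Matrix.add_mulVec, sampleSum_add, hp, hq]; rfl
  | monomial i c =>
    have h : ∀ i : ℕ, sampleSum φ x ((kernelMatrix k x) ^ i *ᵥ a)
        = (sampleOp φ x ^ i) (sampleSum φ x a) := fun i => by
      induction i with
      | zero => simp
      | succ i ih =>
        rw [pow_succ', pow_succ', ← Matrix.mulVec_mulVec, sampleSum_kernelMatrix hkφ, ih]; rfl
    rw [aeval_monomial, aeval_monomial, Algebra.algebraMap_eq_smul_one,
      Algebra.algebraMap_eq_smul_one, smul_mul_assoc, one_mul, smul_mul_assoc, one_mul,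
      Matrix.smul_mulVec, sampleSum_smul, h]
    rfl

theorem mem_krylov_iff (K : Matrix (Fin n) (Fin n) ℝ) (Y : Fin n → ℝ) (m : ℕ) (w : Fin n → ℝ) :
    w ∈ krylov K Y m ↔ ∃ q : ℝ[X], q.degree < m ∧ w = aeval K q *ᵥ Y := by
  constructor
  · intro hw
    refine Submodule.span_induction (p := fun w _ => ∃ q : ℝ[X], q.degree < m ∧ w = aeval K q *ᵥ Y)
      ?_ ⟨0, by simp, by simp⟩ ?_ ?_ hw
    · rintro _ ⟨j, hj, rfl⟩
      exact ⟨X ^ j, by rw [degree_X_pow]; exact_mod_cast hj, by simp⟩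
    · rintro _ _ _ _ ⟨p, hp, rfl⟩ ⟨q, hq, rfl⟩
      exact ⟨p + q, (degree_add_le _ _).trans_lt (max_lt hp hq), by
        rw [map_add, Matrix.add_mulVec]⟩
    · rintro c _ _ ⟨p, hp, rfl⟩
      exact ⟨c • p, (degree_smul_le _ _).trans_lt hp, by rw [map_smul, Matrix.smul_mulVec]⟩
  · rintro ⟨q, hq, rfl⟩
    rw [aeval_def, eval₂_eq_sum, Polynomial.sum, Matrix.sum_mulVec]
    refine Submodule.sum_mem _ fun i hi => ?_
    have him : i < m := by
      have h1 := (le_degree_of_mem_supp i hi).trans_lt hq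
      exact_mod_cast h1
    rw [Algebra.algebraMap_eq_smul_one, smul_mul_assoc, one_mul, Matrix.smul_mulVec]
    exact Submodule.smul_mem _ _ (Submodule.subset_span ⟨i, him, rfl⟩)

/-- The kernel conjugate gradient method is the minimal residual method for the empirical covariance
operator in feature space. -/
theorem IsCGSequence.isKrylovMinimizer (hkφ : ∀ s t, k s t = inner ℝ (φ t) (φ s))
    {x : Fin n → 𝒳} {Y : Fin n → ℝ} {α : ℕ → Fin n → ℝ} {q : ℕ → ℝ[X]}
    (h : IsCGSequence (kernelMatrix k x) Y α q) (m : ℕ) :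
    IsKrylovMinimizer (sampleOp φ x) (sampleSum φ x Y) m (q m) := by
  refine ⟨h.degree_lt m, fun s hs => ?_⟩
  have h1 := h.argmin m _ ((mem_krylov_iff _ _ _ _).2 ⟨s, hs, rfl⟩)
  rw [h.eq_aeval m] at h1
  simpa only [normK_kernelMatrix hkφ, sampleSum_sub, sampleSum_kernelMatrix hkφ,
    sampleSum_aeval_kernelMatrix hkφ] using h1

/-- The minimizers exist although the semi-norm `‖·‖_{K_n}` may be degenerate: they come from an
orthogonal projection in feature space. -/
theorem exists_isCGSequence (hkφ : ∀ s t, k s t = inner ℝ (φ t) (φ s)) (x : Fin n → 𝒳)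
    (Y : Fin n → ℝ) : ∃ α q, IsCGSequence (kernelMatrix k x) Y α q := by
  have h : ∀ m : ℕ, ∃ q : ℝ[X], q.degree < (m : ℕ) ∧ ∀ β ∈ krylov (kernelMatrix k x) Y m,
      normK (kernelMatrix k x) (Y - kernelMatrix k x *ᵥ (aeval (kernelMatrix k x) q *ᵥ Y))
        ≤ normK (kernelMatrix k x) (Y - kernelMatrix k x *ᵥ β) := fun m => by
    set L : (Fin n → ℝ) →ₗ[ℝ] H := sampleSumLin φ x ∘ₗ (kernelMatrix k x).mulVecLin with hL
    set S := (krylov (kernelMatrix k x) Y m).map L with hS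
    obtain ⟨w, hw, hwp⟩ := Submodule.mem_map.1 (S.starProjection_apply_mem (sampleSum φ x Y))
    obtain ⟨q, hq, rfl⟩ := (mem_krylov_iff _ _ _ _).1 hw
    refine ⟨q, hq, fun β hβ => ?_⟩
    have hL' : ∀ w, sampleSum φ x (Y - kernelMatrix k x *ᵥ w) = sampleSum φ x Y - L w :=
      fun w => sampleSum_sub φ x _ _
    rw [normK_kernelMatrix hkφ, normK_kernelMatrix hkφ, hL', hL', hwp,
      S.starProjection_minimal]
    exact ciInf_le ⟨0, by rintro _ ⟨y, rfl⟩; exact norm_nonneg _⟩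
      (⟨L β, Submodule.mem_map_of_mem hβ⟩ : S)
  choose q hq hmin using h
  exact ⟨fun m => aeval (kernelMatrix k x) (q m) *ᵥ Y, q,
    fun m => (mem_krylov_iff _ _ _ _).2 ⟨q m, hq m, rfl⟩, hmin, hq, fun m => rfl⟩

/-- The noise level `ε = 4 M √κ log (2 / γ) / √n` of the data. -/
noncomputable def dataNoiseLevel (n : ℕ) (κ M γ : ℝ) : ℝ :=
  4 * M * √κ * Real.log (2 / γ) / √n

/-- The discrepancy condition in feature space. -/
theorem discrepancyHolds_iff (hkφ : ∀ s t, k s t = inner ℝ (φ t) (φ s)) {κ : ℝ} (hκ : 0 ≤ κ)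
    {γ : ℝ} (hγ : 0 ≤ Real.log (2 / γ)) (τ M : ℝ) (x : Fin n → 𝒳) (Y a : Fin n → ℝ) :
    DiscrepancyHolds τ κ M γ k x Y a ↔
      ‖sampleSum φ x Y - sampleOp φ x (sampleSum φ x a)‖
        < τ * (noiseLevel n κ γ * ‖sampleSum φ x a‖ + dataNoiseLevel n κ M γ) := by
  have h1 : (fun i => kernelExpansion k x a (x i)) = kernelMatrix k x *ᵥ a := by
    funext i
    rw [kernelExpansion_eq_inner hkφ, kernelMatrix_mulVec_apply hkφ]
  have h2 : threshold τ κ M γ (kernelMatrix k x) a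
      = τ * (noiseLevel n κ γ * ‖sampleSum φ x a‖ + dataNoiseLevel n κ M γ) := by
    rw [threshold, noiseLevel, dataNoiseLevel, normK_kernelMatrix hkφ, mul_div_assoc,
      Real.sqrt_mul hκ, Real.sqrt_div hγ]
    have h3 := Real.mul_self_sqrt hκ
    have h4 := Real.mul_self_sqrt hγ
    calc _ = τ * (4 * (√κ * √κ) * (√(Real.log (2 / γ)) / √n) * ‖sampleSum φ x a‖
          + 4 * M * √κ * (√(Real.log (2 / γ)) * √(Real.log (2 / γ))) / √n) := by ring
      _ = _ := by rw [h3, h4]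
  rw [DiscrepancyHolds, h1, h2, normK_kernelMatrix hkφ, sampleSum_sub,
    sampleSum_kernelMatrix hkφ, norm_sub_rev]

end KernelCG

/-! ### Error bounds under the source condition -/

section SourceError

variable {H : Type v} [NormedAddCommGroup H] [InnerProductSpace ℝ H]

theorem norm_pow_sub_pow_le {A B : H →L[ℝ] H} {κ δ : ℝ} (hA : ‖A‖ ≤ κ) (hB : ‖B‖ ≤ κ)
    (hAB : ‖A - B‖ ≤ δ) (j : ℕ) : ‖A ^ (j + 1) - B ^ (j + 1)‖ ≤ (j + 1) * κ ^ j * δ := by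
  have hκ : 0 ≤ κ := (norm_nonneg _).trans hA
  have hδ : 0 ≤ δ := (norm_nonneg _).trans hAB
  induction j with
  | zero => simpa using hAB
  | succ j ih =>
    have h1 : A ^ (j + 1 + 1) - B ^ (j + 1 + 1)
        = A * (A ^ (j + 1) - B ^ (j + 1)) + (A - B) * B ^ (j + 1) := by
      rw [pow_succ' A, pow_succ' B (j + 1)]; noncomm_ring
    have h2 : ‖B ^ (j + 1)‖ ≤ κ ^ (j + 1) :=
      (norm_pow_le' B (Nat.succ_pos j)).trans (pow_le_pow_left₀ (norm_nonneg _) hB _)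
    rw [h1]
    calc _ ≤ ‖A‖ * ‖A ^ (j + 1) - B ^ (j + 1)‖ + ‖A - B‖ * ‖B ^ (j + 1)‖ :=
          (norm_add_le _ _).trans (add_le_add (norm_mul_le _ _) (norm_mul_le _ _))
      _ ≤ κ * ((j + 1) * κ ^ j * δ) + δ * κ ^ (j + 1) :=
          add_le_add (mul_le_mul hA ih (norm_nonneg _) hκ) (mul_le_mul hAB h2 (norm_nonneg _) hδ)
      _ = _ := by push_cast; ring

/-- The constant of the convergence rate in the small noise regime. -/
noncomputable def rateConst (r τ : ℝ) : ℝ :=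
  errorConst τ (⌊r - 1 / 2⌋₊ + 1) * (⌊r - 1 / 2⌋₊ + 2) ^ 2 * (32 * τ) ^ (2 * r)

variable [CompleteSpace H]

/-- The norm of `T v` through the perturbed operator; the price is the term `δ ‖v‖ ^ 2`, which the
error bounds for the iterates control. -/
theorem norm_apply_sq_le {E : Type u} [NormedAddCommGroup E] [InnerProductSpace ℝ E]
    [CompleteSpace E] (T : H →L[ℝ] E) {A : H →L[ℝ] H} {δ : ℝ}
    (hA : ‖A - T.adjoint ∘L T‖ ≤ δ) (v : H) : ‖T v‖ ^ 2 ≤ inner ℝ (A v) v + δ * ‖v‖ ^ 2 := by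
  have h1 : ‖T v‖ ^ 2 = inner ℝ ((T.adjoint ∘L T) v) v := by
    rw [← real_inner_self_eq_norm_sq, ContinuousLinearMap.comp_apply,
      ContinuousLinearMap.adjoint_inner_left]
  have h2 : inner ℝ ((T.adjoint ∘L T) v) v = inner ℝ (A v) v
      - inner ℝ ((A - T.adjoint ∘L T) v) v := by
    rw [sub_apply, inner_sub_left]; ring
  have h3 : |inner ℝ ((A - T.adjoint ∘L T) v) v| ≤ δ * ‖v‖ ^ 2 :=
    calc _ ≤ ‖(A - T.adjoint ∘L T) v‖ * ‖v‖ := abs_real_inner_le_norm _ _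
      _ ≤ δ * ‖v‖ * ‖v‖ := mul_le_mul_of_nonneg_right
          (ContinuousLinearMap.le_of_opNorm_le _ hA v) (norm_nonneg _)
      _ = _ := by ring
  rw [h1, h2]
  linarith [neg_le_of_abs_le h3]

/-- If the operator and data perturbations are of relative order `η ≤ 1`, the modified discrepancy
principle achieves the rate `η ^ (4 r / (2 r + 1))`. The cut-off level is `σ = 32 τ κ η ^ (1 /
(r + 1 / 2))`, at which the noise term `η / s` balances the approximation error `s ^ (r - 1 / 2)`
for `s = σ / κ`. -/
theorem source_error_le {E : Type u} [NormedAddCommGroup E] [InnerProductSpace ℝ E]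
    [CompleteSpace E] (T : H →L[ℝ] E) {κ : ℝ} (hκ : 0 < κ) (hT : ‖T‖ ^ 2 ≤ κ) {r : ℝ}
    (hr : 1 / 2 ≤ r) {w f : E} (hf : IsSpectralPowerImage (T ∘L T.adjoint) r w f) {ρ : ℝ}
    (hw : ‖w‖ ≤ κ ^ (-r) * ρ) {A : H →L[ℝ] H} (hA : (A : H →ₗ[ℝ] H).IsSymmetric)
    (hpos : ∀ f, 0 ≤ inner ℝ (A f) f) (hAκ : ‖A‖ ≤ κ) (V : Submodule ℝ H) [FiniteDimensional ℝ V]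
    (hV : ∀ f, A f ∈ V) {b : H} (hb : ∀ f, A f = 0 → inner ℝ f b = 0) (hbV : b ∈ V)
    {q : ℕ → ℝ[X]} (hq : ∀ m, IsKrylovMinimizer A b m (q m)) {τ η δ ε M : ℝ} (hτ : 1 < τ)
    (hη : 0 < η) (hη1 : η ≤ 1) (hM : 0 ≤ M) (hδ : 0 < δ) (hδη : δ ≤ 4 * κ * η) (hε : 0 < ε)
    (hεη : ε ≤ 4 * M * √κ * η) (hAT : ‖A - T.adjoint ∘L T‖ ≤ δ) (hbT : ‖b - T.adjoint f‖ ≤ ε)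
    {m₀ m₁ : ℕ}
    (hm₀ : ‖b - A (aeval A (q m₀) b)‖ < τ * (δ * ‖aeval A (q m₀) b‖ + ε))
    (hmin : ∀ m < m₀, ¬ ‖b - A (aeval A (q m) b)‖ < τ * (δ * ‖aeval A (q m) b‖ + ε))
    (hm₁ : ((2 * τ)⁻¹ * δ⁻¹ ≤ (q m₀).eval 0 ∧ m₁ = m₀ - 1) ∨
      ((q m₀).eval 0 < (2 * τ)⁻¹ * δ⁻¹ ∧ m₁ = m₀)) :
    ‖T (aeval A (q m₁) b) - f‖ ^ 2
      ≤ rateConst r τ * (M + ρ) ^ 2 * (η ^ 2) ^ (2 * r / (2 * r + 1)) := by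
  obtain ⟨h, rfl, hh, hdec⟩ := exists_source_decomposition T hκ hT hr hf
  have hτ0 : 0 < τ := by linarith
  have hsκ : 0 < √κ := Real.sqrt_pos.2 hκ
  have hss : √κ * √κ = κ := Real.mul_self_sqrt hκ.le
  have hκs : κ * (√κ)⁻¹ = √κ := by rw [← div_eq_mul_inv, Real.div_sqrt]
  have hρ : 0 ≤ ρ := by
    have h1 := (norm_nonneg w).trans hw
    have h2 : 0 < κ ^ (-r) := by positivity
    exact nonneg_of_mul_nonneg_right h1 h2
  obtain ⟨μ, hμ⟩ : ∃ μ, μ = r - 1 / 2 := ⟨_, rfl⟩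
  rw [← hμ] at hh hdec
  have hμ0 : 0 ≤ μ := by linarith
  obtain ⟨j, hj⟩ : ∃ j, j = ⌊μ⌋₊ := ⟨_, rfl⟩
  have hjμ : (j : ℝ) ≤ μ := hj ▸ Nat.floor_le hμ0
  have hμj : μ ≤ ((j + 1 : ℕ) : ℝ) := by
    rw [hj]; push_cast; exact (Nat.lt_floor_add_one μ).le
  have hκw : κ ^ μ * ‖w‖ ≤ (√κ)⁻¹ * ρ := by
    refine (mul_le_mul_of_nonneg_left hw (by positivity)).trans_eq ?_
    rw [← mul_assoc, ← Real.rpow_add hκ, Real.sqrt_eq_rpow, ← Real.rpow_neg hκ.le]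
    congr 2
    rw [hμ]; ring
  have hhρ : ‖h‖ ≤ (√κ)⁻¹ * ρ := hh.trans hκw
  obtain ⟨s, hs⟩ : ∃ s, s = 32 * τ * η ^ (1 / (μ + 1)) := ⟨_, rfl⟩
  have hs0 : 0 < s := by rw [hs]; positivity
  have hB1 : 1 ≤ 32 * τ := by linarith
  have hsη : 32 * τ * η ≤ s := by
    rw [hs]
    refine mul_le_mul_of_nonneg_left ?_ (by positivity)
    nth_rewrite 1 [← Real.rpow_one η]
    exact Real.rpow_le_rpow_of_exponent_ge hη hη1 (by rw [div_le_one (by linarith)]; linarith)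
  have hspow : 4 * η ≤ s ^ (μ + 1) := by
    rw [hs, Real.mul_rpow (by positivity) (by positivity), ← Real.rpow_mul hη.le,
      one_div_mul_cancel (by linarith), Real.rpow_one]
    refine mul_le_mul_of_nonneg_right ?_ hη.le
    calc (4 : ℝ) ≤ (32 * τ) ^ (1 : ℝ) := by rw [Real.rpow_one]; linarith
      _ ≤ _ := Real.rpow_le_rpow_of_exponent_le hB1 (by linarith)
  obtain ⟨σ, hσ⟩ : ∃ σ, σ = κ * s := ⟨_, rfl⟩
  have hσ0 : 0 < σ := by rw [hσ]; positivity
  obtain ⟨g, hg, hz, hg0⟩ := hdec σ hσ0 (j + 1) hμj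
  have hσw : σ ^ μ * ‖w‖ ≤ (√κ)⁻¹ * s ^ μ * ρ := by
    rw [hσ, Real.mul_rpow hκ.le hs0.le]
    calc κ ^ μ * s ^ μ * ‖w‖ = s ^ μ * (κ ^ μ * ‖w‖) := by ring
      _ ≤ s ^ μ * ((√κ)⁻¹ * ρ) := mul_le_mul_of_nonneg_left hκw (by positivity)
      _ = _ := by ring
  obtain ⟨D, hD⟩ : ∃ D, D = (√κ)⁻¹ * s ^ μ * (M + ρ) := ⟨_, rfl⟩
  have hD0 : 0 ≤ D := by rw [hD]; positivity
  have hDj : D ≤ (j + 2) * D := by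
    have h1 := mul_nonneg (Nat.cast_nonneg j : (0 : ℝ) ≤ j) hD0
    linarith
  have hσwD : σ ^ μ * ‖w‖ ≤ D := hσw.trans
    (hD ▸ mul_le_mul_of_nonneg_left (by linarith) (by positivity))
  have hgD : σ ^ (j + 1) * ‖g‖ ≤ D := by
    refine le_trans ?_ hσwD
    calc σ ^ (j + 1) * ‖g‖ ≤ σ ^ (j + 1) * (σ ^ (μ - ((j + 1 : ℕ) : ℝ)) * ‖w‖) :=
          mul_le_mul_of_nonneg_left hg (by positivity)
      _ = _ := by
        rw [← mul_assoc, ← Real.rpow_natCast σ (j + 1), ← Real.rpow_add hσ0]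
        congr 2
        ring
  have hTn : ‖T.adjoint ∘L T‖ ≤ κ := by
    refine (ContinuousLinearMap.opNorm_comp_le _ _).trans ?_
    rw [LinearIsometryEquiv.norm_map, ← sq]
    exact hT
  -- `A ^ (j + 1)` replaces the power of the population operator in the decomposition of `h`
  have hzD : ‖h - (A ^ (j + 1)) g‖ ≤ (j + 2) * D := by
    have h1 : ‖((A ^ (j + 1)) - (T.adjoint ∘L T) ^ (j + 1)) g‖ ≤ (j + 1) * D := by
      -- for `s > 1` the bound `4 η ≤ s ^ (j + 1)` might fail, but then `g = 0`
      rcases le_or_gt κ σ with hκσ | hκσ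
      · rw [hg0 hκσ, map_zero, norm_zero]; positivity
      have hs1 : s ≤ 1 := by
        by_contra hcon
        rw [hσ] at hκσ
        nlinarith
      have h2 : 4 * η ≤ s ^ (j + 1) := by
        refine hspow.trans ?_
        rw [← Real.rpow_natCast s (j + 1)]
        exact Real.rpow_le_rpow_of_exponent_ge hs0 hs1 (by push_cast; linarith)
      calc _ ≤ (j + 1) * κ ^ j * δ * ‖g‖ := ContinuousLinearMap.le_of_opNorm_le _
            (norm_pow_sub_pow_le hAκ hTn hAT j) g
        _ ≤ (j + 1) * κ ^ j * (4 * κ * η) * ‖g‖ := by gcongr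
        _ = (j + 1) * (κ ^ (j + 1) * (4 * η) * ‖g‖) := by ring
        _ ≤ (j + 1) * (κ ^ (j + 1) * s ^ (j + 1) * ‖g‖) := by gcongr
        _ = (j + 1) * (σ ^ (j + 1) * ‖g‖) := by rw [hσ, mul_pow κ]
        _ ≤ (j + 1) * D := by gcongr
    have h2 : h - (A ^ (j + 1)) g = (h - ((T.adjoint ∘L T) ^ (j + 1)) g)
        - ((A ^ (j + 1)) - (T.adjoint ∘L T) ^ (j + 1)) g := by
      rw [sub_apply]; abel
    rw [h2]
    refine (norm_sub_le _ _).trans ((add_le_add (hz.trans hσwD) h1).trans_eq ?_)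
    ring
  have he : ‖b - A h‖ ≤ ε + δ * ‖h‖ := by
    have h1 : b - A h = (b - T.adjoint (T h)) - (A - T.adjoint ∘L T) h := by
      rw [sub_apply, ContinuousLinearMap.comp_apply]; abel
    rw [h1]
    exact (norm_sub_le _ _).trans (add_le_add hbT (ContinuousLinearMap.le_of_opNorm_le _ hAT h))
  have hN : ε + δ * ‖h‖ ≤ σ * ((j + 2) * D) := by
    calc ε + δ * ‖h‖ ≤ 4 * M * √κ * η + 4 * κ * η * ((√κ)⁻¹ * ρ) :=
          add_le_add hεη (mul_le_mul hδη hhρ (norm_nonneg _) (by positivity))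
      _ = √κ * (4 * η) * (M + ρ) := by
          linear_combination (4 * η * ρ) * hκs
      _ ≤ √κ * s ^ (μ + 1) * (M + ρ) := by gcongr
      _ = σ * D := by
          rw [hσ, hD, Real.rpow_add hs0, Real.rpow_one]
          linear_combination (-(s ^ μ * s * (M + ρ))) * hκs
      _ ≤ σ * ((j + 2) * D) := mul_le_mul_of_nonneg_left hDj hσ0.le
  have hbA : δ * (8 * τ) ≤ σ := by
    calc δ * (8 * τ) ≤ 4 * κ * η * (8 * τ) := by gcongr
      _ = κ * (32 * τ * η) := by ring
      _ ≤ σ := by rw [hσ]; exact mul_le_mul_of_nonneg_left hsη hκ.le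
  -- a finite dimensional space, invariant since it contains the range of `A`
  set W : Submodule ℝ H := V ⊔ Submodule.span ℝ {h, g} with hW
  have : FiniteDimensional ℝ (Submodule.span ℝ {h, g}) :=
    FiniteDimensional.span_of_finite ℝ (Set.toFinite _)
  have hVW : V ≤ W := le_sup_left
  have hspW : Submodule.span ℝ {h, g} ≤ W := le_sup_right
  have key := operator_error_le hA hpos W (fun f _ => hVW (hV f)) hb (hVW hbV) hq (Z := (j + 2) * D)
    hτ hδ hε hσ0 hbA (hspW (Submodule.subset_span (by simp)) : h ∈ W)
    (hspW (Submodule.subset_span (by simp)) : g ∈ W) he hN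
    (hgD.trans hDj) hzD hm₀ hmin hm₁
  rw [← map_sub]
  refine ((norm_apply_sq_le T hAT _).trans key).trans_eq ?_
  have h1 : σ * D ^ 2 = s ^ (2 * r) * (M + ρ) ^ 2 := by
    have h2 : s ^ (2 * r) = s * (s ^ μ) ^ 2 := by
      rw [show 2 * r = 1 + μ + μ by rw [hμ]; ring, Real.rpow_add hs0, Real.rpow_add hs0,
        Real.rpow_one]
      ring
    have h4 : κ * (√κ)⁻¹ * (√κ)⁻¹ = 1 := by rw [hκs, mul_inv_cancel₀ hsκ.ne']
    rw [h2, hσ, hD]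
    linear_combination (s * (s ^ μ) ^ 2 * (M + ρ) ^ 2) * h4
  have h3 : s ^ (2 * r) = (32 * τ) ^ (2 * r) * (η ^ 2) ^ (2 * r / (2 * r + 1)) := by
    rw [hs, Real.mul_rpow (by positivity) (by positivity), ← Real.rpow_mul hη.le,
      ← Real.rpow_natCast η 2, ← Real.rpow_mul hη.le]
    congr 2
    have h5 : 2 * r + 1 ≠ 0 := by linarith
    have h6 : μ + 1 = (2 * r + 1) / 2 := by rw [hμ]; ring
    rw [h6]
    push_cast
    field_simp
  calc errorConst τ (j + 1) * σ * ((j + 2) * D) ^ 2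
      = errorConst τ (j + 1) * (j + 2) ^ 2 * (σ * D ^ 2) := by ring
    _ = _ := by rw [h1, h3, rateConst, ← hμ, ← hj]; ring

end SourceError

/-! ### The stopped kernel conjugate gradient method -/

section Sample

variable {𝒳 : Type u} {H : Type v} [NormedAddCommGroup H] [InnerProductSpace ℝ H]
  {n : ℕ} {φ : 𝒳 → H} {κ : ℝ}

theorem inner_sampleOp_self_nonneg (φ : 𝒳 → H) (x : Fin n → 𝒳) (f : H) :
    0 ≤ inner ℝ (sampleOp φ x f) f := by
  rw [real_inner_comm, inner_sampleOp]
  exact mul_nonneg (by positivity) (Finset.sum_nonneg fun i _ => mul_self_nonneg _)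

theorem inner_sampleSum_eq_zero (hn : 0 < n) {x : Fin n → 𝒳} {f : H} (hf : sampleOp φ x f = 0)
    (a : Fin n → ℝ) : inner ℝ f (sampleSum φ x a) = 0 := by
  have hn0 : (0 : ℝ) < n := by exact_mod_cast hn
  have h1 := inner_sampleOp φ x f f
  rw [hf, inner_zero_right] at h1
  have h2 : ∑ i, inner ℝ (φ (x i)) f * inner ℝ (φ (x i)) f = 0 := by
    rcases mul_eq_zero.1 h1.symm with h | h
    · exact absurd h (by positivity)
    · exact h
  have h3 := (Finset.sum_eq_zero_iff_of_nonneg fun i _ => mul_self_nonneg _).1 h2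
  rw [inner_sampleSum, Finset.sum_eq_zero, mul_zero]
  intro i hi
  rw [mul_self_eq_zero.1 (h3 i hi), mul_zero]

theorem sampleSum_mem_span (φ : 𝒳 → H) (x : Fin n → 𝒳) (a : Fin n → ℝ) :
    sampleSum φ x a ∈ Submodule.span ℝ (Set.range fun i => φ (x i)) :=
  Submodule.smul_mem _ _ (Submodule.sum_mem _ fun i _ =>
    Submodule.smul_mem _ _ (Submodule.subset_span ⟨i, rfl⟩))

theorem krylov_zero (K : Matrix (Fin n) (Fin n) ℝ) (Y : Fin n → ℝ) : krylov K Y 0 = ⊥ := by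
  simp [krylov]

variable [MeasurableSpace 𝒳]

theorem norm_sampleSum_le (hφ : IsFeatureMap φ κ) (hn : 0 < n) (x : Fin n → 𝒳) {a : Fin n → ℝ}
    {M : ℝ} (ha : ∀ i, |a i| ≤ M) : ‖sampleSum φ x a‖ ≤ M * √κ := by
  have hn0 : (0 : ℝ) < n := by exact_mod_cast hn
  rw [sampleSum, norm_smul, norm_inv, Real.norm_natCast, inv_mul_le_iff₀ hn0]
  refine (norm_sum_le _ _).trans ((Finset.sum_le_card_nsmul _ _ (M * √κ) fun i _ => ?_).trans_eq ?_)
  · rw [norm_smul]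
    exact mul_le_mul (ha i) (hφ.norm_le _) (norm_nonneg _) ((abs_nonneg _).trans (ha i))
  · simp

theorem norm_sampleOp_le (hφ : IsFeatureMap φ κ) (hκ : 0 ≤ κ) (hn : 0 < n) (x : Fin n → 𝒳) :
    ‖sampleOp φ x‖ ≤ κ := by
  refine ContinuousLinearMap.opNorm_le_bound _ hκ fun f => ?_
  rw [sampleOp_apply]
  refine (norm_sampleSum_le hφ hn x fun i => hφ.abs_inner_le (x i) f).trans_eq ?_
  rw [mul_right_comm, Real.mul_self_sqrt hκ]

variable [CompleteSpace H]

/-- On the event where the sampling operators concentrate, the stopped iterate achieves the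
optimal rate. -/
theorem stopped_error_le (hφ : IsFeatureMap φ κ) (hκ : 0 < κ) (ν : Measure 𝒳)
    [IsProbabilityMeasure ν] {k : 𝒳 → 𝒳 → ℝ} (hkφ : ∀ s t, k s t = inner ℝ (φ t) (φ s)) {r τ : ℝ}
    (hr : 1 / 2 ≤ r) (hτ : 1 < τ) (hn : 0 < n) {γ : ℝ} (hγ : 1 ≤ Real.log (2 / γ)) {M ρ : ℝ}
    (hM : 0 < M) {fstar : 𝒳 → ℝ} (hf : MemLp fstar 2 ν) {w : Lp ℝ 2 ν}
    (hw : IsSpectralPowerImage (hφ.toL2 ν ∘L (hφ.toL2 ν).adjoint) r w (hf.toLp fstar))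
    (hwρ : ‖w‖ ≤ κ ^ (-r) * ρ) {x : Fin n → 𝒳} {Y : Fin n → ℝ} (hY : ∀ i, |Y i| ≤ M)
    (hA : ‖sampleOp φ x - (hφ.toL2 ν).adjoint ∘L hφ.toL2 ν‖ ≤ noiseLevel n κ γ)
    (hb : ‖sampleSum φ x Y - (hφ.toL2 ν).adjoint (hf.toLp fstar)‖ ≤ dataNoiseLevel n κ M γ)
    {α : ℕ → Fin n → ℝ} {q : ℕ → ℝ[X]} (hcg : IsCGSequence (kernelMatrix k x) Y α q) :
    (∃ m, DiscrepancyHolds τ κ M γ k x Y (α m)) ∧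
      ∫ t, (kernelExpansion k x (α (modifiedStop τ κ M γ k x Y α q)) t - fstar t) ^ 2 ∂ν
        ≤ (rateConst r τ + 1) * (M + ρ) ^ 2
          * ((Real.log (2 / γ) / √n) ^ 2) ^ (2 * r / (2 * r + 1)) := by
  have hn0 : (0 : ℝ) < n := by exact_mod_cast hn
  have hsn : 0 < √(n : ℝ) := Real.sqrt_pos.2 hn0
  have hτ0 : 0 < τ := by linarith
  have hsκ : 0 < √κ := Real.sqrt_pos.2 hκ
  have hL0 : 0 ≤ Real.log (2 / γ) := by linarith
  obtain ⟨η, hη⟩ : ∃ η, η = Real.log (2 / γ) / √n := ⟨_, rfl⟩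
  have hη0 : 0 < η := by rw [hη]; exact div_pos (by linarith) hsn
  obtain ⟨δ, hδ⟩ : ∃ δ, δ = noiseLevel n κ γ := ⟨_, rfl⟩
  obtain ⟨ε, hε⟩ : ∃ ε, ε = dataNoiseLevel n κ M γ := ⟨_, rfl⟩
  have hδ0 : 0 < δ := by
    rw [hδ, noiseLevel]
    have : 0 < Real.log (2 / γ) / n := div_pos (by linarith) hn0
    positivity
  have hδη : δ ≤ 4 * κ * η := by
    rw [hδ, noiseLevel, hη, Real.sqrt_div hL0]
    have h1 : √(Real.log (2 / γ)) ≤ Real.log (2 / γ) := by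
      rw [Real.sqrt_le_left hL0]
      nlinarith
    gcongr
  have hεη : ε = 4 * M * √κ * η := by rw [hε, dataNoiseLevel, hη]; ring
  have hε0 : 0 < ε := by rw [hεη]; positivity
  have hdisc : ∀ a, DiscrepancyHolds τ κ M γ k x Y a ↔
      ‖sampleSum φ x Y - sampleOp φ x (sampleSum φ x a)‖ < τ * (δ * ‖sampleSum φ x a‖ + ε) :=
    fun a => by rw [hδ, hε]; exact discrepancyHolds_iff hkφ hκ.le hL0 τ M x Y a
  have hα : ∀ m, sampleSum φ x (α m) = aeval (sampleOp φ x) (q m) (sampleSum φ x Y) := fun m => by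
    rw [hcg.eq_aeval m, sampleSum_aeval_kernelMatrix hkφ]
  have hq := hcg.isKrylovMinimizer hkφ
  set V := Submodule.span ℝ (Set.range fun i => φ (x i)) with hV
  have : FiniteDimensional ℝ V := FiniteDimensional.span_of_finite ℝ (Set.finite_range _)
  have hAV : ∀ f, sampleOp φ x f ∈ V := fun f => by
    rw [sampleOp_apply]; exact sampleSum_mem_span φ x _
  have hker : ∀ f, sampleOp φ x f = 0 → inner ℝ f (sampleSum φ x Y) = 0 :=
    fun f h0 => inner_sampleSum_eq_zero hn h0 Y
  have hpos := inner_sampleOp_self_nonneg φ x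
  have hsym := sampleOp_isSymmetric φ x
  have hex : ∃ m, DiscrepancyHolds τ κ M γ k x Y (α m) := by
    simp only [hdisc, hα]
    exact exists_discrepancy hsym hpos V (fun f _ => hAV f) hker (sampleSum_mem_span φ x Y) hq hτ0
      hδ0.le hε0
  refine ⟨hex, ?_⟩
  obtain ⟨m₀, hm₀⟩ : ∃ m₀, m₀ = discrepancyStop τ κ M γ k x Y α := ⟨_, rfl⟩
  obtain ⟨m₁, hm₁⟩ : ∃ m₁, m₁ = modifiedStop τ κ M γ k x Y α q := ⟨_, rfl⟩
  have hst : DiscrepancyHolds τ κ M γ k x Y (α m₀) := by rw [hm₀]; exact Nat.sInf_mem hex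
  have hmin : ∀ m < m₀, ¬ DiscrepancyHolds τ κ M γ k x Y (α m) := fun m hm hd =>
    Nat.notMem_of_lt_sInf (hm.trans_eq hm₀) hd
  have hcase : ((2 * τ)⁻¹ * δ⁻¹ ≤ (q m₀).eval 0 ∧ m₁ = m₀ - 1) ∨
      ((q m₀).eval 0 < (2 * τ)⁻¹ * δ⁻¹ ∧ m₁ = m₀) := by
    rw [hm₁, modifiedStop, ← hm₀, ← hδ]
    split_ifs with h
    · exact Or.inl ⟨h, rfl⟩
    · exact Or.inr ⟨not_le.1 h, rfl⟩
  have herr : ∫ t, (kernelExpansion k x (α m₁) t - fstar t) ^ 2 ∂ν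
      = ‖hφ.toL2 ν (sampleSum φ x (α m₁)) - hf.toLp fstar‖ ^ 2 := by
    rw [hφ.norm_toL2_sub_sq ν _ hf]
    simp only [kernelExpansion_eq_inner hkφ]
  rw [← hm₁, herr, ← hη]
  have hp0 : 0 ≤ (η ^ 2) ^ (2 * r / (2 * r + 1)) := by positivity
  have hT := hφ.toL2_norm_sq_le hκ.le ν
  have hρ : 0 ≤ ρ := by
    have h2 : 0 < κ ^ (-r) := by positivity
    exact nonneg_of_mul_nonneg_right ((norm_nonneg w).trans hwρ) h2
  have hrate : 0 ≤ rateConst r τ := by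
    unfold rateConst errorConst
    positivity
  rcases le_or_gt η 1 with hη1 | hη1
  · have key := source_error_le (hφ.toL2 ν) hκ hT hr hw hwρ hsym hpos (norm_sampleOp_le hφ hκ.le hn x)
      V hAV hker (sampleSum_mem_span φ x Y) hq hτ hη0 hη1 hM.le hδ0 hδη hε0 hεη.le (hδ ▸ hA)
      (hε ▸ hb) (m₀ := m₀) (m₁ := m₁) (by rw [← hα, ← hdisc]; exact hst)
      (fun m hm => by rw [← hα, ← hdisc]; exact hmin m hm) hcase
    rw [hα]
    refine key.trans ?_
    gcongr
    linarith
  · -- For `η > 1` the discrepancy condition already holds for the zero function.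
    have hα0 : α 0 = 0 := by
      have h1 := hcg.mem 0
      rwa [krylov_zero, Submodule.mem_bot] at h1
    have hs0 : sampleSum φ x (α 0) = 0 := by
      rw [hα0]; exact map_zero (sampleSumLin φ x)
    have hd0 : DiscrepancyHolds τ κ M γ k x Y (α 0) := by
      rw [hdisc, hs0, map_zero, sub_zero, norm_zero, mul_zero, zero_add, hεη]
      refine (norm_sampleSum_le hφ hn x hY).trans_lt ?_
      have h1 : 0 < M * √κ := by positivity
      have h2 : 1 < τ * (4 * η) := by nlinarith
      nlinarith
    have hm₀0 : m₀ = 0 := by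
      by_contra h
      exact hmin 0 (Nat.pos_of_ne_zero h) hd0
    have hm₁0 : m₁ = 0 := by
      rcases hcase with ⟨-, h⟩ | ⟨-, h⟩ <;> simp [h, hm₀0]
    rw [hm₁0, hs0, map_zero, zero_sub, norm_neg]
    obtain ⟨h, hTh, hh, -⟩ := exists_source_decomposition (hφ.toL2 ν) hκ hT hr hw
    have h1 : ‖hf.toLp fstar‖ ^ 2 ≤ ρ ^ 2 := by
      have h2 : ‖h‖ ≤ κ ^ (-(1 / 2 : ℝ)) * ρ := by
        refine hh.trans ((mul_le_mul_of_nonneg_left hwρ (by positivity)).trans_eq ?_)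
        rw [← mul_assoc, ← Real.rpow_add hκ]
        congr 2
        ring
      calc ‖hf.toLp fstar‖ ^ 2 ≤ (‖hφ.toL2 ν‖ * ‖h‖) ^ 2 := by
            rw [← hTh]
            exact pow_le_pow_left₀ (norm_nonneg _) (ContinuousLinearMap.le_opNorm _ _) 2
        _ = ‖hφ.toL2 ν‖ ^ 2 * ‖h‖ ^ 2 := mul_pow _ _ _
        _ ≤ κ * (κ ^ (-(1 / 2 : ℝ)) * ρ) ^ 2 := by gcongr
        _ = (κ ^ (1 : ℝ) * (κ ^ (-(1 / 2 : ℝ)) * κ ^ (-(1 / 2 : ℝ)))) * ρ ^ 2 := by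
            rw [Real.rpow_one]; ring
        _ = ρ ^ 2 := by
            rw [← Real.rpow_add hκ, ← Real.rpow_add hκ]; norm_num
    have h2 : 1 ≤ (η ^ 2) ^ (2 * r / (2 * r + 1)) :=
      Real.one_le_rpow (by nlinarith) (div_nonneg (by linarith) (by linarith))
    calc ‖hf.toLp fstar‖ ^ 2 ≤ ρ ^ 2 := h1
      _ ≤ 1 * (M + ρ) ^ 2 * 1 := by nlinarith
      _ ≤ _ := by
        gcongr
        linarith

end Sample

/-- For `γ < 1 / 2` the concentration bounds are dominated by the noise levels. -/
theorem one_add_sqrt_log_le {γ : ℝ} (hγ : 0 < γ) (hγ2 : γ < 1 / 2) :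
    1 ≤ Real.log (2 / γ) ∧ Real.log (2 / γ) ≤ 2 * Real.log γ⁻¹ ∧
      1 + √(2 * Real.log γ⁻¹) ≤ 4 * √(Real.log (2 / γ)) := by
  have hlog : Real.log (2 / γ) = Real.log 2 + Real.log γ⁻¹ := by
    rw [div_eq_mul_inv, Real.log_mul two_ne_zero (inv_ne_zero hγ.ne')]
  have h2 : (2 : ℝ) ≤ γ⁻¹ := by
    rw [le_inv_comm₀ two_pos hγ]; linarith
  have h3 : Real.log 2 ≤ Real.log γ⁻¹ := Real.log_le_log two_pos h2
  have h4 := Real.log_two_gt_d9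
  have h5 : 1 ≤ Real.log (2 / γ) := by linarith
  refine ⟨h5, by linarith, ?_⟩
  have h6 : 1 ≤ √(Real.log (2 / γ)) := Real.one_le_sqrt.2 h5
  have h7 : √(2 * Real.log γ⁻¹) ≤ 2 * √(Real.log (2 / γ)) := by
    rw [Real.sqrt_le_left (by positivity), mul_pow, Real.sq_sqrt (by linarith)]
    linarith
  linarith

theorem theorem1 (r τ : ℝ) (hr : 1 / 2 ≤ r) (hτ : 1 < τ) :
    ∃ c : ℝ, 0 < c ∧
      ∀ (𝒳 : Type u) [MeasurableSpace 𝒳] (H : Type v) [NormedAddCommGroup H]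
        [InnerProductSpace ℝ H] [CompleteSpace H] [TopologicalSpace.SeparableSpace H]
        [RKHS ℝ H 𝒳 ℝ]
        (hk : Measurable (Function.uncurry (rkhsKernel (𝒳 := 𝒳) H)))
        (κ : ℝ) (_ : 0 < κ) (hκ : ∀ x : 𝒳, rkhsKernel H x x ≤ κ)
        (P : Measure (𝒳 × ℝ)) [IsProbabilityMeasure P]
        (M : ℝ) (_ : 0 < M) (_ : ∀ᵐ z ∂P, |z.2| ≤ M)
        (fstar : 𝒳 → ℝ) (hf : MemLp fstar 2 P.fst)
        (_ : P[fun z => z.2 | MeasurableSpace.comap Prod.fst inferInstance]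
          =ᵐ[P] fun z => fstar z.1)
        (ρ : ℝ)
        (_ : ∃ w : Lp ℝ 2 P.fst,
          IsSpectralPowerImage
            (kernelOp P.fst (rkhsKernel H) hk κ (abs_rkhsKernel_le hκ)) r w (hf.toLp fstar) ∧
          ‖w‖ ≤ κ ^ (-r) * ρ)
        (γ : ℝ) (_ : 0 < γ) (_ : γ < 1) (n : ℕ) (_ : 1 ≤ n),
        ∃ E : Set (Fin n → 𝒳 × ℝ), MeasurableSet E ∧
          ENNReal.ofReal (1 - 2 * γ) ≤ Measure.pi (fun _ : Fin n => P) E ∧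
          ∀ z ∈ E,
            let x : Fin n → 𝒳 := fun i => (z i).1
            let Y : Fin n → ℝ := fun i => (z i).2
            (∃ (α : ℕ → Fin n → ℝ) (q : ℕ → ℝ[X]),
              IsCGSequence (kernelMatrix (rkhsKernel H) x) Y α q) ∧
            ∀ (α : ℕ → Fin n → ℝ) (q : ℕ → ℝ[X]),
              IsCGSequence (kernelMatrix (rkhsKernel H) x) Y α q →
              (∃ m, DiscrepancyHolds τ κ M γ (rkhsKernel H) x Y (α m)) ∧
              ∫ t, (kernelExpansion (rkhsKernel H) x
                  (α (modifiedStop τ κ M γ (rkhsKernel H) x Y α q)) t - fstar t) ^ 2 ∂P.fst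
                ≤ c * (M + ρ) ^ 2 * (Real.log γ⁻¹ ^ 2 / n) ^ (2 * r / (2 * r + 1)) := by
  have hrate : 0 ≤ rateConst r τ := by
    unfold rateConst errorConst
    have : 0 < τ := by linarith
    positivity
  refine ⟨(rateConst r τ + 1) * 4, by positivity, ?_⟩
  intro 𝒳 _ H _ _ _ _ _ hk κ hκ0 hκ P _ M hM hY fstar hf hreg ρ hsrc γ hγ hγ1 n hn
  obtain ⟨w, hw, hwρ⟩ := hsrc
  rcases le_or_gt (1 / 2) γ with hγ2 | hγ2
  · -- Nothing is claimed when `1 - 2 * γ ≤ 0`.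
    refine ⟨∅, MeasurableSet.empty, ?_, fun z hz => absurd hz (Set.notMem_empty z)⟩
    rw [ENNReal.ofReal_eq_zero.2 (by linarith)]
    exact zero_le
  obtain ⟨hL1, hL2, hL3⟩ := one_add_sqrt_log_le hγ hγ2
  have hn0 : (0 : ℝ) < n := by exact_mod_cast hn
  have hsn : 0 < √(n : ℝ) := Real.sqrt_pos.2 hn0
  have hφ := isFeatureMap_kerFun hk hκ
  have hkφ := rkhsKernel_eq_inner (𝒳 := 𝒳) (H := H)
  generalize hφdef : (fun x : 𝒳 => RKHS.kerFun H x (1 : ℝ)) = φ at hφ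
  have hkφ' : ∀ s t, rkhsKernel H s t = inner ℝ (φ t) (φ s) := fun s t => by
    rw [hkφ, ← hφdef]
  rw [← hφ.toL2_comp_adjoint P.fst hk (abs_rkhsKernel_le hκ) hkφ'] at hw
  obtain ⟨E, hE, hPE, hEz⟩ := exists_concentration_event hφ hκ0 P hM hY hf hreg hn hγ hγ1
  refine ⟨E, hE, hPE, fun z hz => ?_⟩
  obtain ⟨hzY, hzA, hzb⟩ := hEz z hz
  refine ⟨exists_isCGSequence hkφ' _ _, fun α q hcg => ?_⟩
  have hA : κ / √n * (1 + √(2 * Real.log γ⁻¹)) ≤ noiseLevel n κ γ := by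
    rw [noiseLevel, Real.sqrt_div (by linarith)]
    calc _ ≤ κ / √n * (4 * √(Real.log (2 / γ))) := by gcongr
      _ = _ := by ring
  have hb : M * √κ / √n * (1 + √(2 * Real.log γ⁻¹)) ≤ dataNoiseLevel n κ M γ := by
    have h1 : √(Real.log (2 / γ)) ≤ Real.log (2 / γ) := by
      rw [Real.sqrt_le_left (by linarith)]
      nlinarith
    rw [dataNoiseLevel]
    calc _ ≤ M * √κ / √n * (4 * Real.log (2 / γ)) := by gcongr; linarith
      _ = _ := by ring
  obtain ⟨hex, herr⟩ := stopped_error_le hφ hκ0 P.fst hkφ' hr hτ hn hL1 hM hf hw hwρ hzY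
    (hzA.trans hA) (hzb.trans hb) hcg
  refine ⟨hex, herr.trans ?_⟩
  have hp0 : 0 ≤ 2 * r / (2 * r + 1) := div_nonneg (by linarith) (by linarith)
  have hp1 : 2 * r / (2 * r + 1) ≤ 1 := by rw [div_le_one (by linarith)]; linarith
  have hη : (Real.log (2 / γ) / √n) ^ 2 ≤ 4 * (Real.log γ⁻¹ ^ 2 / n) := by
    rw [div_pow, Real.sq_sqrt hn0.le, ← mul_div_assoc]
    gcongr
    nlinarith
  have hpow : ((Real.log (2 / γ) / √n) ^ 2) ^ (2 * r / (2 * r + 1))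
      ≤ 4 * (Real.log γ⁻¹ ^ 2 / n) ^ (2 * r / (2 * r + 1)) := by
    refine (Real.rpow_le_rpow (sq_nonneg _) hη hp0).trans ?_
    rw [Real.mul_rpow (by norm_num) (by positivity)]
    refine mul_le_mul_of_nonneg_right ?_ (by positivity)
    calc (4 : ℝ) ^ (2 * r / (2 * r + 1)) ≤ 4 ^ (1 : ℝ) :=
          Real.rpow_le_rpow_of_exponent_le (by norm_num) hp1
      _ = 4 := Real.rpow_one 4
  calc _ ≤ (rateConst r τ + 1) * (M + ρ) ^ 2
        * (4 * (Real.log γ⁻¹ ^ 2 / n) ^ (2 * r / (2 * r + 1))) :=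
        mul_le_mul_of_nonneg_left hpow (by positivity)
    _ = _ := by ring
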